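/- Let the service times have a probability distribution on $[0,\infty)$ with mean $b$ and Laplace–Stieltjes transform $B^*(s)=\mathbb E[e^{-sX}]$, and let $-R_{B^*}$ be the abscissa of convergence of $B^*$ ($R_{B^*}=\infty$ if $B^*$ is entire). Assume that the service times are of type 1: $R_{B^*}>0$ and $B^*(s)\to\infty$ as $s\downarrow -R_{B^*}$. Let $\lambda_1,\lambda_2,\nu>0$, $\lambda=\lambda_1+\lambda_2$ and $\rho=\lambda b<1$. A number $R>0$ is called the dominant singularity of a function $f$ analytic at $0$ if $f$ extends analytically to the disc $|z|<R$, and $R$ is the only point of the circle $|z|=R$ to a neighbourhood of which this extension cannot be continued analytically. A $\Delta$-domain at $R$ is a set $\{z: |z|<S,\ z\ne R,\ |\arg(z-R)|>\varphi\}$ with $S>R$ and $0<\varphi<\pi/2$. For $|z|<1$ let $h(z)$ be the root $w$ in $|w|<1$ of $w=B^*(\lambda_1(1-w)+\lambda_2(1-z))$, and extend $h$ by its Taylor series at $0$. Put $$f_1(z)=\frac{1-h(z)}{h(z)-z},\qquad f_2(z)=-\frac{\lambda}{\nu}\int_z^1 f_1(x)\,dx,\qquad Q(z)=(1-\rho)\,e^{f_2(z)}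 .$$ ($Q$ is the partial generating function of the orbit size when the server is idle.) Theorem. The root $h(z)$ exists and is unique for $|z|<1$, and $h$, $f_1$ and $Q$ have dominant singularities $R_h$, $R_{f_1}$ and $R_Q$, with $R_Q=R_{f_1}$. The function $Q$ continues analytically to a $\Delta$-domain at $R_Q$. Let $R^*$ denote the smallest zero of $h(x)-x$ with $1<x\le R_h$, if there is one. Then, as $z\to R_Q$ in this $\Delta$-domain (with principal branches of the powers, and $u\sim v$ meaning $u=v+o(v)$): 1. If $R^*$ exists and $R^*<R_h$, then $R_Q=R^*$ and $$Q(z)\sim c_Q^{(1)}(R_Q-z)^{-\frac{\lambda}{\nu}c_{f_1}^{(1)}} .$$ 2. If $R^*$ does not exist, then $R_Q=R_h$ and $$Q(z)-\Big(Q(R_Q)-(1-\rho)e^{f_2(R_Q)}\tfrac{\lambda}{\nu}f_1(R_Q)(R_Q-z)\Big)\sim c_Q^{(2)}(R_Q-z)^{3/2} .$$ 3. If $R^*$ exists and $R^*=R_h$, then $R_Q=R^*=R_h$ and $$Q(z)-Q(R_Q)\sim -c_Q^{(3)}(R_Q-z)^{1/2} .$$ Here $$c_Q^{(1)}=(1-\rho)(R_Q-1)^{\frac{\lambda}{\nu}c_{f_1}^{(1)}}\exp\Big(-\frac{\lambda}{\nu}\int_{R_Q}^1\Big(f_1(x)-\frac{c_{f_1}^{(1)}}{R_Q-x}\Big)dx\Big),$$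 $$c_Q^{(2)}=(1-\rho)e^{f_2(R_Q)}\frac{2\lambda}{3\nu}c_{f_1}^{(2)},\qquad c_Q^{(3)}=(1-\rho)e^{f_2(R_Q)}\frac{2\lambda}{\nu}c_{f_1}^{(3)},$$ $$c_{f_1}^{(1)}=\frac{(1-R_{f_1})\big(1+\lambda_1 {B^*}'(\lambda(1-R_{f_1}))\big)}{1+\lambda {B^*}'(\lambda(1-R_{f_1}))},\qquad c_{f_1}^{(2)}=\frac{R_{f_1}-1}{(h(R_{f_1})-R_{f_1})^2}\,c_h,\qquad c_{f_1}^{(3)}=\frac{R_{f_1}-1}{c_h},$$ $$c_h=\sqrt{\frac{2\lambda_2}{\lambda_1^3\,{B^*}''\big(\lambda_1(1-h(R_h))+\lambda_2(1-R_h)\big)}} .$$ -/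

import Mathlib

open Real Set Filter Topology MeasureTheory ProbabilityTheory Asymptotics

noncomputable section

namespace PriorityRetrial

/-! ### Service times -/

/-- The Laplace-Stieltjes transform `B*(s) = ∫ exp (-s x) dB(x)` of the service-time
distribution `μ`, for complex `s`. -/
def LST (μ : Measure ℝ) (s : ℂ) : ℂ := complexMGF id μ (-s)

/-- The Laplace-Stieltjes transform at a real argument. -/
def realLST (μ : Measure ℝ) (s : ℝ) : ℝ := mgf id μ (-s)

/-- The number `R_{B*} ∈ [0, ∞]` such that `-R_{B*}` is the abscissa of convergence of the
Laplace-Stieltjes transform, i.e. its dominant singularity (`R_{B*} = ∞` if it is entire). -/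
def RB (μ : Measure ℝ) : EReal := sSup ((fun θ : ℝ => (θ : EReal)) '' integrableExpSet id μ)

/-- Type-1 service times: `R_{B*} > 0` and `B*(s) → ∞` as the real variable `s`
decreases to `-R_{B*}` (which may be `-∞`). -/
def IsType1 (μ : Measure ℝ) : Prop :=
  0 < RB μ ∧
    Tendsto (realLST μ) (comap (fun s : ℝ => (s : EReal)) (𝓝[>] (-RB μ))) atTop

/-- The load `ρ = (λ₁ + λ₂) b` with `b` the mean service time. -/
def load (μ : Measure ℝ) (lam₁ lam₂ : ℝ) : ℝ := (lam₁ + lam₂) * ∫ x, x ∂μ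

/-! ### Singularities -/

/-- `g`, given on `U`, has an analytic continuation to a neighbourhood of `ζ`. -/
def ContinuableAt (g : ℂ → ℂ) (U : Set ℂ) (ζ : ℂ) : Prop :=
  ∃ k : ℂ → ℂ, AnalyticAt ℂ k ζ ∧ k =ᶠ[𝓝[U] ζ] g

/-- The positive number `R` is the (unique) dominant singularity of `f`: the germ of `f` at `0`
extends analytically to the disc of radius `R`, and `R` is the only point of the circle of
radius `R` at which this extension cannot be continued analytically. -/
def IsDominantSingularity (f : ℂ → ℂ) (R : ℝ) : Prop :=
  0 < R ∧ ∃ g : ℂ → ℂ, AnalyticOnNhd ℂ g (Metric.ball 0 R) ∧ g =ᶠ[𝓝 0] f ∧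
    ∀ ζ ∈ Metric.sphere (0 : ℂ) R, ContinuableAt g (Metric.ball 0 R) ζ ↔ ζ ≠ (R : ℂ)

/-- The Delta-domain at `R` with outer radius `S` and angle `φ`. -/
def DeltaDomain (R S φ : ℝ) : Set ℂ :=
  {z : ℂ | ‖z‖ < S ∧ z ≠ (R : ℂ) ∧ φ < |Complex.arg (z - (R : ℂ))|}

/-! ### The functions `h`, `f₁`, `f₂` and `Q` -/

/-- `w` is a root in the open unit disc of `w = B*(λ₁ (1 - w) + λ₂ (1 - z))`. -/
def IsRoot (μ : Measure ℝ) (lam₁ lam₂ : ℝ) (z w : ℂ) : Prop :=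
  ‖w‖ < 1 ∧ w = LST μ ((lam₁ : ℂ) * (1 - w) + (lam₂ : ℂ) * (1 - z))

/-- The root as a function of `z` in the open unit disc. -/
def hRoot (μ : Measure ℝ) (lam₁ lam₂ : ℝ) (z : ℂ) : ℂ :=
  Classical.epsilon (IsRoot μ lam₁ lam₂ z)

/-- The function `h`: the sum of the Taylor series at `0` of the root function. On the open unit
disc it is the root function; elsewhere, where the series converges, it extends the latter. -/
def h (μ : Measure ℝ) (lam₁ lam₂ : ℝ) (z : ℂ) : ℂ :=
  ∑' n : ℕ, iteratedDeriv n (hRoot μ lam₁ lam₂) 0 / (n.factorial : ℂ) * z ^ n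

/-- `f₁(z) = (1 - h(z)) / (h(z) - z)`. -/
def f₁ (μ : Measure ℝ) (lam₁ lam₂ : ℝ) (z : ℂ) : ℂ :=
  (1 - h μ lam₁ lam₂ z) / (h μ lam₁ lam₂ z - z)

/-- `f₂(z) = -(λ/ν) ∫_z^1 f₁(x) dx`, with `λ = λ₁ + λ₂`, integrated along the segment
from `z` to `1`. -/
def f₂ (μ : Measure ℝ) (lam₁ lam₂ ν : ℝ) (z : ℂ) : ℂ :=
  -(((lam₁ + lam₂) / ν : ℝ) : ℂ) *
    ((1 - z) * ∫ t in (0 : ℝ)..1, f₁ μ lam₁ lam₂ (z + (t : ℂ) * (1 - z)))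

/-- `Q(z) = (1 - ρ) exp (-(λ/ν) ∫_z^1 (1 - h(x)) / (h(x) - x) dx)`. -/
def Q (μ : Measure ℝ) (lam₁ lam₂ ν : ℝ) (z : ℂ) : ℂ :=
  ((1 - load μ lam₁ lam₂ : ℝ) : ℂ) * Complex.exp (f₂ μ lam₁ lam₂ ν z)

/-- `r` is the number `R*`: the smallest zero larger than `1` of `h(x) - x`, where `h` is
considered up to and including its dominant singularity `Rh`. -/
def IsRstar (μ : Measure ℝ) (lam₁ lam₂ Rh r : ℝ) : Prop :=
  IsLeast {x : ℝ | 1 < x ∧ x ≤ Rh ∧ h μ lam₁ lam₂ (x : ℂ) = (x : ℂ)} r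

/-! ### The constants

The values of `h`, `f₁`, `f₂` at real points up to the singularity are real numbers, so that
taking their real parts below only changes the type. -/

/-- The constant `c_h`, as a function of the dominant singularity `Rh` of `h`. -/
def cH (μ : Measure ℝ) (lam₁ lam₂ Rh : ℝ) : ℝ :=
  √(2 * lam₂ / (lam₁ ^ 3 *
    iteratedDeriv 2 (realLST μ)
      (lam₁ * (1 - (h μ lam₁ lam₂ (Rh : ℂ)).re) + lam₂ * (1 - Rh))))

/-- The constant `c_{f₁}^{(1)}`, as a function of the dominant singularity `R` of `f₁`. -/
def cF1 (μ : Measure ℝ) (lam₁ lam₂ R : ℝ) : ℝ :=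
  (1 - R) * (1 + lam₁ * deriv (realLST μ) ((lam₁ + lam₂) * (1 - R))) /
    (1 + (lam₁ + lam₂) * deriv (realLST μ) ((lam₁ + lam₂) * (1 - R)))

/-- The constant `c_{f₁}^{(2)}`, in the case that `R` is the dominant singularity of both
`h` and `f₁`. -/
def cF2 (μ : Measure ℝ) (lam₁ lam₂ R : ℝ) : ℝ :=
  (R - 1) / ((h μ lam₁ lam₂ (R : ℂ)).re - R) ^ 2 * cH μ lam₁ lam₂ R

/-- The constant `c_{f₁}^{(3)}`, in the case that `R` is the dominant singularity of both
`h` and `f₁`. -/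
def cF3 (μ : Measure ℝ) (lam₁ lam₂ R : ℝ) : ℝ :=
  (R - 1) / cH μ lam₁ lam₂ R

/-- The constant `c_Q^{(1)}`. -/
def cQ1 (μ : Measure ℝ) (lam₁ lam₂ ν R : ℝ) : ℝ :=
  (1 - load μ lam₁ lam₂) * (R - 1) ^ ((lam₁ + lam₂) / ν * cF1 μ lam₁ lam₂ R) *
    Real.exp (-((lam₁ + lam₂) / ν) *
      ∫ x in R..1, ((f₁ μ lam₁ lam₂ (x : ℂ)).re - cF1 μ lam₁ lam₂ R / (R - x)))

/-- The constant `c_Q^{(2)}`. -/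
def cQ2 (μ : Measure ℝ) (lam₁ lam₂ ν R : ℝ) : ℝ :=
  (1 - load μ lam₁ lam₂) * Real.exp (f₂ μ lam₁ lam₂ ν (R : ℂ)).re *
    (2 * (lam₁ + lam₂) / (3 * ν)) * cF2 μ lam₁ lam₂ R

/-- The constant `c_Q^{(3)}`. -/
def cQ3 (μ : Measure ℝ) (lam₁ lam₂ ν R : ℝ) : ℝ :=
  (1 - load μ lam₁ lam₂) * Real.exp (f₂ μ lam₁ lam₂ ν (R : ℂ)).re *
    (2 * (lam₁ + lam₂) / ν) * cF3 μ lam₁ lam₂ R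

/-- The coefficient `(1 - ρ) exp (f₂(R)) (λ/ν) f₁(R)` of the linear term. -/
def cQlin (μ : Measure ℝ) (lam₁ lam₂ ν R : ℝ) : ℝ :=
  (1 - load μ lam₁ lam₂) * Real.exp (f₂ μ lam₁ lam₂ ν (R : ℂ)).re *
    ((lam₁ + lam₂) / ν) * (f₁ μ lam₁ lam₂ (R : ℂ)).re

end PriorityRetrial

end

open PriorityRetrial

/-!
With `u = λ₁ (h z - 1) + λ₂ (z - 1)` the functional equation of `h` reads `h z = 𝔼[e ^ (u X)]`, so
that `z = 1 + (u + λ₁ (1 - 𝔼[e ^ (u X)])) / λ₂` is an explicit function of `u`. By a contraction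
argument it has an inverse on the half-plane `re z < R`, where `R` is its value at its first
critical point `u₀ > 0`. This half-plane meets the circle `‖z‖ = R` everywhere except at `R`, which
is therefore the only possible singularity there; as the critical point is nondegenerate, `h` is
near `R` an analytic function of `√(R - z)`.

In the variable `u`, the difference `h z - z` vanishes only at `u = 0`, where `f₁` stays regular,
and at the positive root `u*` of `(λ₁ + λ₂) (𝔼[e ^ (u X)] - 1) = u`. According as `u* < u₀`,
`u₀ < u*` or `u* = u₀`, the first singularity of `f₁` is a simple pole, a square-root branch point,
or of the type `(R - z) ^ (-1 / 2)`. Integrating and exponentiating gives the expansions of `Q`.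
-/

namespace PriorityRetrial

/-! ### Moment families -/

/-- The derivatives `M k z = 𝔼[X ^ k e ^ (z X)]` of a moment generating function on the half-plane
`re z < A`, together with their restrictions `m k` to the real axis, abstracted to the properties
that the singularity analysis uses. -/
structure IsMomentFamily (M : ℕ → ℂ → ℂ) (m : ℕ → ℝ → ℝ) (A : ℝ) : Prop where
  hasDerivAt (k : ℕ) (z : ℂ) : z.re < A → HasDerivAt (M k) (M (k + 1) z) z
  ofReal (k : ℕ) (x : ℝ) : x < A → M k x = m k x
  norm_le (k : ℕ) (z : ℂ) : z.re < A → ‖M k z‖ ≤ m k z.re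
  pos (k : ℕ) (x : ℝ) : x < A → 0 < m k x
  real_zero : m 0 0 = 1
  bound_pos : 0 < A

namespace IsMomentFamily

variable {M : ℕ → ℂ → ℂ} {m : ℕ → ℝ → ℝ} {A : ℝ}

lemma zero (hM : IsMomentFamily M m A) : M 0 0 = 1 := by
  simpa [hM.real_zero] using hM.ofReal 0 0 hM.bound_pos

lemma differentiableOn (hM : IsMomentFamily M m A) (k : ℕ) :
    DifferentiableOn ℂ (M k) {z | z.re < A} := fun z hz =>
  (hM.hasDerivAt k z hz).differentiableAt.differentiableWithinAt

lemma hasDerivAt_real (hM : IsMomentFamily M m A) (k : ℕ) {x : ℝ} (hx : x < A) :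
    HasDerivAt (m k) (m (k + 1) x) x := by
  have hre := (hM.hasDerivAt k (x : ℂ) (by simpa using hx)).real_of_complex
  rw [hM.ofReal _ _ hx, Complex.ofReal_re] at hre
  refine hre.congr_of_eventuallyEq ?_
  filter_upwards [isOpen_Iio.mem_nhds hx] with y hy
  rw [hM.ofReal _ _ hy, Complex.ofReal_re]

lemma continuousOn_real (hM : IsMomentFamily M m A) (k : ℕ) : ContinuousOn (m k) (Iio A) :=
  fun _ hx => (hM.hasDerivAt_real k hx).continuousAt.continuousWithinAt

lemma strictMonoOn_real (hM : IsMomentFamily M m A) (k : ℕ) : StrictMonoOn (m k) (Iio A) := by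
  refine strictMonoOn_of_deriv_pos (convex_Iio A) (hM.continuousOn_real k) fun x hx => ?_
  rw [interior_Iio] at hx
  rw [(hM.hasDerivAt_real k hx).deriv]
  exact hM.pos _ _ hx

lemma real_le_real (hM : IsMomentFamily M m A) (k : ℕ) {x y : ℝ} (hxy : x ≤ y) (hy : y < A) :
    m k x ≤ m k y :=
  (hM.strictMonoOn_real k).monotoneOn (hxy.trans_lt hy) hy hxy

lemma strictConvexOn_real (hM : IsMomentFamily M m A) (k : ℕ) :
    StrictConvexOn ℝ (Iio A) (m k) := by
  refine strictConvexOn_of_deriv2_pos' (convex_Iio A) (hM.continuousOn_real k) fun x hx => ?_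
  have hderiv : deriv (m k) =ᶠ[𝓝 x] m (k + 1) := by
    filter_upwards [isOpen_Iio.mem_nhds hx] with y hy using (hM.hasDerivAt_real k hy).deriv
  rw [Function.iterate_succ, Function.iterate_one, Function.comp_apply, hderiv.deriv_eq,
    (hM.hasDerivAt_real (k + 1) hx).deriv]
  exact hM.pos _ _ hx

lemma norm_sub_le (hM : IsMomentFamily M m A) (k : ℕ) {c : ℝ} (hc : c < A) {u v : ℂ}
    (hu : u.re ≤ c) (hv : v.re ≤ c) : ‖M k u - M k v‖ ≤ m (k + 1) c * ‖u - v‖ :=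
  (convex_halfSpace_re_le c).norm_image_sub_le_of_norm_hasDerivWithin_le
    (fun _ hz => (hM.hasDerivAt k _ (lt_of_le_of_lt hz hc)).hasDerivWithinAt)
    (fun _ hz => (hM.norm_le _ _ (lt_of_le_of_lt hz hc)).trans (hM.real_le_real _ hz hc)) hv hu

lemma exists_mul_real_one_eq_one (hM : IsMomentFamily M m A) {a v : ℝ} (hload : a * m 1 0 < 1)
    (hv : 0 < v) (hvA : v < A) (hsec : v < a * (m 0 v - 1)) :
    ∃ u, 0 < u ∧ u < A ∧ a * m 1 u = 1 := by
  have hsub : Icc 0 v ⊆ Iio A := fun x hx => hx.2.trans_lt hvA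
  obtain ⟨ξ, ⟨hξ0, hξv⟩, hξ⟩ := exists_hasDerivAt_eq_slope (m 0) (m 1) hv
    ((hM.continuousOn_real 0).mono hsub) fun x hx => hM.hasDerivAt_real 0 (hx.2.trans hvA)
  have hslope : 1 < a * m 1 ξ := by
    rwa [hξ, hM.real_zero, sub_zero, mul_div_assoc', one_lt_div hv]
  obtain ⟨u, ⟨hu0, huξ⟩, hu⟩ := intermediate_value_Ioo hξ0.le
    ((continuousOn_const (c := a)).mul
      ((hM.continuousOn_real 1).mono ((Icc_subset_Icc_right hξv.le).trans hsub)))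
    (show (1 : ℝ) ∈ Ioo _ _ from ⟨hload, hslope⟩)
  exact ⟨u, hu0, (huξ.trans hξv).trans hvA, hu⟩

lemma exists_mul_real_sub_one_lt (hM : IsMomentFamily M m A) {l v : ℝ}
    (hload : l * m 1 0 < 1) (hv : 0 < v) : ∃ w, 0 < w ∧ w < v ∧ l * (m 0 w - 1) < w := by
  have hderiv : HasDerivAt (fun x => l * (m 0 x - 1) - x) (l * m 1 0 - 1) 0 :=
    (((hM.hasDerivAt_real 0 hM.bound_pos).sub_const 1).const_mul l).sub (hasDerivAt_id 0)
  have hslope : ∀ᶠ w in 𝓝[>] (0 : ℝ), slope (fun x => l * (m 0 x - 1) - x) 0 w < 0 :=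
    (hderiv.tendsto_slope.eventually (gt_mem_nhds (sub_neg.2 hload))).filter_mono
      (nhdsWithin_mono _ fun x hx => ne_of_gt hx)
  obtain ⟨w, hw, hw0, hwv⟩ := (hslope.and (Ioo_mem_nhdsGT hv)).exists
  rw [slope_def_field, hM.real_zero, sub_zero w, div_neg_iff] at hw
  exact ⟨w, hw0, hwv, by linarith [(hw.resolve_left fun h => hw0.not_gt h.2).1]⟩

lemma exists_mul_real_sub_one_eq (hM : IsMomentFamily M m A) {l v : ℝ}
    (hload : l * m 1 0 < 1) (hv : 0 < v) (hvA : v < A) (hsec : v < l * (m 0 v - 1)) :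
    ∃ u, 0 < u ∧ u < A ∧ l * (m 0 u - 1) = u := by
  obtain ⟨w, hw0, hwv, hw⟩ := hM.exists_mul_real_sub_one_lt hload hv
  have hsub : Icc w v ⊆ Iio A := fun x hx => hx.2.trans_lt hvA
  obtain ⟨u, ⟨huw, huv⟩, hu⟩ := intermediate_value_Ioo hwv.le
    (((continuousOn_const (c := l)).mul
      (((hM.continuousOn_real 0).mono hsub).sub continuousOn_const)).sub continuousOn_id)
    (show (0 : ℝ) ∈ Ioo _ _ from ⟨sub_neg.2 hw, sub_pos.2 hsec⟩)
  exact ⟨u, hw0.trans huw, huv.trans hvA, sub_eq_zero.1 hu⟩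

end IsMomentFamily

/-- The complex exponential moment `𝔼[X ^ k e ^ (z X)]` of a distribution `μ`; it is the `k`-th
derivative of the moment generating function. -/
noncomputable def complexMoment (μ : Measure ℝ) (k : ℕ) (z : ℂ) : ℂ :=
  ∫ x, (x : ℂ) ^ k * Complex.exp (z * x) ∂μ

/-- The real exponential moment `𝔼[X ^ k e ^ (t X)]` of a distribution `μ`. -/
noncomputable def realMoment (μ : Measure ℝ) (k : ℕ) (t : ℝ) : ℝ :=
  ∫ x, x ^ k * Real.exp (t * x) ∂μ

section ServiceTimes

variable {μ : Measure ℝ}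

lemma LST_eq_complexMoment (μ : Measure ℝ) (s : ℂ) : LST μ s = complexMoment μ 0 (-s) := by
  simp [LST, complexMGF, complexMoment]

lemma realLST_eq_realMoment (μ : Measure ℝ) (s : ℝ) : realLST μ s = realMoment μ 0 (-s) := by
  simp [realLST, mgf, realMoment]

lemma ae_nonneg_of_measure_Iio (hμ : μ (Iio 0) = 0) : ∀ᵐ x ∂μ, 0 ≤ x := by
  simpa [ae_iff, Iio] using hμ

lemma mem_interior_integrableExpSet_of_lt_RB (hμ : μ (Iio 0) = 0) {t : ℝ}
    (ht : (t : EReal) < RB μ) : t ∈ interior (integrableExpSet id μ) := by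
  obtain ⟨_, ⟨s, hs, rfl⟩, hts⟩ := lt_sSup_iff.1 ht
  refine mem_interior.2 ⟨Iio s, fun r hr => ?_, isOpen_Iio, EReal.coe_lt_coe_iff.1 hts⟩
  refine Integrable.mono' (g := fun x : ℝ => rexp (s * id x)) hs (by fun_prop) ?_
  filter_upwards [ae_nonneg_of_measure_Iio hμ] with x hx
  simp only [id, norm_eq_abs, abs_exp, exp_le_exp]
  exact mul_le_mul_of_nonneg_right (le_of_lt hr) hx

lemma integrable_pow_mul_exp_of_lt_RB (hμ : μ (Iio 0) = 0) (k : ℕ) {t : ℝ}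
    (ht : (t : EReal) < RB μ) : Integrable (fun x : ℝ => x ^ k * Real.exp (t * x)) μ :=
  integrable_pow_mul_exp_of_mem_interior_integrableExpSet
    (mem_interior_integrableExpSet_of_lt_RB hμ ht) k

lemma realMoment_pos (hμ : μ (Iio 0) = 0) (hpos : 0 < μ (Ioi 0)) (k : ℕ) {t : ℝ}
    (ht : (t : EReal) < RB μ) : 0 < realMoment μ k t := by
  rw [realMoment, integral_pos_iff_support_of_nonneg_ae _ (integrable_pow_mul_exp_of_lt_RB hμ k ht)]
  · refine hpos.trans_le (measure_mono fun x hx => ?_)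
    have : 0 < x := hx
    exact (by positivity : 0 < x ^ k * Real.exp (t * x)).ne'
  · filter_upwards [ae_nonneg_of_measure_Iio hμ] with x hx
    simp only [Pi.zero_apply]
    positivity

lemma isMomentFamily_moments [IsProbabilityMeasure μ] (hμ : μ (Iio 0) = 0)
    (hpos : 0 < μ (Ioi 0)) {A : ℝ} (hA : 0 < A) (hAR : (A : EReal) < RB μ) :
    IsMomentFamily (complexMoment μ) (realMoment μ) A where
  hasDerivAt k z hz := hasDerivAt_integral_pow_mul_exp (X := id)
    (mem_interior_integrableExpSet_of_lt_RB hμ (lt_trans (by exact_mod_cast hz) hAR)) k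
  ofReal k x _ := by
    rw [complexMoment, realMoment, ← integral_complex_ofReal]
    push_cast
    rfl
  norm_le k z _ := by
    refine (norm_integral_le_integral_norm _).trans (le_of_eq (integral_congr_ae ?_))
    filter_upwards [ae_nonneg_of_measure_Iio hμ] with x hx
    simp [Complex.norm_exp, abs_of_nonneg hx]
  pos k x hx := realMoment_pos hμ hpos k (lt_trans (by exact_mod_cast hx) hAR)
  real_zero := by simp [realMoment]
  bound_pos := hA

lemma deriv_realLST_neg {A : ℝ} (hM : IsMomentFamily (complexMoment μ) (realMoment μ) A) {u : ℝ}
    (hu : u < A) : deriv (realLST μ) (-u) = -realMoment μ 1 u := by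
  rw [funext (realLST_eq_realMoment μ), deriv_comp_neg (realMoment μ 0), neg_neg,
    (hM.hasDerivAt_real 0 hu).deriv]

lemma iteratedDeriv_two_realLST_neg {A : ℝ}
    (hM : IsMomentFamily (complexMoment μ) (realMoment μ) A) {u : ℝ} (hu : u < A) :
    iteratedDeriv 2 (realLST μ) (-u) = realMoment μ 2 u := by
  have hderiv : deriv (realLST μ) =ᶠ[𝓝 (-u)] fun s => -realMoment μ 1 (-s) := by
    filter_upwards [isOpen_Ioi.mem_nhds (neg_lt_neg hu)] with s hs
    simpa using deriv_realLST_neg hM (neg_lt.1 hs)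
  rw [iteratedDeriv_succ, iteratedDeriv_one, hderiv.deriv_eq, deriv.fun_neg,
    deriv_comp_neg (realMoment μ 1), neg_neg, neg_neg, (hM.hasDerivAt_real 1 hu).deriv]

lemma IsType1.exists_lt_realMoment_zero (hType : IsType1 μ) (C : ℝ) {v₀ : ℝ}
    (hv₀ : (v₀ : EReal) < RB μ) :
    ∃ v : ℝ, v₀ < v ∧ (v : EReal) < RB μ ∧ C < realMoment μ 0 v := by
  have hev := hType.2.eventually (eventually_gt_atTop C)
  rw [eventually_comap] at hev
  have hlt : -RB μ < ((-v₀ : ℝ) : EReal) := by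
    rw [EReal.coe_neg]; exact EReal.neg_lt_neg_iff.2 hv₀
  obtain ⟨b, hb, hbC⟩ := (mem_nhdsGT_iff_exists_Ioo_subset' hlt).1 hev
  obtain ⟨s, hsR, hs⟩ := EReal.lt_iff_exists_real_btwn.1 (lt_min hlt hb)
  have hsv : s < -v₀ := by exact_mod_cast hs.trans_le (min_le_left _ _)
  refine ⟨-s, lt_neg.1 hsv, ?_, ?_⟩
  · rw [EReal.coe_neg]; exact EReal.neg_lt_comm.1 hsR
  · rw [← realLST_eq_realMoment]
    exact hbC ⟨hsR, hs.trans_le (min_le_right _ _)⟩ s rfl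

lemma IsType1.measure_Ioi_pos [IsProbabilityMeasure μ] (hType : IsType1 μ)
    (hμ : μ (Iio 0) = 0) : 0 < μ (Ioi 0) := by
  rw [pos_iff_ne_zero]
  intro hzero
  have hae : ∀ᵐ x ∂μ, x = 0 := by
    have hle : ∀ᵐ x ∂μ, x ≤ 0 := by simpa [ae_iff, Ioi] using hzero
    filter_upwards [hle, ae_nonneg_of_measure_Iio hμ] with x hx hx' using le_antisymm hx hx'
  obtain ⟨v, -, -, hv⟩ := hType.exists_lt_realMoment_zero 1 (v₀ := 0) hType.1
  have hone : realMoment μ 0 v = ∫ _, (1 : ℝ) ∂μ :=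
    integral_congr_ae (by filter_upwards [hae] with x hx using by simp [hx])
  simp only [integral_const, probReal_univ, smul_eq_mul, mul_one] at hone
  linarith

lemma one_add_sq_mul_le_realMoment_zero [IsProbabilityMeasure μ] (hμ : μ (Iio 0) = 0)
    {v : ℝ} (hv : 0 ≤ v) (hvR : (v : EReal) < RB μ) :
    1 + v ^ 2 / 2 * realMoment μ 2 0 ≤ realMoment μ 0 v := by
  have hint := (integrable_pow_mul_exp_of_lt_RB hμ 2
    (lt_of_le_of_lt (by exact_mod_cast hv) hvR : ((0 : ℝ) : EReal) < RB μ)).const_mul (v ^ 2 / 2)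
  calc 1 + v ^ 2 / 2 * realMoment μ 2 0
      = ∫ x, (1 + v ^ 2 / 2 * (x ^ 2 * Real.exp (0 * x))) ∂μ := by
        rw [integral_add (integrable_const _) hint, integral_const_mul]
        simp [realMoment]
    _ ≤ realMoment μ 0 v := by
        refine integral_mono_ae ((integrable_const _).add hint)
          (integrable_pow_mul_exp_of_lt_RB hμ 0 hvR) ?_
        filter_upwards [ae_nonneg_of_measure_Iio hμ] with x hx
        have := Real.quadratic_le_exp_of_nonneg (mul_nonneg hv hx)
        simp only [zero_mul, Real.exp_zero, pow_zero, one_mul, mul_one]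
        nlinarith [mul_nonneg hv hx]

/-- If `R_{B*} = ∞`, the quadratic growth of the moment generating function replaces its blow-up
at a finite abscissa. -/
lemma IsType1.exists_lt_mul_realMoment_zero_sub_one [IsProbabilityMeasure μ] (hType : IsType1 μ)
    (hμ : μ (Iio 0) = 0) {a : ℝ} (ha : 0 < a) :
    ∃ v : ℝ, 0 < v ∧ (v : EReal) < RB μ ∧ v < a * (realMoment μ 0 v - 1) := by
  rcases eq_or_ne (RB μ) ⊤ with htop | htop
  · have hlt : ∀ x : ℝ, (x : EReal) < RB μ := fun x => htop ▸ EReal.coe_lt_top x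
    have hsecond : 0 < realMoment μ 2 0 := realMoment_pos hμ (hType.measure_Ioi_pos hμ) 2 (hlt 0)
    set v := 4 / (a * realMoment μ 2 0) with hv_def
    have hv : 0 < v := by positivity
    refine ⟨v, hv, hlt v, ?_⟩
    calc v < 2 * v := by linarith
      _ = a * (v ^ 2 / 2 * realMoment μ 2 0) := by rw [hv_def]; field_simp; norm_num
      _ ≤ a * (realMoment μ 0 v - 1) := mul_le_mul_of_nonneg_left
          (by linarith [one_add_sq_mul_le_realMoment_zero hμ hv.le (hlt v)]) ha.le
  · obtain ⟨r, hr⟩ : ∃ r : ℝ, (r : EReal) = RB μ :=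
      ⟨_, EReal.coe_toReal htop (ne_bot_of_gt hType.1)⟩
    obtain ⟨v, hv, hvR, hlarge⟩ := hType.exists_lt_realMoment_zero (1 + r / a) (v₀ := 0) hType.1
    have hvr : v < r := by rw [← hr] at hvR; exact_mod_cast hvR
    refine ⟨v, hv, hvR, hvr.trans ?_⟩
    rwa [← div_lt_iff₀' ha, lt_sub_iff_add_lt']

end ServiceTimes

/-! ### The change of variable `u = λ₁ (h z - 1) + λ₂ (z - 1)` -/

/-- A moment family with rates `a = λ₁`, `b = λ₂` and the critical point `u₀ > 0` of the map
`zMap`, that is, the root of `λ₁ 𝔼[X e ^ (u X)] = 1`. -/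
structure IsCriticalFamily (M : ℕ → ℂ → ℂ) (m : ℕ → ℝ → ℝ) (A a b u₀ : ℝ) : Prop
    extends IsMomentFamily M m A where
  a_pos : 0 < a
  b_pos : 0 < b
  u₀_pos : 0 < u₀
  u₀_lt : u₀ < A
  mul_real_u₀ : a * m 1 u₀ = 1

/-- The inverse of the change of variable `z ↦ λ₁ (h z - 1) + λ₂ (z - 1)`; in the variable `u`, the
function `h` is `M 0`. -/
noncomputable def zMap (M : ℕ → ℂ → ℂ) (a b : ℝ) (u : ℂ) : ℂ := 1 + (u + a * (1 - M 0 u)) / b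

/-- The restriction of `zMap` to the real axis. Its value at the critical point `u₀` is the
dominant singularity of `h`. -/
noncomputable def zMapReal (m : ℕ → ℝ → ℝ) (a b : ℝ) (x : ℝ) : ℝ := 1 + (x + a * (1 - m 0 x)) / b

/-- The map whose fixed points are the solutions `u` of `zMap u = z`. -/
noncomputable def fixedPointMap (M : ℕ → ℂ → ℂ) (a b : ℝ) (z u : ℂ) : ℂ :=
  b * (z - 1) + a * (M 0 u - 1)

/-- The inverse of `zMap` with values in the half-plane to the left of the critical point. -/
noncomputable def zMapInv (M : ℕ → ℂ → ℂ) (a b u₀ : ℝ) (z : ℂ) : ℂ :=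
  Function.invFunOn (zMap M a b) {u | u.re < u₀} z

lemma zMap_eq_iff {M : ℕ → ℂ → ℂ} {a b : ℝ} (hb : b ≠ 0) {z u : ℂ} :
    zMap M a b u = z ↔ fixedPointMap M a b z u = u := by
  have hb' : (b : ℂ) ≠ 0 := by exact_mod_cast hb
  rw [zMap, fixedPointMap, ← eq_sub_iff_add_eq', div_eq_iff hb']
  constructor <;> intro h <;> linear_combination -h

namespace IsCriticalFamily

variable {M : ℕ → ℂ → ℂ} {m : ℕ → ℝ → ℝ} {A a b u₀ : ℝ}

lemma ofReal_b_ne_zero (hM : IsCriticalFamily M m A a b u₀) : (b : ℂ) ≠ 0 := by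
  exact_mod_cast hM.b_pos.ne'

lemma mul_real_one_lt_one (hM : IsCriticalFamily M m A a b u₀) {c : ℝ} (hc : c < u₀) :
    a * m 1 c < 1 := by
  rw [← hM.mul_real_u₀]
  exact mul_lt_mul_of_pos_left (hM.strictMonoOn_real 1 (hc.trans hM.u₀_lt) hM.u₀_lt hc) hM.a_pos

lemma one_sub_mul_ne_zero (hM : IsCriticalFamily M m A a b u₀) {u : ℂ} (hu : u.re < u₀) :
    1 - a * M 1 u ≠ 0 := by
  intro hzero
  have hnorm : a * ‖M 1 u‖ = 1 := by
    rw [← norm_of_nonneg hM.a_pos.le, ← Complex.norm_real, ← norm_mul, ← sub_eq_zero.1 hzero,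
      norm_one]
  have hle := mul_le_mul_of_nonneg_left (hM.norm_le 1 u (hu.trans hM.u₀_lt)) hM.a_pos.le
  linarith [hM.mul_real_one_lt_one hu]

lemma zMap_ofReal (hM : IsCriticalFamily M m A a b u₀) {x : ℝ} (hx : x < A) :
    zMap M a b x = zMapReal m a b x := by
  simp [zMap, zMapReal, hM.ofReal 0 x hx]

lemma zMapReal_zero (hM : IsCriticalFamily M m A a b u₀) : zMapReal m a b 0 = 1 := by
  simp [zMapReal, hM.real_zero]

lemma hasDerivAt_zMap (hM : IsCriticalFamily M m A a b u₀) {u : ℂ} (hu : u.re < A) :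
    HasDerivAt (zMap M a b) ((1 - a * M 1 u) / b) u := by
  refine ((((hasDerivAt_id u).add (((hM.hasDerivAt 0 u hu).const_sub 1).const_mul
    (a : ℂ))).div_const (b : ℂ)).const_add 1).congr_deriv ?_
  ring

lemma hasDerivAt_zMapReal (hM : IsCriticalFamily M m A a b u₀) {x : ℝ} (hx : x < A) :
    HasDerivAt (zMapReal m a b) ((1 - a * m 1 x) / b) x := by
  refine ((((hasDerivAt_id x).add (((hM.hasDerivAt_real 0 hx).const_sub 1).const_mul
    a)).div_const b).const_add 1).congr_deriv ?_
  ring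

lemma strictMonoOn_zMapReal (hM : IsCriticalFamily M m A a b u₀) :
    StrictMonoOn (zMapReal m a b) (Iic u₀) := by
  refine strictMonoOn_of_deriv_pos (convex_Iic u₀) (fun x hx => ?_) fun x hx => ?_
  · exact (hM.hasDerivAt_zMapReal (lt_of_le_of_lt hx hM.u₀_lt)).continuousAt.continuousWithinAt
  · rw [interior_Iic] at hx
    rw [(hM.hasDerivAt_zMapReal (lt_trans hx hM.u₀_lt)).deriv]
    exact div_pos (sub_pos.2 (hM.mul_real_one_lt_one hx)) hM.b_pos

lemma zMapReal_lt_zMapReal_u₀ (hM : IsCriticalFamily M m A a b u₀) {c : ℝ} (hc : c < u₀) :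
    zMapReal m a b c < zMapReal m a b u₀ :=
  hM.strictMonoOn_zMapReal hc.le self_mem_Iic hc

lemma one_lt_zMapReal_u₀ (hM : IsCriticalFamily M m A a b u₀) : 1 < zMapReal m a b u₀ :=
  hM.zMapReal_zero ▸ hM.zMapReal_lt_zMapReal_u₀ hM.u₀_pos

lemma exists_lt_zMapReal (hM : IsCriticalFamily M m A a b u₀) {c : ℝ} (hc : c ≤ u₀) {r : ℝ}
    (hr : r < zMapReal m a b c) : ∃ c' < c, r < zMapReal m a b c' := by
  have hcont := (hM.hasDerivAt_zMapReal (hc.trans_lt hM.u₀_lt)).continuousAt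
  have hev := (hcont.eventually (lt_mem_nhds hr)).filter_mono (nhdsWithin_le_nhds (s := Iio c))
  obtain ⟨c', hrc', hc'⟩ := (hev.and self_mem_nhdsWithin).exists
  exact ⟨c', hc', hrc'⟩

lemma exists_zMapReal_eq (hM : IsCriticalFamily M m A a b u₀) {x : ℝ}
    (hx : x < zMapReal m a b u₀) : ∃ y < u₀, zMapReal m a b y = x := by
  set y := min 0 (b * (x - 1) - a)
  have hyu : y < u₀ := (min_le_left _ _).trans_lt hM.u₀_pos
  have hle : zMapReal m a b y ≤ x := by
    have hpos := mul_pos hM.a_pos (hM.pos 0 y (hyu.trans hM.u₀_lt))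
    rw [zMapReal, ← le_sub_iff_add_le', div_le_iff₀' hM.b_pos]
    linarith [min_le_right 0 (b * (x - 1) - a)]
  obtain ⟨w, hw, hwx⟩ := intermediate_value_Ico hyu.le (f := zMapReal m a b)
    (fun w hw => (hM.hasDerivAt_zMapReal
      (lt_of_le_of_lt hw.2 hM.u₀_lt)).continuousAt.continuousWithinAt) ⟨hle, hx⟩
  exact ⟨w, hw.2, hwx⟩

lemma mul_norm_sub_le (hM : IsCriticalFamily M m A a b u₀) {c : ℝ} (hc : c < A) {u v : ℂ}
    (hu : u.re ≤ c) (hv : v.re ≤ c) :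
    (1 - a * m 1 c) * ‖u - v‖ ≤ b * ‖zMap M a b u - zMap M a b v‖ := by
  have hsub : (b : ℂ) * (zMap M a b u - zMap M a b v) = (u - v) - a * (M 0 u - M 0 v) := by
    have := hM.ofReal_b_ne_zero
    simp only [zMap]; field_simp; ring
  have hM0 := mul_le_mul_of_nonneg_left (hM.norm_sub_le 0 hc hu hv) hM.a_pos.le
  calc (1 - a * m 1 c) * ‖u - v‖ ≤ ‖u - v‖ - a * ‖M 0 u - M 0 v‖ := by
        rw [zero_add] at hM0; linarith
    _ = ‖u - v‖ - ‖a * (M 0 u - M 0 v)‖ := by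
        rw [norm_mul, Complex.norm_real, norm_of_nonneg hM.a_pos.le]
    _ ≤ ‖(u - v) - a * (M 0 u - M 0 v)‖ := norm_sub_norm_le _ _
    _ = b * ‖zMap M a b u - zMap M a b v‖ := by
        rw [← hsub, norm_mul, Complex.norm_real, norm_of_nonneg hM.b_pos.le]

lemma injOn_zMap (hM : IsCriticalFamily M m A a b u₀) :
    InjOn (zMap M a b) {u | u.re < u₀} := by
  intro u hu v hv huv
  have hlt : max u.re v.re < u₀ := max_lt hu hv
  have hle := hM.mul_norm_sub_le (hlt.trans hM.u₀_lt) (le_max_left u.re v.re) (le_max_right _ _)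
  rw [huv, sub_self, norm_zero, mul_zero] at hle
  have hnorm := nonpos_of_mul_nonpos_right hle (sub_pos.2 (hM.mul_real_one_lt_one hlt))
  exact sub_eq_zero.1 (norm_le_zero_iff.1 hnorm)

lemma mapsTo_fixedPointMap (hM : IsCriticalFamily M m A a b u₀) {c : ℝ} (hc : c < A) {z : ℂ}
    (hz : z.re ≤ zMapReal m a b c) :
    MapsTo (fixedPointMap M a b z) {u | u.re ≤ c} {u | u.re ≤ c} := by
  intro u hu
  have hM0 : (M 0 u).re ≤ m 0 c := (Complex.re_le_norm _).trans
    ((hM.norm_le 0 u (lt_of_le_of_lt hu hc)).trans (hM.real_le_real 0 hu hc))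
  have hzc : b * (z.re - 1) ≤ c + a * (1 - m 0 c) := by
    rwa [← le_div_iff₀' hM.b_pos, sub_le_iff_le_add']
  have hre : (fixedPointMap M a b z u).re = b * (z.re - 1) + a * ((M 0 u).re - 1) := by
    simp [fixedPointMap]
  rw [mem_ofPred_eq, hre]
  linarith [mul_le_mul_of_nonneg_left hM0 hM.a_pos.le]

lemma contractingWith_fixedPointMap (hM : IsCriticalFamily M m A a b u₀) {c : ℝ} (hc : c < u₀)
    {z : ℂ} (hmaps : MapsTo (fixedPointMap M a b z) {u | u.re ≤ c} {u | u.re ≤ c}) :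
    ContractingWith (a * m 1 c).toNNReal (hmaps.restrict _ _ _) := by
  have hcA := hc.trans hM.u₀_lt
  refine ⟨Real.toNNReal_lt_one.2 (hM.mul_real_one_lt_one hc),
    LipschitzWith.of_dist_le_mul fun u v => ?_⟩
  simp only [Subtype.dist_eq, MapsTo.val_restrict_apply, dist_eq_norm,
    Real.coe_toNNReal _ (mul_pos hM.a_pos (hM.pos 1 c hcA)).le]
  have hsub : fixedPointMap M a b z u - fixedPointMap M a b z v = a * (M 0 u - M 0 v) := by
    simp only [fixedPointMap]; ring
  rw [hsub, norm_mul, Complex.norm_real, norm_of_nonneg hM.a_pos.le, mul_assoc]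
  exact mul_le_mul_of_nonneg_left (hM.norm_sub_le 0 hcA u.2 v.2) hM.a_pos.le

lemma exists_zMap_eq (hM : IsCriticalFamily M m A a b u₀) {c : ℝ} (hc : c < u₀) {z : ℂ}
    (hz : z.re ≤ zMapReal m a b c) : ∃ u : ℂ, u.re ≤ c ∧ zMap M a b u = z := by
  have hmaps := hM.mapsTo_fixedPointMap (hc.trans hM.u₀_lt) hz
  have hclosed : IsClosed {u : ℂ | u.re ≤ c} := isClosed_le Complex.continuous_re continuous_const
  obtain ⟨u, hu, hfix, -⟩ := (hM.contractingWith_fixedPointMap hc hmaps).exists_fixedPoint'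
    hclosed.isComplete hmaps (x := (c : ℂ)) (by simp) (edist_ne_top _ _)
  exact ⟨u, hu, (zMap_eq_iff hM.b_pos.ne').2 hfix⟩

lemma zMapInv_eq (hM : IsCriticalFamily M m A a b u₀) {u z : ℂ} (hu : u.re < u₀)
    (hz : zMap M a b u = z) : zMapInv M a b u₀ z = u := by
  have hex : ∃ v ∈ {v : ℂ | v.re < u₀}, zMap M a b v = z := ⟨u, hu, hz⟩
  exact hM.injOn_zMap (Function.invFunOn_mem hex) hu ((Function.invFunOn_eq hex).trans hz.symm)

lemma zMapInv_ofReal (hM : IsCriticalFamily M m A a b u₀) {x : ℝ} (hx : x < u₀) :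
    zMapInv M a b u₀ (zMapReal m a b x) = x :=
  hM.zMapInv_eq (by simpa using hx) (hM.zMap_ofReal (hx.trans hM.u₀_lt))

lemma zMapInv_re_le (hM : IsCriticalFamily M m A a b u₀) {c : ℝ} (hc : c < u₀) {z : ℂ}
    (hz : z.re ≤ zMapReal m a b c) : (zMapInv M a b u₀ z).re ≤ c := by
  obtain ⟨u, hu, huz⟩ := hM.exists_zMap_eq hc hz
  rwa [hM.zMapInv_eq (lt_of_le_of_lt hu hc) huz]

lemma zMapInv_re_lt (hM : IsCriticalFamily M m A a b u₀) {c : ℝ} (hc : c ≤ u₀) {z : ℂ}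
    (hz : z.re < zMapReal m a b c) : (zMapInv M a b u₀ z).re < c := by
  obtain ⟨c', hc', hz'⟩ := hM.exists_lt_zMapReal hc hz
  exact (hM.zMapInv_re_le (hc'.trans_le hc) hz'.le).trans_lt hc'

lemma zMap_zMapInv (hM : IsCriticalFamily M m A a b u₀) {z : ℂ} (hz : z.re < zMapReal m a b u₀) :
    zMap M a b (zMapInv M a b u₀ z) = z := by
  obtain ⟨c, hc, hcz⟩ := hM.exists_lt_zMapReal le_rfl hz
  obtain ⟨u, hu, huz⟩ := hM.exists_zMap_eq hc hcz.le
  exact Function.invFunOn_eq ⟨u, lt_of_le_of_lt hu hc, huz⟩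

lemma dist_zMapInv_le (hM : IsCriticalFamily M m A a b u₀) {c : ℝ} (hc : c < u₀) {z w : ℂ}
    (hz : z.re ≤ zMapReal m a b c) (hw : w.re ≤ zMapReal m a b c) :
    dist (zMapInv M a b u₀ z) (zMapInv M a b u₀ w) ≤ b / (1 - a * m 1 c) * dist z w := by
  have hle := hM.mul_norm_sub_le (hc.trans hM.u₀_lt) (hM.zMapInv_re_le hc hz)
    (hM.zMapInv_re_le hc hw)
  have hlt := hM.zMapReal_lt_zMapReal_u₀ hc
  rw [hM.zMap_zMapInv (hz.trans_lt hlt), hM.zMap_zMapInv (hw.trans_lt hlt)] at hle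
  rwa [dist_eq_norm, dist_eq_norm, div_mul_eq_mul_div,
    le_div_iff₀' (sub_pos.2 (hM.mul_real_one_lt_one hc))]

lemma continuousAt_zMapInv (hM : IsCriticalFamily M m A a b u₀) {z : ℂ}
    (hz : z.re < zMapReal m a b u₀) : ContinuousAt (zMapInv M a b u₀) z := by
  obtain ⟨c, hc, hcz⟩ := hM.exists_lt_zMapReal le_rfl hz
  rw [ContinuousAt, tendsto_iff_dist_tendsto_zero]
  refine squeeze_zero' (.of_forall fun _ => dist_nonneg)
    (g := fun w => b / (1 - a * m 1 c) * dist w z) ?_ ?_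
  · filter_upwards [(Complex.isOpen_re_lt _).mem_nhds hcz] with w hw
      using hM.dist_zMapInv_le hc (le_of_lt hw) hcz.le
  · have : Continuous fun w => b / (1 - a * m 1 c) * dist w z := by fun_prop
    simpa using this.tendsto z

lemma hasDerivAt_zMapInv (hM : IsCriticalFamily M m A a b u₀) {z : ℂ}
    (hz : z.re < zMapReal m a b u₀) :
    HasDerivAt (zMapInv M a b u₀) (b / (1 - a * M 1 (zMapInv M a b u₀ z))) z := by
  have hre := hM.zMapInv_re_lt le_rfl hz
  rw [← inv_div]
  refine HasDerivAt.of_local_left_inverse (hM.continuousAt_zMapInv hz)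
    (hM.hasDerivAt_zMap (hre.trans hM.u₀_lt))
    (div_ne_zero (hM.one_sub_mul_ne_zero hre) hM.ofReal_b_ne_zero) ?_
  filter_upwards [(Complex.isOpen_re_lt _).mem_nhds hz] with w hw using hM.zMap_zMapInv hw

lemma differentiableOn_zMapInv (hM : IsCriticalFamily M m A a b u₀) :
    DifferentiableOn ℂ (zMapInv M a b u₀) {z | z.re < zMapReal m a b u₀} := fun _ hz =>
  (hM.hasDerivAt_zMapInv hz).differentiableAt.differentiableWithinAt

end IsCriticalFamily

/-! ### Square roots and quadratic critical points -/

lemma complexSqrt_sq (z : ℂ) : z.sqrt ^ 2 = z := Complex.cpow_ofNat_inv_pow z 2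

lemma complexSqrt_ne_zero {z : ℂ} (hz : z ≠ 0) : z.sqrt ≠ 0 := fun h => by
  rw [← complexSqrt_sq z, h] at hz
  exact hz (zero_pow two_ne_zero)

lemma complexSqrt_ofReal {x : ℝ} (hx : 0 ≤ x) : (x : ℂ).sqrt = √x := by
  simpa using Complex.sqrt_of_nonneg (a := x) (by exact_mod_cast hx)

lemma complexSqrt_re_pos {z : ℂ} (hz : z ∈ Complex.slitPlane) : 0 < z.sqrt.re := by
  rw [Complex.sqrt, Complex.cpow_inv_two_re, Real.sqrt_pos]
  rcases Complex.mem_slitPlane_iff.1 hz with hre | him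
  · linarith [norm_nonneg z]
  · linarith [neg_abs_le z.re, Complex.abs_re_lt_norm.2 him]

lemma tendsto_complexSqrt_sub (R : ℂ) : Tendsto (fun z => (R - z).sqrt) (𝓝 R) (𝓝 0) := by
  have hcont : ContinuousAt (fun z => (R - z).sqrt) R :=
    ContinuousAt.comp (g := Complex.sqrt) (Complex.continuousAt_sqrt (by simp)) (by fun_prop)
  simpa using hcont.tendsto

lemma hasDerivAt_complexSqrt_sub {R z : ℂ} (hz : R - z ∈ Complex.slitPlane) :
    HasDerivAt (fun z => (R - z).sqrt) (-1 / (2 * (R - z).sqrt)) z := by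
  refine ((Complex.hasDerivAt_sqrt hz).comp z ((hasDerivAt_id z).const_sub R)).congr_deriv ?_
  rw [Complex.sqrt, show (-1 / 2 : ℂ) = -2⁻¹ by ring, Complex.cpow_neg]
  ring

lemma analyticAt_dslope {E : Type*} [NormedAddCommGroup E] [NormedSpace ℂ E] [CompleteSpace E]
    {f : ℂ → E} {c : ℂ} (hf : AnalyticAt ℂ f c) : AnalyticAt ℂ (dslope f c) c := by
  obtain ⟨s, hs, hd⟩ := hf.exists_mem_nhds_analyticOnNhd
  exact ((Complex.differentiableOn_dslope hs).2 hd.differentiableOn).analyticAt hs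

lemma exists_analyticAt_eq_add_sq_mul {f : ℂ → ℂ} {c : ℂ} (hf : AnalyticAt ℂ f c)
    (hc : deriv f c = 0) :
    ∃ q : ℂ → ℂ, AnalyticAt ℂ q c ∧ 2 * q c = deriv (deriv f) c ∧
      ∀ u, f u = f c + (u - c) ^ 2 * q u := by
  set q := dslope (dslope f c) c
  have hq : AnalyticAt ℂ q c := analyticAt_dslope (analyticAt_dslope hf)
  have hfq : ∀ u, f u = f c + (u - c) ^ 2 * q u := fun u => by
    have hslope := sub_smul_dslope f c u
    have hslope₂ := sub_smul_dslope (dslope f c) c u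
    simp only [smul_eq_mul, dslope_same, hc, sub_zero] at hslope hslope₂
    linear_combination -hslope - (u - c) * hslope₂
  have hderiv : deriv f =ᶠ[𝓝 c] fun u => 2 * (u - c) * q u + (u - c) ^ 2 * deriv q u := by
    filter_upwards [hq.eventually_analyticAt] with u hu
    rw [funext hfq]
    refine HasDerivAt.deriv (((((hasDerivAt_id u).sub_const c).pow 2).mul
      hu.differentiableAt.hasDerivAt).const_add (f c) |>.congr_deriv ?_)
    simp
  refine ⟨q, hq, ?_, hfq⟩
  rw [hderiv.deriv_eq]
  refine (HasDerivAt.deriv (((((hasDerivAt_id c).sub_const c).const_mul 2).mul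
    hq.differentiableAt.hasDerivAt).add ((((hasDerivAt_id c).sub_const c).pow 2).mul
    hq.deriv.differentiableAt.hasDerivAt) |>.congr_deriv ?_)).symm
  simp

lemma exists_analyticAt_rightInverse {k : ℂ → ℂ} {c k' : ℂ} (hk : AnalyticAt ℂ k c)
    (hkc : k c = 0) (hderiv : HasDerivAt k k' c) (hk' : k' ≠ 0) :
    ∃ ψ : ℂ → ℂ, AnalyticAt ℂ ψ 0 ∧ ψ 0 = c ∧ HasDerivAt ψ k'⁻¹ 0 ∧ ∀ᶠ t in 𝓝 0, k (ψ t) = t := by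
  have hne : deriv k c ≠ 0 := by rwa [hderiv.deriv]
  refine ⟨hk.hasStrictDerivAt.localInverse _ _ _ hne, hkc ▸ hk.analyticAt_localInverse hne,
    ?_, ?_, ?_⟩ <;> rw [← hkc]
  · exact HasStrictFDerivAt.localInverse_apply_image ..
  · simpa only [hderiv.deriv] using (hk.hasStrictDerivAt.to_localInverse hne).hasDerivAt
  · exact HasStrictDerivAt.eventually_right_inverse ..

lemma exists_analyticAt_inverse_sqrt {f : ℂ → ℂ} {c : ℂ} {g : ℝ} (hf : AnalyticAt ℂ f c)
    (hc : deriv f c = 0) (hf'' : deriv (deriv f) c = -2 * g) (hg : 0 < g) :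
    ∃ ψ : ℂ → ℂ, AnalyticAt ℂ ψ 0 ∧ ψ 0 = c ∧ HasDerivAt ψ (-1 / (√g : ℂ)) 0 ∧
      ∀ᶠ t in 𝓝 0, f (ψ t) = f c - t ^ 2 := by
  obtain ⟨q, hq, hqc, hfq⟩ := exists_analyticAt_eq_add_sq_mul hf hc
  have hqc : -q c = g := by linear_combination -(hqc.trans hf'') / 2
  have hslit : -q c ∈ Complex.slitPlane := hqc ▸ Complex.ofReal_mem_slitPlane.2 hg
  have hsqrt : AnalyticAt ℂ (fun u => (-q u).sqrt) c := hq.neg.cpow analyticAt_const hslit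
  -- `k` is an analytic square root of `f c - f`, with a simple zero at `c`.
  set k : ℂ → ℂ := fun u => (c - u) * (-q u).sqrt with hk
  have hksq : ∀ u, k u ^ 2 = f c - f u := fun u => by
    rw [hk, hfq u]; simp only [mul_pow, complexSqrt_sq]; ring
  have hkd : HasDerivAt k (-(√g : ℂ)) c := by
    refine (((hasDerivAt_id c).const_sub c).mul
      hsqrt.differentiableAt.hasDerivAt).congr_deriv ?_
    simp [hqc, complexSqrt_ofReal hg.le]
  have hgne : -(√g : ℂ) ≠ 0 := neg_ne_zero.2 (by exact_mod_cast (Real.sqrt_pos.2 hg).ne')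
  obtain ⟨ψ, hψ, hψ0, hψd, hright⟩ := exists_analyticAt_rightInverse
    ((analyticAt_const.sub analyticAt_id).mul hsqrt) (by simp) hkd hgne
  refine ⟨ψ, hψ, hψ0, hψd.congr_deriv (by rw [neg_div, one_div, inv_neg]), ?_⟩
  filter_upwards [hright] with t ht
  change k (ψ t) = t at ht
  rw [← ht, hksq, ht, sub_sub_cancel]

lemma norm_lt_two_mul_re {t : ℂ} (ht : 0 < t.re) (hsq : 0 < (t ^ 2).re) : ‖t‖ < 2 * t.re := by
  have hre : (t ^ 2).re = t.re ^ 2 - t.im ^ 2 := by rw [sq, Complex.mul_re]; ring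
  refine lt_of_pow_lt_pow_left₀ 2 (by positivity) ?_
  rw [Complex.sq_norm, Complex.normSq_apply]
  nlinarith

lemma eventually_re_lt_of_hasDerivAt_zero {ψ : ℂ → ℂ} {s : ℝ} (hs : 0 < s)
    (hψ : HasDerivAt ψ (-1 / (s : ℂ)) 0) :
    ∀ᶠ t in 𝓝 (0 : ℂ), 0 < t.re → 0 < (t ^ 2).re → (ψ t).re < (ψ 0).re := by
  have hlin := (hasDerivAt_iff_isLittleO.1 hψ).def (show 0 < 1 / (2 * s) by positivity)
  filter_upwards [hlin] with t ht hre hsq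
  have hle : (ψ t - ψ 0 - (t - 0) • (-1 / (s : ℂ))).re ≤ 1 / (2 * s) * ‖t - 0‖ :=
    (Complex.re_le_norm _).trans ht
  have heq : (ψ t - ψ 0 - (t - 0) • (-1 / (s : ℂ))).re = (ψ t).re - (ψ 0).re + t.re / s := by
    rw [sub_zero, smul_eq_mul, mul_div_assoc', Complex.sub_re, Complex.sub_re,
      Complex.div_ofReal_re]
    simp [neg_div]
  have hlt : 1 / (2 * s) * ‖t‖ < t.re / s := by
    rw [div_mul_eq_mul_div, one_mul, div_lt_div_iff₀ (by positivity) hs]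
    nlinarith [norm_lt_two_mul_re hre hsq]
  rw [heq, sub_zero] at hle
  linarith

namespace IsCriticalFamily

variable {M : ℕ → ℂ → ℂ} {m : ℕ → ℝ → ℝ} {A a b u₀ : ℝ}

lemma analyticAt_zMap (hM : IsCriticalFamily M m A a b u₀) {u : ℂ} (hu : u.re < A) :
    AnalyticAt ℂ (zMap M a b) u := by
  refine Complex.analyticAt_iff_eventually_differentiableAt.2 ?_
  filter_upwards [(Complex.isOpen_re_lt A).mem_nhds hu] with v hv
    using (hM.hasDerivAt_zMap hv).differentiableAt

lemma deriv_zMap_u₀ (hM : IsCriticalFamily M m A a b u₀) : deriv (zMap M a b) u₀ = 0 := by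
  have hcrit : (a : ℂ) * m 1 u₀ = 1 := by exact_mod_cast hM.mul_real_u₀
  rw [(hM.hasDerivAt_zMap (by simpa using hM.u₀_lt)).deriv, hM.ofReal 1 u₀ hM.u₀_lt, hcrit,
    sub_self, zero_div]

lemma deriv_deriv_zMap_u₀ (hM : IsCriticalFamily M m A a b u₀) :
    deriv (deriv (zMap M a b)) u₀ = -(a * m 2 u₀ / b : ℝ) := by
  have hu₀ : (u₀ : ℂ).re < A := by simpa using hM.u₀_lt
  have hderiv : deriv (zMap M a b) =ᶠ[𝓝 ↑u₀] fun u => (1 - a * M 1 u) / b := by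
    filter_upwards [(Complex.isOpen_re_lt A).mem_nhds hu₀] with u hu
      using (hM.hasDerivAt_zMap hu).deriv
  rw [hderiv.deriv_eq, ((((hM.hasDerivAt 1 u₀ hu₀).const_mul (a : ℂ)).const_sub 1).div_const
    (b : ℂ)).deriv, hM.ofReal 2 u₀ hM.u₀_lt]
  push_cast
  ring

lemma exists_sqrt_param (hM : IsCriticalFamily M m A a b u₀) :
    ∃ ψ : ℂ → ℂ, AnalyticAt ℂ ψ 0 ∧ ψ 0 = u₀ ∧
      HasDerivAt ψ (-1 / (√(a * m 2 u₀ / (2 * b)) : ℂ)) 0 ∧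
      (∀ᶠ t in 𝓝 0, zMap M a b (ψ t) = zMapReal m a b u₀ - t ^ 2) ∧
      ∀ᶠ z in 𝓝[{z : ℂ | z.re < zMapReal m a b u₀}] (zMapReal m a b u₀ : ℂ),
        zMapInv M a b u₀ z = ψ (zMapReal m a b u₀ - z).sqrt := by
  have hg : 0 < a * m 2 u₀ / (2 * b) :=
    div_pos (mul_pos hM.a_pos (hM.pos 2 u₀ hM.u₀_lt)) (mul_pos two_pos hM.b_pos)
  obtain ⟨ψ, hψa, hψ0, hψd, hψ⟩ := exists_analyticAt_inverse_sqrt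
    (hM.analyticAt_zMap (u := u₀) (by simpa using hM.u₀_lt)) hM.deriv_zMap_u₀
    (hM.deriv_deriv_zMap_u₀.trans (by have := hM.b_pos.ne'; push_cast; field_simp)) hg
  rw [hM.zMap_ofReal hM.u₀_lt] at hψ
  refine ⟨ψ, hψa, hψ0, hψd, hψ, ?_⟩
  have hre_lt := eventually_re_lt_of_hasDerivAt_zero (Real.sqrt_pos.2 hg) hψd
  have htend := (tendsto_complexSqrt_sub (zMapReal m a b u₀)).mono_left
    (nhdsWithin_le_nhds (s := {z : ℂ | z.re < zMapReal m a b u₀}))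
  filter_upwards [htend.eventually hψ, htend.eventually hre_lt, self_mem_nhdsWithin]
    with z hz hzre (hlt : z.re < _)
  have hre : 0 < (zMapReal m a b u₀ - z : ℂ).re := by simpa using hlt
  rw [complexSqrt_sq] at hz hzre
  refine hM.zMapInv_eq ?_ (hz.trans (sub_sub_cancel _ _))
  simpa [hψ0] using hzre (complexSqrt_re_pos (Or.inl hre)) hre

lemma tendsto_zMapInv (hM : IsCriticalFamily M m A a b u₀) :
    Tendsto (zMapInv M a b u₀) (𝓝[{z : ℂ | z.re < zMapReal m a b u₀}] (zMapReal m a b u₀ : ℂ))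
      (𝓝 u₀) := by
  obtain ⟨ψ, hψa, hψ0, -, -, hψ⟩ := hM.exists_sqrt_param
  have htend : Tendsto ψ (𝓝 0) (𝓝 u₀) := hψ0 ▸ hψa.continuousAt.tendsto
  exact (htend.comp ((tendsto_complexSqrt_sub _).mono_left nhdsWithin_le_nhds)).congr'
    (hψ.mono fun z hz => hz.symm)

lemma tendsto_zMapInv_of_le (hM : IsCriticalFamily M m A a b u₀) {c : ℝ} (hc : c ≤ u₀) :
    Tendsto (zMapInv M a b u₀) (𝓝[{z : ℂ | z.re < zMapReal m a b c}] (zMapReal m a b c : ℂ))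
      (𝓝 c) := by
  rcases hc.eq_or_lt with rfl | hlt
  · exact hM.tendsto_zMapInv
  · have hcont := hM.continuousAt_zMapInv (z := (zMapReal m a b c : ℂ))
      (by simpa using hM.zMapReal_lt_zMapReal_u₀ hlt)
    rw [ContinuousAt, hM.zMapInv_ofReal hlt] at hcont
    exact hcont.mono_left nhdsWithin_le_nhds

end IsCriticalFamily

/-! ### Taylor coefficients of `h` -/

/-- The cone of functions generated by the moments and the derivative of `zMapInv`, both as
functions of the variable `u`. It is closed under differentiation in `z`, so all derivatives of
`h` at `0` are nonnegative. -/
inductive IsPositiveFun (M : ℕ → ℂ → ℂ) (a b : ℝ) : (ℂ → ℂ) → Prop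
  | moment (k : ℕ) : IsPositiveFun M a b (M k)
  | resolvent : IsPositiveFun M a b fun u => b / (1 - a * M 1 u)
  | smul (r : ℝ) (hr : 0 ≤ r) {F : ℂ → ℂ} (hF : IsPositiveFun M a b F) :
      IsPositiveFun M a b fun u => r * F u
  | add {F G : ℂ → ℂ} (hF : IsPositiveFun M a b F) (hG : IsPositiveFun M a b G) :
      IsPositiveFun M a b fun u => F u + G u
  | mul {F G : ℂ → ℂ} (hF : IsPositiveFun M a b F) (hG : IsPositiveFun M a b G) :
      IsPositiveFun M a b fun u => F u * G u

lemma ball_subset_re_lt (R : ℝ) : Metric.ball (0 : ℂ) R ⊆ {z | z.re < R} := fun z hz =>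
  (Complex.re_le_norm z).trans_lt (by simpa using hz)

lemma tendsto_ofReal_nhdsLT (R : ℝ) :
    Tendsto (fun x : ℝ => (x : ℂ)) (𝓝[<] R) (𝓝[{z : ℂ | z.re < R}] (R : ℂ)) := by
  refine tendsto_nhdsWithin_iff.2 ⟨?_, ?_⟩
  · exact (Complex.continuous_ofReal.tendsto R).mono_left nhdsWithin_le_nhds
  · filter_upwards [self_mem_nhdsWithin] with x hx using by simpa using hx

lemma hasSum_of_tendsto_of_nonneg {c : ℕ → ℝ} {g : ℝ → ℝ} {R L : ℝ} (hR : 0 < R)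
    (hc : ∀ n, 0 ≤ c n) (hg : ∀ x ∈ Ioo 0 R, HasSum (fun n => c n * x ^ n) (g x))
    (hL : Tendsto g (𝓝[<] R) (𝓝 L)) : HasSum (fun n => c n * R ^ n) L := by
  have hbound : ∀ s : Finset ℕ, ∑ n ∈ s, c n * R ^ n ≤ L := fun s => by
    have hpoly : Tendsto (fun x : ℝ => ∑ n ∈ s, c n * x ^ n) (𝓝[<] R)
        (𝓝 (∑ n ∈ s, c n * R ^ n)) :=
      (Continuous.tendsto (by fun_prop) R).mono_left nhdsWithin_le_nhds
    refine le_of_tendsto_of_tendsto hpoly hL ?_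
    filter_upwards [Ioo_mem_nhdsLT hR] with x hx
    exact sum_le_hasSum s (fun n _ => mul_nonneg (hc n) (pow_nonneg hx.1.le n)) (hg x hx)
  have hnonneg : ∀ n, 0 ≤ c n * R ^ n := fun n => mul_nonneg (hc n) (pow_nonneg hR.le n)
  have hsum : Summable fun n => c n * R ^ n := summable_of_sum_le hnonneg hbound
  have hle : L ≤ ∑' n, c n * R ^ n := by
    refine le_of_tendsto hL ?_
    filter_upwards [Ioo_mem_nhdsLT hR] with x hx
    exact hasSum_le (fun n => mul_le_mul_of_nonneg_left (pow_le_pow_left₀ hx.1.le hx.2.le n) (hc n))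
      (hg x hx) hsum.hasSum
  exact hle.antisymm (hsum.tsum_le_of_sum_le hbound) ▸ hsum.hasSum

namespace IsCriticalFamily

variable {M : ℕ → ℂ → ℂ} {m : ℕ → ℝ → ℝ} {A a b u₀ : ℝ}

lemma exists_nonneg_of_isPositiveFun (hM : IsCriticalFamily M m A a b u₀) {F : ℂ → ℂ}
    (hF : IsPositiveFun M a b F) {x : ℝ} (hx : x < u₀) : ∃ r : ℝ, 0 ≤ r ∧ F x = r := by
  have hxA := hx.trans hM.u₀_lt
  induction hF with
  | moment k => exact ⟨m k x, (hM.pos k x hxA).le, hM.ofReal k x hxA⟩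
  | resolvent =>
    exact ⟨b / (1 - a * m 1 x),
      div_nonneg hM.b_pos.le (sub_nonneg.2 (hM.mul_real_one_lt_one hx).le),
      by simp [hM.ofReal 1 x hxA]⟩
  | smul r hr _ ih =>
    obtain ⟨s, hs, h⟩ := ih
    exact ⟨r * s, mul_nonneg hr hs, by simp [h]⟩
  | add _ _ ihF ihG =>
    obtain ⟨r, hr, hFr⟩ := ihF
    obtain ⟨s, hs, hGs⟩ := ihG
    exact ⟨r + s, add_nonneg hr hs, by simp [hFr, hGs]⟩
  | mul _ _ ihF ihG =>
    obtain ⟨r, hr, hFr⟩ := ihF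
    obtain ⟨s, hs, hGs⟩ := ihG
    exact ⟨r * s, mul_nonneg hr hs, by simp [hFr, hGs]⟩

lemma exists_hasDerivAt_of_isPositiveFun (hM : IsCriticalFamily M m A a b u₀) {F : ℂ → ℂ}
    (hF : IsPositiveFun M a b F) :
    ∃ F', IsPositiveFun M a b F' ∧ ∀ u : ℂ, u.re < u₀ → HasDerivAt F (F' u) u := by
  induction hF with
  | moment k => exact ⟨_, .moment (k + 1), fun u hu => hM.hasDerivAt k u (hu.trans hM.u₀_lt)⟩
  | resolvent =>
    refine ⟨_, .smul (a / b) (div_nonneg hM.a_pos.le hM.b_pos.le)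
      (.mul (.mul .resolvent .resolvent) (.moment 2)), fun u hu => ?_⟩
    have hne := hM.one_sub_mul_ne_zero hu
    have := hM.ofReal_b_ne_zero
    refine ((hasDerivAt_const u (b : ℂ)).div (((hM.hasDerivAt 1 u
      (hu.trans hM.u₀_lt)).const_mul (a : ℂ)).const_sub 1) hne).congr_deriv ?_
    push_cast
    field_simp
    ring
  | smul r hr _ ih =>
    obtain ⟨F', hF', h⟩ := ih
    exact ⟨_, .smul r hr hF', fun u hu => (h u hu).const_mul _⟩
  | add _ _ ihF ihG =>
    obtain ⟨F', hF', hFd⟩ := ihF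
    obtain ⟨G', hG', hGd⟩ := ihG
    exact ⟨_, .add hF' hG', fun u hu => (hFd u hu).add (hGd u hu)⟩
  | mul hF hG ihF ihG =>
    obtain ⟨F', hF', hFd⟩ := ihF
    obtain ⟨G', hG', hGd⟩ := ihG
    exact ⟨_, .add (.mul hF' hG) (.mul hF hG'), fun u hu => (hFd u hu).mul (hGd u hu)⟩

lemma exists_iteratedDeriv_comp_zMapInv (hM : IsCriticalFamily M m A a b u₀) {F : ℂ → ℂ}
    (hF : IsPositiveFun M a b F) (n : ℕ) :
    ∃ G, IsPositiveFun M a b G ∧ ∀ z : ℂ, z.re < zMapReal m a b u₀ →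
      iteratedDeriv n (fun z => F (zMapInv M a b u₀ z)) z = G (zMapInv M a b u₀ z) := by
  induction n with
  | zero => exact ⟨F, hF, fun z _ => by simp⟩
  | succ n ih =>
    obtain ⟨G, hG, hn⟩ := ih
    obtain ⟨G', hG', hderiv⟩ := hM.exists_hasDerivAt_of_isPositiveFun hG
    refine ⟨_, .mul hG' .resolvent, fun z hz => ?_⟩
    have hev : iteratedDeriv n (fun z => F (zMapInv M a b u₀ z)) =ᶠ[𝓝 z]
        fun z => G (zMapInv M a b u₀ z) := by
      filter_upwards [(Complex.isOpen_re_lt _).mem_nhds hz] with w hw using hn w hw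
    rw [iteratedDeriv_succ, hev.deriv_eq]
    exact ((hderiv _ (hM.zMapInv_re_lt le_rfl hz)).comp z (hM.hasDerivAt_zMapInv hz)).deriv

lemma exists_taylor_coeff (hM : IsCriticalFamily M m A a b u₀) :
    ∃ c : ℕ → ℝ, (∀ n, 0 ≤ c n) ∧
      ∀ n, iteratedDeriv n (fun z => M 0 (zMapInv M a b u₀ z)) 0 / (n.factorial : ℂ) = c n := by
  have hR : (0 : ℝ) < zMapReal m a b u₀ := one_pos.trans hM.one_lt_zMapReal_u₀
  obtain ⟨y, hy, hy0⟩ := hM.exists_zMapReal_eq hR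
  have hinv := hM.zMapInv_ofReal hy
  rw [hy0, Complex.ofReal_zero] at hinv
  have hcoeff : ∀ n, ∃ r : ℝ, 0 ≤ r ∧
      iteratedDeriv n (fun z => M 0 (zMapInv M a b u₀ z)) 0 / (n.factorial : ℂ) = r := fun n => by
    obtain ⟨G, hG, hn⟩ := hM.exists_iteratedDeriv_comp_zMapInv (.moment 0) n
    obtain ⟨r, hr, hGr⟩ := hM.exists_nonneg_of_isPositiveFun hG hy
    exact ⟨r / n.factorial, by positivity, by
      rw [hn 0 (by simpa using hR), hinv, hGr, Complex.ofReal_div, Complex.ofReal_natCast]⟩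
  choose c hc hc' using hcoeff
  exact ⟨c, hc, hc'⟩

lemma differentiableOn_comp_zMapInv (hM : IsCriticalFamily M m A a b u₀) {F : ℂ → ℂ}
    (hF : DifferentiableOn ℂ F {u | u.re < u₀}) :
    DifferentiableOn ℂ (fun z => F (zMapInv M a b u₀ z)) {z | z.re < zMapReal m a b u₀} :=
  hF.comp hM.differentiableOn_zMapInv fun _ hz => hM.zMapInv_re_lt le_rfl hz

lemma differentiableOn_moment_zMapInv (hM : IsCriticalFamily M m A a b u₀) (k : ℕ) :
    DifferentiableOn ℂ (fun z => M k (zMapInv M a b u₀ z)) {z | z.re < zMapReal m a b u₀} :=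
  hM.differentiableOn_comp_zMapInv
    ((hM.differentiableOn k).mono fun u (hu : u.re < u₀) => hu.trans hM.u₀_lt)

lemma hasSum_moment_zMapInv (hM : IsCriticalFamily M m A a b u₀) {c : ℕ → ℝ}
    (hc : ∀ n, iteratedDeriv n (fun z => M 0 (zMapInv M a b u₀ z)) 0 / (n.factorial : ℂ) = c n)
    {z : ℂ} (hz : ‖z‖ < zMapReal m a b u₀) :
    HasSum (fun n => (c n : ℂ) * z ^ n) (M 0 (zMapInv M a b u₀ z)) := by
  have hsum := Complex.hasSum_taylorSeries_on_ball ((hM.differentiableOn_moment_zMapInv 0).mono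
    (ball_subset_re_lt _)) (z := z) (by simpa using hz)
  refine hsum.congr_fun fun n => ?_
  rw [← hc n, sub_zero, smul_eq_mul, smul_eq_mul]
  ring

lemma exists_moment_zMapInv_ofReal (hM : IsCriticalFamily M m A a b u₀) {x : ℝ}
    (hx : x < zMapReal m a b u₀) :
    ∃ y < u₀, zMapReal m a b y = x ∧ zMapInv M a b u₀ x = y ∧ M 0 (zMapInv M a b u₀ x) = m 0 y := by
  obtain ⟨y, hy, rfl⟩ := hM.exists_zMapReal_eq hx
  have hinv := hM.zMapInv_ofReal hy
  exact ⟨y, hy, rfl, hinv, by rw [hinv, hM.ofReal 0 y (hy.trans hM.u₀_lt)]⟩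

lemma tendsto_moment_zMapInv (hM : IsCriticalFamily M m A a b u₀) (k : ℕ) :
    Tendsto (fun z => M k (zMapInv M a b u₀ z))
      (𝓝[{z : ℂ | z.re < zMapReal m a b u₀}] (zMapReal m a b u₀ : ℂ)) (𝓝 (m k u₀)) := by
  rw [← hM.ofReal k u₀ hM.u₀_lt]
  exact (hM.hasDerivAt k u₀ (by simpa using hM.u₀_lt)).continuousAt.tendsto.comp hM.tendsto_zMapInv

lemma tsum_taylor_coeff (hM : IsCriticalFamily M m A a b u₀) {c : ℕ → ℝ} (hc0 : ∀ n, 0 ≤ c n)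
    (hc : ∀ n, iteratedDeriv n (fun z => M 0 (zMapInv M a b u₀ z)) 0 / (n.factorial : ℂ) = c n) :
    ∑' n, (c n : ℂ) * (zMapReal m a b u₀ : ℂ) ^ n = m 0 u₀ := by
  have hR : 0 < zMapReal m a b u₀ := one_pos.trans hM.one_lt_zMapReal_u₀
  have hreal : ∀ x ∈ Ioo 0 (zMapReal m a b u₀),
      HasSum (fun n => c n * x ^ n) (M 0 (zMapInv M a b u₀ x)).re := fun x hx => by
    obtain ⟨y, -, -, -, hxy⟩ := hM.exists_moment_zMapInv_ofReal hx.2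
    have hsum := hM.hasSum_moment_zMapInv hc (z := x)
      (by rw [Complex.norm_real, norm_of_nonneg hx.1.le]; exact hx.2)
    rw [hxy] at hsum ⊢
    rw [Complex.ofReal_re, ← Complex.hasSum_ofReal]
    exact_mod_cast hsum
  have hlim : Tendsto (fun x : ℝ => (M 0 (zMapInv M a b u₀ x)).re) (𝓝[<] zMapReal m a b u₀)
      (𝓝 (m 0 u₀)) :=
    (Complex.continuous_re.tendsto _).comp
      ((hM.tendsto_moment_zMapInv 0).comp (tendsto_ofReal_nhdsLT _))
  exact_mod_cast (Complex.hasSum_ofReal.2 (hasSum_of_tendsto_of_nonneg hR hc0 hreal hlim)).tsum_eq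

end IsCriticalFamily

/-! ### The function `f₁` -/

/-- A critical family together with the positive root `uStar` of `(λ₁ + λ₂) (𝔼[e ^ (u X)] - 1) = u`,
at load less than `1`. In the variable `u`, the zeros of `h z - z` to the right of `1` reduce to
`uStar`. -/
structure IsRetrialModel (M : ℕ → ℂ → ℂ) (m : ℕ → ℝ → ℝ) (A a b u₀ uStar : ℝ) : Prop
    extends IsCriticalFamily M m A a b u₀ where
  uStar_pos : 0 < uStar
  uStar_lt : uStar < A
  mul_uStar : (a + b) * (m 0 uStar - 1) = uStar
  subcritical : (a + b) * m 1 0 < 1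

/-- The denominator `1 - (a + b) (M₀ u - 1) / u`, with its removable singularity removed. It is
`h z - z` in the variable `u`, up to the factor `-u / b`. -/
noncomputable def reducedDenom (M : ℕ → ℂ → ℂ) (a b : ℝ) (u : ℂ) : ℂ :=
  1 - (a + b) * dslope (M 0) 0 u

/-- The function `f₁` in the variable `u`, with its removable singularity at `u = 0`, that is at
`z = 1`, removed. -/
noncomputable def f₁Lift (M : ℕ → ℂ → ℂ) (a b : ℝ) (u : ℂ) : ℂ :=
  b * dslope (M 0) 0 u / reducedDenom M a b u

namespace IsMomentFamily

variable {M : ℕ → ℂ → ℂ} {m : ℕ → ℝ → ℝ} {A : ℝ}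

lemma moment_zero_eq (hM : IsMomentFamily M m A) (u : ℂ) : M 0 u = 1 + u * dslope (M 0) 0 u := by
  have hslope := sub_smul_dslope (M 0) 0 u
  rw [hM.zero, sub_zero, smul_eq_mul] at hslope
  rw [hslope, add_sub_cancel]

lemma differentiableOn_dslope (hM : IsMomentFamily M m A) :
    DifferentiableOn ℂ (dslope (M 0) 0) {u | u.re < A} :=
  (Complex.differentiableOn_dslope ((Complex.isOpen_re_lt A).mem_nhds
    (by simpa using hM.bound_pos))).2 (hM.differentiableOn 0)

lemma differentiableOn_reducedDenom (hM : IsMomentFamily M m A) (a b : ℝ) :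
    DifferentiableOn ℂ (reducedDenom M a b) {u | u.re < A} :=
  (hM.differentiableOn_dslope.const_mul _).const_sub _

lemma mul_reducedDenom (hM : IsMomentFamily M m A) (a b : ℝ) (u : ℂ) :
    u * reducedDenom M a b u = u - (a + b) * (M 0 u - 1) := by
  rw [hM.moment_zero_eq u, reducedDenom]; ring

lemma moment_sub_zMap (hM : IsMomentFamily M m A) (a : ℝ) {b : ℝ} (hb : b ≠ 0) (u : ℂ) :
    M 0 u - zMap M a b u = -(u * reducedDenom M a b u) / b := by
  have hbne : (b : ℂ) ≠ 0 := by exact_mod_cast hb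
  rw [hM.mul_reducedDenom, zMap, eq_div_iff hbne, sub_mul, add_mul, div_mul_cancel₀ _ hbne]
  ring

lemma f₁Lift_mul (hM : IsMomentFamily M m A) {a b : ℝ} (hb : b ≠ 0) {u : ℂ}
    (hu : reducedDenom M a b u ≠ 0) : f₁Lift M a b u * (M 0 u - zMap M a b u) = 1 - M 0 u := by
  have hbne : (b : ℂ) ≠ 0 := by exact_mod_cast hb
  rw [hM.moment_sub_zMap a hb, hM.moment_zero_eq u, f₁Lift, div_mul_div_comm,
    div_eq_iff (mul_ne_zero hu hbne)]
  ring

lemma f₁Lift_eq (hM : IsMomentFamily M m A) {a b : ℝ} (hb : b ≠ 0) {u : ℂ} (hu : u ≠ 0) :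
    f₁Lift M a b u = (1 - M 0 u) / (M 0 u - zMap M a b u) := by
  have hbne : (b : ℂ) ≠ 0 := by exact_mod_cast hb
  rcases eq_or_ne (reducedDenom M a b u) 0 with hzero | hne
  · simp [f₁Lift, hM.moment_sub_zMap a hb, hzero]
  · rw [← hM.f₁Lift_mul hb hne, mul_div_cancel_right₀]
    rw [hM.moment_sub_zMap a hb]
    exact div_ne_zero (neg_ne_zero.2 (mul_ne_zero hu hne)) hbne

lemma differentiableAt_f₁Lift (hM : IsMomentFamily M m A) {a b : ℝ} {u : ℂ} (hu : u.re < A)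
    (hne : reducedDenom M a b u ≠ 0) : DifferentiableAt ℂ (f₁Lift M a b) u :=
  have hmem := (Complex.isOpen_re_lt A).mem_nhds hu
  ((hM.differentiableOn_dslope.differentiableAt hmem).const_mul _).div
    ((hM.differentiableOn_reducedDenom a b).differentiableAt hmem) hne

end IsMomentFamily

namespace IsRetrialModel

variable {M : ℕ → ℂ → ℂ} {m : ℕ → ℝ → ℝ} {A a b u₀ uStar : ℝ}

lemma add_pos (hM : IsRetrialModel M m A a b u₀ uStar) : 0 < a + b :=
  _root_.add_pos hM.a_pos hM.b_pos

lemma mul_real_sub_one_lt (hM : IsRetrialModel M m A a b u₀ uStar) {x : ℝ} (hx0 : 0 < x)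
    (hx : x < uStar) : (a + b) * (m 0 x - 1) < x := by
  have hsec := (hM.strictConvexOn_real 0).secant_strict_mono (a := 0) hM.bound_pos
    (hx.trans hM.uStar_lt) hM.uStar_lt hx0.ne' hM.uStar_pos.ne' hx
  rw [hM.real_zero, sub_zero, sub_zero] at hsec
  calc (a + b) * (m 0 x - 1) = (a + b) * ((m 0 x - 1) / x) * x := by field_simp
    _ < (a + b) * ((m 0 uStar - 1) / uStar) * x :=
        mul_lt_mul_of_pos_right (mul_lt_mul_of_pos_left hsec hM.add_pos) hx0
    _ = x := by rw [mul_div_assoc', hM.mul_uStar, div_self hM.uStar_pos.ne', one_mul]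

lemma eq_uStar (hM : IsRetrialModel M m A a b u₀ uStar) {x : ℝ} (hx0 : 0 < x) (hxA : x < A)
    (hx : (a + b) * (m 0 x - 1) = x) : x = uStar := by
  have hM' : IsRetrialModel M m A a b u₀ x :=
    { hM with uStar_pos := hx0, uStar_lt := hxA, mul_uStar := hx }
  rcases lt_trichotomy x uStar with hlt | heq | hlt
  · exact absurd hx (hM.mul_real_sub_one_lt hx0 hlt).ne
  · exact heq
  · exact absurd hM.mul_uStar (hM'.mul_real_sub_one_lt hM.uStar_pos hlt).ne

lemma one_lt_mul_real_uStar (hM : IsRetrialModel M m A a b u₀ uStar) : 1 < (a + b) * m 1 uStar := by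
  have hsub : Icc 0 uStar ⊆ Iio A := fun x hx => hx.2.trans_lt hM.uStar_lt
  obtain ⟨ξ, hξ, hslope⟩ := exists_hasDerivAt_eq_slope (m 0) (m 1) hM.uStar_pos
    ((hM.continuousOn_real 0).mono hsub)
    fun x hx => hM.hasDerivAt_real 0 (hx.2.trans hM.uStar_lt)
  calc 1 = (a + b) * m 1 ξ := by
        rw [hslope, hM.real_zero, sub_zero, mul_div_assoc', hM.mul_uStar,
          div_self hM.uStar_pos.ne']
    _ < (a + b) * m 1 uStar := mul_lt_mul_of_pos_left
        (hM.strictMonoOn_real 1 (hξ.2.trans hM.uStar_lt) hM.uStar_lt hξ.2) hM.add_pos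

lemma mul_moment_sub_one_ne (hM : IsRetrialModel M m A a b u₀ uStar) {u : ℂ} (hu : u.re < uStar)
    (hu0 : u ≠ 0) : u ≠ (a + b) * (M 0 u - 1) := by
  intro heq
  rcases lt_or_ge 0 u.re with hpos | hneg
  · have hre : u.re = (a + b) * ((M 0 u).re - 1) := by
      have := congrArg Complex.re heq
      rwa [← Complex.ofReal_add, Complex.re_ofReal_mul, Complex.sub_re, Complex.one_re] at this
    have hle := (Complex.re_le_norm _).trans (hM.norm_le 0 u (hu.trans hM.uStar_lt))
    linarith [hM.mul_real_sub_one_lt hpos hu, mul_le_mul_of_nonneg_left hle hM.add_pos.le]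
  · have hle := hM.norm_sub_le 0 (c := 0) hM.bound_pos hneg (v := 0) (by simp)
    rw [hM.zero, sub_zero, zero_add] at hle
    have hlt : ‖u‖ < ‖u‖ := by
      calc ‖u‖ = (a + b) * ‖M 0 u - 1‖ := by
            conv_lhs => rw [heq]
            rw [← Complex.ofReal_add, norm_mul, Complex.norm_real, norm_of_nonneg hM.add_pos.le]
        _ ≤ (a + b) * (m 1 0 * ‖u‖) := mul_le_mul_of_nonneg_left hle hM.add_pos.le
        _ = (a + b) * m 1 0 * ‖u‖ := by ring
        _ < ‖u‖ := mul_lt_of_lt_one_left (norm_pos_iff.2 hu0) hM.subcritical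
    exact lt_irrefl _ hlt

lemma reducedDenom_ne_zero (hM : IsRetrialModel M m A a b u₀ uStar) {u : ℂ} (hu : u.re < uStar) :
    reducedDenom M a b u ≠ 0 := by
  intro hzero
  rcases eq_or_ne u 0 with rfl | hne
  · have hderiv : dslope (M 0) 0 0 = m 1 0 := by
      rw [dslope_same, (hM.hasDerivAt 0 0 (hu.trans hM.uStar_lt)).deriv, zero_add,
        ← hM.ofReal 1 0 hM.bound_pos, Complex.ofReal_zero]
    rw [reducedDenom, hderiv, sub_eq_zero] at hzero
    exact hM.subcritical.ne' (by exact_mod_cast hzero)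
  · have hmul := hM.mul_reducedDenom a b u
    rw [hzero, mul_zero, eq_comm, sub_eq_zero] at hmul
    exact hM.mul_moment_sub_one_ne hu hne hmul

lemma reducedDenom_ofReal_ne_zero (hM : IsRetrialModel M m A a b u₀ uStar) {x : ℝ} (hx0 : 0 < x)
    (hxA : x < A) (hx : x ≠ uStar) : reducedDenom M a b x ≠ 0 := by
  intro hzero
  have hmul := hM.mul_reducedDenom a b x
  rw [hzero, mul_zero, eq_comm, sub_eq_zero, hM.ofReal 0 x hxA] at hmul
  exact hx (hM.eq_uStar hx0 hxA (by exact_mod_cast hmul.symm))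

lemma ofReal_uStar_ne_zero (hM : IsRetrialModel M m A a b u₀ uStar) : (uStar : ℂ) ≠ 0 := by
  exact_mod_cast hM.uStar_pos.ne'

lemma reducedDenom_uStar (hM : IsRetrialModel M m A a b u₀ uStar) :
    reducedDenom M a b uStar = 0 := by
  have hmul := hM.mul_reducedDenom a b uStar
  have hstar : ((a : ℂ) + b) * (m 0 uStar - 1) = uStar := by exact_mod_cast hM.mul_uStar
  rw [hM.ofReal 0 uStar hM.uStar_lt, hstar, sub_self] at hmul
  exact (mul_eq_zero.1 hmul).resolve_left hM.ofReal_uStar_ne_zero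

lemma dslope_uStar (hM : IsRetrialModel M m A a b u₀ uStar) :
    dslope (M 0) 0 uStar = 1 / (a + b) := by
  have hab : (a : ℂ) + b ≠ 0 := by exact_mod_cast hM.add_pos.ne'
  rw [eq_div_iff hab, mul_comm]
  exact (sub_eq_zero.1 hM.reducedDenom_uStar).symm

lemma hasDerivAt_reducedDenom_uStar (hM : IsRetrialModel M m A a b u₀ uStar) :
    HasDerivAt (reducedDenom M a b) (-(((a + b) * m 1 uStar - 1) / uStar : ℝ)) uStar := by
  have hlt : (uStar : ℂ).re < A := by simpa using hM.uStar_lt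
  have hd := ((hM.differentiableOn_reducedDenom a b).differentiableAt
    ((Complex.isOpen_re_lt A).mem_nhds hlt)).hasDerivAt
  have hprod : HasDerivAt (fun u => u * reducedDenom M a b u) (1 - (a + b) * M 1 uStar) uStar := by
    rw [funext (hM.mul_reducedDenom a b)]
    exact (hasDerivAt_id _).sub (((hM.hasDerivAt 0 uStar hlt).sub_const 1).const_mul _)
  have heq := ((hasDerivAt_id _).mul hd).unique hprod
  rw [hM.reducedDenom_uStar, hM.ofReal 1 uStar hM.uStar_lt, mul_zero, zero_add] at heq
  refine hd.congr_deriv ?_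
  push_cast
  rw [← neg_div, eq_div_iff hM.ofReal_uStar_ne_zero]
  linear_combination heq

lemma mul_zMapReal_uStar_sub_one (hM : IsRetrialModel M m A a b u₀ uStar) :
    (a + b) * (zMapReal m a b uStar - 1) = uStar := by
  have hb := hM.b_pos.ne'
  rw [zMapReal, add_sub_cancel_left, mul_div_assoc', div_eq_iff hb]
  linear_combination -a * hM.mul_uStar

lemma zMapReal_min_le (hM : IsRetrialModel M m A a b u₀ uStar) :
    zMapReal m a b (min u₀ uStar) ≤ zMapReal m a b u₀ :=
  hM.strictMonoOn_zMapReal.monotoneOn (mem_Iic.2 (min_le_left _ _)) self_mem_Iic (min_le_left _ _)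

lemma one_lt_zMapReal_min (hM : IsRetrialModel M m A a b u₀ uStar) :
    1 < zMapReal m a b (min u₀ uStar) := by
  rw [← hM.zMapReal_zero]
  exact hM.strictMonoOn_zMapReal hM.u₀_pos.le (mem_Iic.2 (min_le_left _ _))
    (lt_min hM.u₀_pos hM.uStar_pos)

lemma reducedDenom_zMapInv_ne_zero (hM : IsRetrialModel M m A a b u₀ uStar) {z : ℂ}
    (hz : z.re < zMapReal m a b (min u₀ uStar)) :
    reducedDenom M a b (zMapInv M a b u₀ z) ≠ 0 :=
  hM.reducedDenom_ne_zero ((hM.zMapInv_re_lt (min_le_left _ _) hz).trans_le (min_le_right _ _))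

lemma differentiableOn_f₁Lift_zMapInv (hM : IsRetrialModel M m A a b u₀ uStar) :
    DifferentiableOn ℂ (fun z => f₁Lift M a b (zMapInv M a b u₀ z))
      {z | z.re < zMapReal m a b (min u₀ uStar)} := by
  intro z hz
  have hz₀ := lt_of_lt_of_le (show z.re < _ from hz) hM.zMapReal_min_le
  exact ((hM.differentiableAt_f₁Lift ((hM.zMapInv_re_lt le_rfl hz₀).trans hM.u₀_lt)
    (hM.reducedDenom_zMapInv_ne_zero hz)).comp z
      (hM.hasDerivAt_zMapInv hz₀).differentiableAt).differentiableWithinAt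

lemma exists_primitive_f₁Lift_zMapInv (hM : IsRetrialModel M m A a b u₀ uStar) :
    ∃ F : ℂ → ℂ, F 1 = 0 ∧ ∀ z : ℂ, z.re < zMapReal m a b (min u₀ uStar) →
      HasDerivAt F (f₁Lift M a b (zMapInv M a b u₀ z)) z := by
  obtain ⟨F, hF⟩ :=
    (convex_halfSpace_re_lt _).exists_forall_hasDerivWithinAt hM.differentiableOn_f₁Lift_zMapInv
  exact ⟨fun z => F z - F 1, sub_self _, fun z hz =>
    ((hF z hz).hasDerivAt ((Complex.isOpen_re_lt _).mem_nhds hz)).sub_const _⟩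

lemma exists_f₁Lift_zMapInv_eq_nonneg (hM : IsRetrialModel M m A a b u₀ uStar) {x : ℝ} (hx1 : 1 < x)
    (hx : x < zMapReal m a b (min u₀ uStar)) :
    ∃ r : ℝ, 0 ≤ r ∧ f₁Lift M a b (zMapInv M a b u₀ x) = r := by
  obtain ⟨y, hy, rfl, hinv, -⟩ := hM.exists_moment_zMapInv_ofReal (hx.trans_le hM.zMapReal_min_le)
  have hymin : y < min u₀ uStar :=
    (hM.strictMonoOn_zMapReal.lt_iff_lt hy.le (mem_Iic.2 (min_le_left _ _))).1 hx
  have hy0 : 0 < y := by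
    rw [← hM.zMapReal_zero] at hx1
    exact (hM.strictMonoOn_zMapReal.lt_iff_lt hM.u₀_pos.le hy.le).1 hx1
  have hyA := hy.trans hM.u₀_lt
  have hnum : 1 < m 0 y := hM.real_zero ▸ hM.strictMonoOn_real 0 hM.bound_pos hyA hy0
  have hden : m 0 y < zMapReal m a b y := by
    rw [zMapReal, ← sub_lt_iff_lt_add', lt_div_iff₀ hM.b_pos]
    linarith [hM.mul_real_sub_one_lt hy0 (hymin.trans_le (min_le_right _ _))]
  refine ⟨(1 - m 0 y) / (m 0 y - zMapReal m a b y),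
    div_nonneg_of_nonpos (sub_neg.2 hnum).le (sub_neg.2 hden).le, ?_⟩
  rw [hinv, hM.f₁Lift_eq hM.b_pos.ne' (by exact_mod_cast hy0.ne'), hM.zMap_ofReal hyA,
    hM.ofReal 0 y hyA]
  push_cast
  rfl

end IsRetrialModel

/-! ### Continuation to Delta-domains -/

lemma exists_eq_add_const {s : Set ℂ} (hs : Convex ℝ s) {F L f : ℂ → ℂ}
    (hF : ∀ z ∈ s, HasDerivAt F (f z) z) (hL : ∀ z ∈ s, HasDerivAt L (f z) z) :
    ∃ k, ∀ z ∈ s, F z = L z + k := by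
  rcases s.eq_empty_or_nonempty with rfl | ⟨w, hw⟩
  · exact ⟨0, fun z hz => hz.elim⟩
  refine ⟨F w - L w, fun z hz => ?_⟩
  have hle := hs.norm_image_sub_le_of_norm_hasDerivWithin_le (C := 0)
    (fun z hz => ((hF z hz).sub (hL z hz)).hasDerivWithinAt) (by simp) hw hz
  rw [zero_mul, norm_le_zero_iff, sub_eq_zero, Pi.sub_apply, Pi.sub_apply] at hle
  linear_combination hle

lemma sub_mem_slitPlane_of_re_lt {R : ℝ} {z : ℂ} (hz : z.re < R) : R - z ∈ Complex.slitPlane :=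
  Or.inl (by simpa using hz)

open ComplexOrder in
lemma sub_mem_slitPlane_of_mem_deltaDomain {R S φ : ℝ} (hφ : 0 < φ) {z : ℂ}
    (hz : z ∈ DeltaDomain R S φ) : (R : ℂ) - z ∈ Complex.slitPlane := by
  by_contra hslit
  have hle : 0 ≤ z - R := by
    rwa [Complex.mem_slitPlane_iff_not_le_zero, not_not, sub_nonpos, ← sub_nonneg] at hslit
  have harg := hz.2.2
  rw [Complex.arg_eq_zero_iff_zero_le.2 hle, abs_zero] at harg
  exact hφ.not_gt harg

lemma isOpen_setOf_sub_mem_slitPlane (R : ℂ) : IsOpen {z : ℂ | R - z ∈ Complex.slitPlane} :=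
  Complex.isOpen_slitPlane.preimage (by fun_prop)

lemma exists_forall_mem_ball_of_norm_lt {R δ : ℝ} (hR : 0 < R) (hδ : 0 < δ) :
    ∃ S, R < S ∧ ∀ z : ℂ, ‖z‖ < S → R ≤ z.re → z ∈ Metric.ball (R : ℂ) δ := by
  obtain ⟨ε, hε0, hε⟩ : ∃ ε > 0, 2 * R * ε + ε ^ 2 < δ ^ 2 := by
    have hcont : ContinuousAt (fun ε : ℝ => 2 * R * ε + ε ^ 2) 0 := by fun_prop
    have hnhds := hcont.eventually_lt_const (u := δ ^ 2) (by simpa using pow_pos hδ 2)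
    obtain ⟨ε, hlt, hpos⟩ := ((hnhds.filter_mono nhdsWithin_le_nhds).and
      (self_mem_nhdsWithin (s := Ioi (0 : ℝ)))).exists
    exact ⟨ε, hpos, hlt⟩
  refine ⟨R + ε, by linarith, fun z hz hre => ?_⟩
  rw [mem_ball_iff_norm]
  refine lt_of_pow_lt_pow_left₀ 2 hδ.le ?_
  have hsq : ‖z‖ ^ 2 < (R + ε) ^ 2 := pow_lt_pow_left₀ hz (norm_nonneg z) two_ne_zero
  rw [← Complex.normSq_eq_norm_sq, Complex.normSq_apply] at hsq ⊢
  simp only [Complex.sub_re, Complex.ofReal_re, Complex.sub_im, Complex.ofReal_im, sub_zero]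
  nlinarith

/-- Near `R`, the function `F` on `re z < R` is the restriction of a function `L` that is
holomorphic off the cut `[R, ∞)`. -/
def ExtendsToSlit (F L : ℂ → ℂ) (R : ℝ) : Prop :=
  ∃ δ > 0,
    (∀ z ∈ Metric.ball (R : ℂ) δ, (R : ℂ) - z ∈ Complex.slitPlane → DifferentiableAt ℂ L z) ∧
    ∀ z ∈ Metric.ball (R : ℂ) δ, z.re < R → F z = L z

lemma ExtendsToSlit.eventuallyEq {F L : ℂ → ℂ} {R : ℝ} (hext : ExtendsToSlit F L R) :
    F =ᶠ[𝓝[{z : ℂ | z.re < R}] (R : ℂ)] L := by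
  obtain ⟨δ, hδ, -, hFL⟩ := hext
  filter_upwards [inter_mem_nhdsWithin _ (Metric.ball_mem_nhds _ hδ)] with z hz
  exact hFL z hz.2 hz.1

lemma ExtendsToSlit.exists_deltaDomain {R : ℝ} (hR : 0 < R) {F L : ℂ → ℂ}
    (hF : DifferentiableOn ℂ F {z | z.re < R}) (hFL : ExtendsToSlit F L R) :
    ∃ S, R < S ∧ ∃ G : ℂ → ℂ, AnalyticOnNhd ℂ G (DeltaDomain R S (π / 4)) ∧
      (∀ z : ℂ, z.re < R → G z = F z) ∧
      ∀ᶠ z in 𝓝[DeltaDomain R S (π / 4)] (R : ℂ), G z = L z := by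
  classical
  obtain ⟨δ, hδ, hL, hFL⟩ := hFL
  obtain ⟨S, hRS, hS⟩ := exists_forall_mem_ball_of_norm_lt hR hδ
  set G : ℂ → ℂ := fun z => if z.re < R then F z else L z
  have hGF : ∀ z : ℂ, z.re < R → G z = F z := fun z hz => if_pos hz
  have hGL : ∀ z ∈ Metric.ball (R : ℂ) δ, G z = L z := fun z hz => by
    by_cases hre : z.re < R
    · rw [hGF z hre, hFL z hz hre]
    · exact if_neg hre
  refine ⟨S, hRS, G, fun z hz => ?_, hGF, eventually_nhdsWithin_of_eventually_nhds
    (mem_of_superset (Metric.ball_mem_nhds _ hδ) hGL)⟩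
  by_cases hre : z.re < R
  · have hnhds := (Complex.isOpen_re_lt R).mem_nhds hre
    exact (hF.analyticAt hnhds).congr (mem_of_superset hnhds fun w hw => (hGF w hw).symm)
  · have hnhds : ∀ᶠ w in 𝓝 z, w ∈ Metric.ball (R : ℂ) δ ∧ (R : ℂ) - w ∈ Complex.slitPlane :=
      (Metric.isOpen_ball.eventually_mem (hS z hz.1 (not_lt.1 hre))).and
        ((isOpen_setOf_sub_mem_slitPlane R).eventually_mem
          (sub_mem_slitPlane_of_mem_deltaDomain (by positivity) hz))
    exact (Complex.analyticAt_iff_eventually_differentiableAt.2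
      (hnhds.mono fun w hw => hL w hw.1 hw.2)).congr (hnhds.mono fun w hw => (hGL w hw.1).symm)

lemma isDominantSingularity_of_re_lt {f g : ℂ → ℂ} {R : ℝ} (hR : 0 < R)
    (hg : DifferentiableOn ℂ g {z | z.re < R}) (hfg : g =ᶠ[𝓝 0] f)
    (hn : ¬ ContinuableAt g (Metric.ball 0 R) R) : IsDominantSingularity f R := by
  have hanalytic := hg.analyticOnNhd (Complex.isOpen_re_lt R)
  refine ⟨hR, g, hanalytic.mono (ball_subset_re_lt R), hfg, fun ζ hζ => ⟨?_, fun hne => ?_⟩⟩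
  · rintro hcont rfl
    exact hn hcont
  · refine ⟨g, hanalytic ζ ?_, EventuallyEq.rfl⟩
    have hnorm : ‖ζ‖ = R := mem_sphere_zero_iff_norm.1 hζ
    refine (hnorm ▸ Complex.re_le_norm ζ).lt_of_ne fun hre => hne ?_
    have hnonneg := Complex.re_eq_norm.1 (hre.trans hnorm.symm)
    exact Complex.ext (by simpa using hre) (by simpa using (Complex.nonneg_iff.1 hnonneg).2.symm)

lemma tendsto_ofReal_ball {R : ℝ} (hR : 0 < R) :
    Tendsto (fun x : ℝ => (x : ℂ)) (𝓝[<] R) (𝓝[Metric.ball 0 R] (R : ℂ)) := by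
  refine tendsto_nhdsWithin_iff.2
    ⟨(Complex.continuous_ofReal.tendsto R).mono_left nhdsWithin_le_nhds, ?_⟩
  filter_upwards [Ioo_mem_nhdsLT hR] with x hx
  rw [mem_ball_zero_iff, Complex.norm_real, norm_of_nonneg hx.1.le]
  exact hx.2

lemma neBot_nhdsWithin_ball {R : ℝ} (hR : 0 < R) : (𝓝[Metric.ball 0 R] (R : ℂ)).NeBot :=
  (tendsto_ofReal_ball hR).neBot

lemma eventually_hasDerivAt_of_eventuallyEq {U : Set ℂ} (hU : IsOpen U) {ζ : ℂ} {k g g' : ℂ → ℂ}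
    (hkg : k =ᶠ[𝓝[U] ζ] g) (hg : ∀ z ∈ U, HasDerivAt g (g' z) z) :
    ∀ᶠ z in 𝓝[U] ζ, HasDerivAt k (g' z) z := by
  filter_upwards [eventually_eventually_nhdsWithin.2 hkg, self_mem_nhdsWithin] with z hz hzU
  rw [hU.nhdsWithin_eq hzU] at hz
  exact (hg z hzU).congr_of_eventuallyEq hz

/-- The continuation of `f` is the logarithmic derivative of that of `C exp (κ F)`. -/
lemma continuableAt_of_exp {R : ℝ} {F f : ℂ → ℂ} {C κ ℓ : ℂ} (hC : C ≠ 0) (hκ : κ ≠ 0)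
    (hR : 0 < R) (hF : ∀ z ∈ Metric.ball (0 : ℂ) R, HasDerivAt F (f z) z)
    (hlim : Tendsto F (𝓝[Metric.ball 0 R] (R : ℂ)) (𝓝 ℓ))
    (hcont : ContinuableAt (fun z => C * Complex.exp (κ * F z)) (Metric.ball 0 R) R) :
    ContinuableAt f (Metric.ball 0 R) R := by
  obtain ⟨k, hk, hkg⟩ := hcont
  have := neBot_nhdsWithin_ball hR
  have hkR : k R = C * Complex.exp (κ * ℓ) :=
    tendsto_nhds_unique ((hk.continuousAt.tendsto.mono_left nhdsWithin_le_nhds).congr' hkg)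
      (((Complex.continuous_exp.tendsto _).comp (hlim.const_mul _)).const_mul _)
  have hkne : k R ≠ 0 := hkR ▸ mul_ne_zero hC (Complex.exp_ne_zero _)
  refine ⟨fun z => κ⁻¹ * (deriv k z / k z), analyticAt_const.mul (hk.deriv.div hk hkne), ?_⟩
  have hderiv := eventually_hasDerivAt_of_eventuallyEq Metric.isOpen_ball hkg
    fun z hz => (((hF z hz).const_mul κ).cexp.const_mul C)
  filter_upwards [hderiv, hkg] with z hz hkz
  have := Complex.exp_ne_zero (κ * F z)
  rw [hz.deriv, hkz]
  field_simp

/-- `R` is the dominant singularity of `f`, and along a Delta-domain at `R` the analytic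
continuation of `f` is equal to `p` up to an error equivalent to `g`. -/
def HasSingularExpansion (f : ℂ → ℂ) (R : ℝ) (p g : ℂ → ℂ) : Prop :=
  IsDominantSingularity f R ∧ ∃ S, R < S ∧ ∃ fc : ℂ → ℂ,
    AnalyticOnNhd ℂ fc (DeltaDomain R S (π / 4)) ∧ EqOn fc f (Metric.ball 0 R) ∧
      (fun z => fc z - p z) ~[𝓝[DeltaDomain R S (π / 4)] (R : ℂ)] g

/-! ### Expansions at a square-root singularity -/

lemma isLittleO_pow_succ_of_hasDerivAt {g g' : ℂ → ℂ} {n : ℕ} (hzero : g 0 = 0)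
    (hg : ∀ᶠ t in 𝓝 0, HasDerivAt g (g' t) t) (hg' : g' =o[𝓝 0] fun t => t ^ n) :
    g =o[𝓝 0] fun t => t ^ (n + 1) := by
  refine isLittleO_iff.2 fun ε hε => ?_
  obtain ⟨δ, hδ, hball⟩ := Metric.eventually_nhds_iff_ball.1 (hg.and (hg'.def hε))
  filter_upwards [Metric.ball_mem_nhds _ hδ] with t ht
  have hball' : ∀ s ∈ Metric.closedBall (0 : ℂ) ‖t‖, HasDerivAt g (g' s) s ∧ ‖g' s‖ ≤ ε * ‖s ^ n‖ :=
    fun s hs => hball s (Metric.closedBall_subset_ball (mem_ball_zero_iff.1 ht) hs)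
  have hle := (convex_closedBall (0 : ℂ) ‖t‖).norm_image_sub_le_of_norm_hasDerivWithin_le
    (f := g) (f' := g') (C := ε * ‖t‖ ^ n) (x := 0) (y := t)
    (fun s hs => (hball' s hs).1.hasDerivWithinAt) (fun s hs => ?_) (by simp) (by simp)
  · rwa [hzero, sub_zero, sub_zero, mul_assoc, ← pow_succ, ← norm_pow] at hle
  · refine (hball' s hs).2.trans ?_
    rw [norm_pow]
    have := mem_closedBall_zero_iff.1 hs
    gcongr

/-- Integration in the variable `t = √(R - z)`, in which `dz = -2 t dt`. -/
lemma exists_sqrt_primitive {R : ℝ} {F f e : ℂ → ℂ}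
    (hF : ∀ z : ℂ, z.re < R → HasDerivAt F (f z) z) (he : AnalyticAt ℂ e 0)
    (hfe : ∀ᶠ z in 𝓝[{z : ℂ | z.re < R}] (R : ℂ), f z * (-2 * (R - z).sqrt) = e (R - z).sqrt) :
    ∃ B : ℂ → ℂ, (∀ᶠ t in 𝓝 0, HasDerivAt B (e t) t) ∧
      ExtendsToSlit F (fun z => B (R - z).sqrt) R := by
  obtain ⟨η, hη, hball⟩ := Metric.eventually_nhds_iff_ball.1 he.eventually_analyticAt
  obtain ⟨B, hB⟩ := (AnalyticOnNhd.differentiableOn hball).isExactOn_ball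
  have hcomp : ∀ z : ℂ, (R : ℂ) - z ∈ Complex.slitPlane → (R - z).sqrt ∈ Metric.ball (0 : ℂ) η →
      HasDerivAt (fun z : ℂ => B (R - z).sqrt) (e (R - z).sqrt * (-1 / (2 * (R - z).sqrt))) z :=
    fun z hz hsqrt => (hB _ hsqrt).comp z (hasDerivAt_complexSqrt_sub hz)
  obtain ⟨δ, hδ, hball⟩ := Metric.eventually_nhds_iff_ball.1
    ((eventually_nhdsWithin_iff.1 hfe).and
      ((tendsto_complexSqrt_sub R).eventually (Metric.ball_mem_nhds 0 hη)))
  obtain ⟨k, hk⟩ := exists_eq_add_const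
    ((convex_ball (R : ℂ) δ).inter (convex_halfSpace_re_lt R)) (F := F)
    (L := fun z => B (R - z).sqrt) (fun z hz => hF z hz.2) fun z hz => by
      refine (hcomp z (sub_mem_slitPlane_of_re_lt hz.2) (hball z hz.1).2).congr_deriv ?_
      have := complexSqrt_ne_zero (Complex.slitPlane_ne_zero (sub_mem_slitPlane_of_re_lt hz.2))
      rw [← (hball z hz.1).1 hz.2]
      field_simp
  refine ⟨fun t => B t + k, ?_, δ, hδ, fun z hz hzslit => ?_, fun z hz hre => hk z ⟨hz, hre⟩⟩
  · filter_upwards [Metric.ball_mem_nhds _ hη] with t ht using (hB t ht).add_const k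
  · exact ((hcomp z hzslit (hball z hz).2).add_const k).differentiableAt

lemma isEquivalent_sqrt {l : Filter ℂ} {R : ℂ} (hl : l ≤ 𝓝 R) {B G : ℂ → ℂ} {C κ B' : ℂ}
    (hB : HasDerivAt B B' 0) (hne : C * Complex.exp (κ * B 0) * κ * B' ≠ 0)
    (hG : ∀ᶠ z in l, G z = C * Complex.exp (κ * B (R - z).sqrt)) :
    (fun z => G z - C * Complex.exp (κ * B 0)) ~[l]
      fun z => C * Complex.exp (κ * B 0) * κ * B' * (R - z).sqrt := by
  have hq := (hasDerivAt_iff_isLittleO.1 ((hB.const_mul κ).cexp.const_mul C)).comp_tendsto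
    ((tendsto_complexSqrt_sub R).mono_left hl)
  refine ((isLittleO_const_mul_right_iff hne).2 hq).congr' ?_ ?_
  · filter_upwards [hG] with z hz
    simp only [Pi.sub_apply, Function.comp, hz, sub_zero, smul_eq_mul]
    ring
  · exact Eventually.of_forall fun z => by simp only [Function.comp, sub_zero]

lemma isLittleO_cube_of_hasDerivAt_mul {q r : ℂ → ℂ} {r' : ℂ}
    (hq : ∀ᶠ t in 𝓝 0, HasDerivAt q (t * r t) t) (hr : HasDerivAt r r' 0) :
    (fun t => q t - q 0 - (r 0 / 2 * t ^ 2 + r' / 3 * t ^ 3)) =o[𝓝 0] fun t => t ^ 3 := by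
  refine isLittleO_pow_succ_of_hasDerivAt (n := 2)
    (g' := fun t => t * (r t - r 0 - r' * t)) (by simp) ?_ ?_
  · filter_upwards [hq] with t ht
    refine ((ht.sub_const (q 0)).sub ((((hasDerivAt_id t).pow 2).const_mul (r 0 / 2)).add
      (((hasDerivAt_id t).pow 3).const_mul (r' / 3)))).congr_deriv ?_
    simp only [id]
    ring
  · refine ((isBigO_refl (fun t : ℂ => t) (𝓝 0)).mul_isLittleO
      (hasDerivAt_iff_isLittleO.1 hr)).congr (fun t => ?_) fun t => ?_
    · simp only [sub_zero, smul_eq_mul]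
      ring
    · ring

lemma isEquivalent_sqrt_cubed {l : Filter ℂ} {R : ℂ} (hl : l ≤ 𝓝 R) {B p G : ℂ → ℂ}
    {C κ p' : ℂ} (hB : ∀ᶠ t in 𝓝 0, HasDerivAt B (-2 * t * p t) t) (hp : HasDerivAt p p' 0)
    (hne : C * Complex.exp (κ * B 0) * κ * p' ≠ 0)
    (hG : ∀ᶠ z in l, G z = C * Complex.exp (κ * B (R - z).sqrt)) :
    (fun z => G z -
        (C * Complex.exp (κ * B 0) - C * Complex.exp (κ * B 0) * κ * p 0 * (R - z))) ~[l]
      fun z => -(2 / 3) * (C * Complex.exp (κ * B 0) * κ * p') * (R - z).sqrt ^ 3 := by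
  set q : ℂ → ℂ := fun t => C * Complex.exp (κ * B t) with hq
  have hqd : ∀ᶠ t in 𝓝 0, HasDerivAt q (t * (-2 * κ * q t * p t)) t := by
    filter_upwards [hB] with t ht
    exact ((ht.const_mul κ).cexp.const_mul C).congr_deriv (by rw [hq]; ring)
  have hrd : HasDerivAt (fun t => -2 * κ * q t * p t) (-2 * κ * q 0 * p') 0 :=
    ((hqd.self_of_nhds.const_mul (-2 * κ)).mul hp).congr_deriv (by ring)
  have ho := (isLittleO_cube_of_hasDerivAt_mul hqd hrd).comp_tendsto
    ((tendsto_complexSqrt_sub R).mono_left hl)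
  refine ((isLittleO_const_mul_right_iff (mul_ne_zero (by norm_num) hne)).2 ho).congr' ?_
    EventuallyEq.rfl
  filter_upwards [hG] with z hz
  simp only [Pi.sub_apply, Function.comp, hz, hq, complexSqrt_sq]
  ring

lemma intervalIntegrable_of_hasDerivAt_of_nonneg {G g : ℝ → ℝ} {c d ℓc ℓd : ℝ} (hcd : c < d)
    (hG : ∀ x ∈ Ioo c d, HasDerivAt G (g x) x) (hg : ∀ x ∈ Ioo c d, 0 ≤ g x)
    (hc : Tendsto G (𝓝[>] c) (𝓝 ℓc)) (hd : Tendsto G (𝓝[<] d) (𝓝 ℓd)) :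
    IntervalIntegrable g volume c d := by
  have hcont : ContinuousOn G (Ioo c d) := HasDerivAt.continuousOn hG
  refine intervalIntegral.intervalIntegrable_deriv_of_nonneg (g := extendFrom (Ioo c d) G) ?_ ?_ ?_
  · rw [uIcc_of_le hcd.le]
    exact continuousOn_Icc_extendFrom_Ioo hcont hc hd
  · rw [min_eq_left hcd.le, max_eq_right hcd.le]
    exact fun x hx => (hG x hx).congr_of_eventuallyEq
      (mem_of_superset (isOpen_Ioo.mem_nhds hx) fun y hy => extendFrom_extends hcont y hy)
  · rwa [min_eq_left hcd.le, max_eq_right hcd.le]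

lemma exists_integral_eq_of_real_nonneg {R : ℝ} (hR : 1 < R) {F f : ℂ → ℂ} {ℓ : ℂ} (hF1 : F 1 = 0)
    (hF : ∀ z : ℂ, z.re < R → HasDerivAt F (f z) z)
    (hr : ∀ x : ℝ, 1 < x → x < R → ∃ r : ℝ, 0 ≤ r ∧ f x = r)
    (hlim : Tendsto F (𝓝[{z : ℂ | z.re < R}] (R : ℂ)) (𝓝 ℓ)) :
    ∃ β : ℝ, ℓ = β ∧ ∫ x in (1 : ℝ)..R, f x = β := by
  have hderiv : ∀ x < R, HasDerivAt (fun x : ℝ => F x) (f x) x := fun x hx =>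
    (hF x (by simpa using hx)).comp_ofReal
  have hright : Tendsto (fun x : ℝ => F x) (𝓝[<] R) (𝓝 ℓ) := hlim.comp (tendsto_ofReal_nhdsLT R)
  have hleft : Tendsto (fun x : ℝ => F x) (𝓝[>] 1) (𝓝 0) := by
    simpa [hF1] using (hderiv 1 hR).continuousAt.tendsto.mono_left nhdsWithin_le_nhds
  have hre : ∀ x ∈ Ioo 1 R, 0 ≤ (f x).re ∧ ((f x).re : ℂ) = f x := fun x hx => by
    obtain ⟨r, hr0, hfr⟩ := hr x hx.1 hx.2
    simp [hfr, hr0]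
  have hint : IntervalIntegrable (fun x : ℝ => (f x).re) volume 1 R :=
    intervalIntegrable_of_hasDerivAt_of_nonneg hR
      (fun x hx => Complex.reCLM.hasFDerivAt.comp_hasDerivAt x (hderiv x hx.2))
      (fun x hx => (hre x hx).1) ((Complex.continuous_re.tendsto _).comp hleft)
      ((Complex.continuous_re.tendsto _).comp hright)
  have heq : EqOn (fun x : ℝ => ((f x).re : ℂ)) (fun x => f x) (Ioo 1 R) := fun x hx => (hre x hx).2
  have hintegral : ∫ x in (1 : ℝ)..R, f x = ((∫ x in (1 : ℝ)..R, (f x).re : ℝ) : ℂ) := by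
    rw [← intervalIntegral.integral_ofReal]
    exact (intervalIntegral.integral_congr_Ioo_of_le hR.le heq).symm
  have hFTC := intervalIntegral.integral_eq_sub_of_hasDerivAt_of_tendsto hR
    (fun x hx => hderiv x hx.2) ((intervalIntegrable_congr_uIoo (uIoo_of_le hR.le ▸ heq)).1
      ⟨hint.1.ofReal, hint.2.ofReal⟩) hleft hright
  rw [sub_zero] at hFTC
  exact ⟨_, hFTC.symm.trans hintegral, hintegral⟩

/-! ### Singularities of `h` and `f₁` -/

/-- The equation determines `g` from `f` as `(1 + z f z) / (1 + f z)`. -/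
lemma continuableAt_of_mul_sub_eq {U : Set ℂ} {ζ ℓ : ℂ} {f g : ℂ → ℂ} [(𝓝[U] ζ).NeBot]
    (hζ : ζ ≠ 1) (hfg : ∀ z ∈ U, f z * (g z - z) = 1 - g z) (hg : Tendsto g (𝓝[U] ζ) (𝓝 ℓ))
    (hf : ContinuableAt f U ζ) : ContinuableAt g U ζ := by
  obtain ⟨k, hk, hkf⟩ := hf
  have hklim := hk.continuousAt.tendsto.mono_left (nhdsWithin_le_nhds (s := U))
  have hkg : ∀ᶠ z in 𝓝[U] ζ, k z * (g z - z) = 1 - g z := by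
    filter_upwards [hkf, self_mem_nhdsWithin] with z hz hzU
    rw [hz, hfg z hzU]
  have hid : Tendsto (fun z : ℂ => z) (𝓝[U] ζ) (𝓝 ζ) := nhdsWithin_le_nhds
  have hlim := tendsto_nhds_unique ((hklim.mul (hg.sub hid)).congr' hkg) (hg.const_sub 1)
  have hne : 1 + k ζ ≠ 0 := fun h => hζ (by linear_combination hlim - (ℓ - ζ) * h)
  refine ⟨fun z => (1 + k z * z) / (1 + k z), (analyticAt_const.add (hk.mul analyticAt_id)).div
    (analyticAt_const.add hk) hne, ?_⟩
  filter_upwards [hkg, (hklim.const_add 1).eventually_ne hne] with z hz hkz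
  rw [div_eq_iff hkz]
  linear_combination -hz

namespace IsCriticalFamily

variable {M : ℕ → ℂ → ℂ} {m : ℕ → ℝ → ℝ} {A a b u₀ : ℝ}

lemma not_continuableAt_zMapInv (hM : IsCriticalFamily M m A a b u₀) :
    ¬ ContinuableAt (zMapInv M a b u₀) (Metric.ball 0 (zMapReal m a b u₀)) (zMapReal m a b u₀) := by
  rintro ⟨k, hk, hkinv⟩
  set R := zMapReal m a b u₀
  have hball := ball_subset_re_lt R
  have := neBot_nhdsWithin_ball (one_pos.trans hM.one_lt_zMapReal_u₀)
  have hderiv : ∀ᶠ z in 𝓝[Metric.ball 0 R] (R : ℂ),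
      deriv k z * (1 - a * M 1 (zMapInv M a b u₀ z)) = b := by
    filter_upwards [eventually_hasDerivAt_of_eventuallyEq Metric.isOpen_ball hkinv
      fun z hz => hM.hasDerivAt_zMapInv (hball hz), self_mem_nhdsWithin] with z hz hzball
    rw [hz.deriv]
    exact div_mul_cancel₀ _ (hM.one_sub_mul_ne_zero (hM.zMapInv_re_lt le_rfl (hball hzball)))
  have hlim := (hk.deriv.continuousAt.tendsto.mono_left nhdsWithin_le_nhds).mul
    (((hM.tendsto_moment_zMapInv 1).mono_left (nhdsWithin_mono _ hball)).const_mul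
      (a : ℂ) |>.const_sub 1)
  have hzero := tendsto_nhds_unique (hlim.congr' hderiv) tendsto_const_nhds
  have hcrit : (a : ℂ) * m 1 u₀ = 1 := by exact_mod_cast hM.mul_real_u₀
  rw [hcrit, sub_self, mul_zero] at hzero
  exact hM.ofReal_b_ne_zero hzero.symm

lemma not_continuableAt_moment_zMapInv (hM : IsCriticalFamily M m A a b u₀) :
    ¬ ContinuableAt (fun z => M 0 (zMapInv M a b u₀ z)) (Metric.ball 0 (zMapReal m a b u₀))
      (zMapReal m a b u₀) := by
  rintro ⟨k, hk, hkM⟩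
  refine hM.not_continuableAt_zMapInv ⟨fun z => a * (k z - 1) + b * (z - 1), by fun_prop, ?_⟩
  filter_upwards [hkM, self_mem_nhdsWithin] with z hz hzball
  have hzMap := hM.zMap_zMapInv (ball_subset_re_lt _ hzball)
  have hbne := hM.ofReal_b_ne_zero
  rw [zMap, ← eq_sub_iff_add_eq', div_eq_iff hbne] at hzMap
  simp only [hz]
  linear_combination -hzMap

end IsCriticalFamily

namespace IsRetrialModel

variable {M : ℕ → ℂ → ℂ} {m : ℕ → ℝ → ℝ} {A a b u₀ uStar : ℝ}

lemma zMapInv_f₁Lift_mul (hM : IsRetrialModel M m A a b u₀ uStar) {z : ℂ}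
    (hz : z.re < zMapReal m a b (min u₀ uStar)) :
    f₁Lift M a b (zMapInv M a b u₀ z) * (M 0 (zMapInv M a b u₀ z) - z) =
      1 - M 0 (zMapInv M a b u₀ z) := by
  have hmul := hM.f₁Lift_mul hM.b_pos.ne' (hM.reducedDenom_zMapInv_ne_zero hz)
  rwa [hM.zMap_zMapInv (hz.trans_le hM.zMapReal_min_le)] at hmul

lemma not_continuableAt_f₁Lift_zMapInv_of_lt (hM : IsRetrialModel M m A a b u₀ uStar)
    (hlt : u₀ < uStar) :
    ¬ ContinuableAt (fun z => f₁Lift M a b (zMapInv M a b u₀ z))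
      (Metric.ball 0 (zMapReal m a b u₀)) (zMapReal m a b u₀) := fun hcont => by
  have hball := ball_subset_re_lt (zMapReal m a b u₀)
  have := neBot_nhdsWithin_ball (one_pos.trans hM.one_lt_zMapReal_u₀)
  refine hM.not_continuableAt_moment_zMapInv (continuableAt_of_mul_sub_eq
    (by exact_mod_cast hM.one_lt_zMapReal_u₀.ne') (fun z hz => hM.zMapInv_f₁Lift_mul ?_)
    ((hM.tendsto_moment_zMapInv 0).mono_left (nhdsWithin_mono _ hball)) hcont)
  rw [min_eq_left hlt.le]
  exact hball hz

lemma not_continuableAt_f₁Lift_zMapInv_of_le (hM : IsRetrialModel M m A a b u₀ uStar)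
    (hle : uStar ≤ u₀) :
    ¬ ContinuableAt (fun z => f₁Lift M a b (zMapInv M a b u₀ z))
      (Metric.ball 0 (zMapReal m a b uStar)) (zMapReal m a b uStar) := by
  rintro ⟨k, hk, hkf⟩
  have hmin := min_eq_right hle
  have hball := ball_subset_re_lt (zMapReal m a b uStar)
  have := neBot_nhdsWithin_ball (one_pos.trans (hmin ▸ hM.one_lt_zMapReal_min))
  have hnhds := (Complex.isOpen_re_lt A).mem_nhds
    (show (uStar : ℂ).re < A by simpa using hM.uStar_lt)
  have hmul : ∀ᶠ z in 𝓝[Metric.ball 0 (zMapReal m a b uStar)] (zMapReal m a b uStar : ℂ),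
      k z * reducedDenom M a b (zMapInv M a b u₀ z) =
        b * dslope (M 0) 0 (zMapInv M a b u₀ z) := by
    filter_upwards [hkf, self_mem_nhdsWithin] with z hz hzball
    rw [hz]
    exact div_mul_cancel₀ _ (hM.reducedDenom_zMapInv_ne_zero (hmin.symm ▸ hball hzball))
  have hinv := (hM.tendsto_zMapInv_of_le hle).mono_left (nhdsWithin_mono _ hball)
  have hden := ((hM.differentiableOn_reducedDenom a b).differentiableAt
    hnhds).continuousAt.tendsto.comp hinv
  have hnum := (hM.differentiableOn_dslope.differentiableAt hnhds).continuousAt.tendsto.comp hinv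
  have hzero := tendsto_nhds_unique
    (((hk.continuousAt.tendsto.mono_left nhdsWithin_le_nhds).mul hden).congr' hmul)
    (hnum.const_mul (b : ℂ))
  have hab : (a : ℂ) + b ≠ 0 := by exact_mod_cast hM.add_pos.ne'
  rw [hM.reducedDenom_uStar, hM.dslope_uStar, mul_zero] at hzero
  exact mul_ne_zero hM.ofReal_b_ne_zero (one_div_ne_zero hab) hzero.symm

lemma not_continuableAt_f₁Lift_zMapInv (hM : IsRetrialModel M m A a b u₀ uStar) :
    ¬ ContinuableAt (fun z => f₁Lift M a b (zMapInv M a b u₀ z))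
      (Metric.ball 0 (zMapReal m a b (min u₀ uStar))) (zMapReal m a b (min u₀ uStar)) := by
  rcases le_or_gt uStar u₀ with hle | hlt
  · rw [min_eq_right hle]
    exact hM.not_continuableAt_f₁Lift_zMapInv_of_le hle
  · rw [min_eq_left hlt.le]
    exact hM.not_continuableAt_f₁Lift_zMapInv_of_lt hlt

end IsRetrialModel

/-! ### The function `f₁` at a square-root singularity -/

lemma exists_eq_mul_of_hasDerivAt {g : ℂ → ℂ} {w g' : ℂ} (hg : AnalyticAt ℂ g w) (hw : g w = 0)
    (hg' : HasDerivAt g g' w) :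
    ∃ k : ℂ → ℂ, AnalyticAt ℂ k w ∧ k w = g' ∧ ∀ z, g z = (z - w) * k z :=
  ⟨dslope g w, analyticAt_dslope hg, (dslope_same g w).trans hg'.deriv, fun z => by
    simpa [hw] using (sub_smul_dslope g w z).symm⟩

namespace IsMomentFamily

variable {M : ℕ → ℂ → ℂ} {m : ℕ → ℝ → ℝ} {A : ℝ}

lemma analyticAt_dslope (hM : IsMomentFamily M m A) {u : ℂ} (hu : u.re < A) :
    AnalyticAt ℂ (dslope (M 0) 0) u :=
  hM.differentiableOn_dslope.analyticAt ((Complex.isOpen_re_lt A).mem_nhds hu)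

lemma analyticAt_reducedDenom (hM : IsMomentFamily M m A) (a b : ℝ) {u : ℂ} (hu : u.re < A) :
    AnalyticAt ℂ (reducedDenom M a b) u :=
  (hM.differentiableOn_reducedDenom a b).analyticAt ((Complex.isOpen_re_lt A).mem_nhds hu)

lemma analyticAt_f₁Lift (hM : IsMomentFamily M m A) {a b : ℝ} {u : ℂ} (hu : u.re < A)
    (hne : reducedDenom M a b u ≠ 0) : AnalyticAt ℂ (f₁Lift M a b) u :=
  (analyticAt_const.mul (hM.analyticAt_dslope hu)).div (hM.analyticAt_reducedDenom a b hu) hne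

end IsMomentFamily

namespace IsCriticalFamily

variable {M : ℕ → ℂ → ℂ} {m : ℕ → ℝ → ℝ} {A a b u₀ : ℝ}

lemma sqrt_coeff_pos (hM : IsCriticalFamily M m A a b u₀) : 0 < √(2 * b / (a ^ 3 * m 2 u₀)) := by
  have := hM.a_pos
  have := hM.b_pos
  have := hM.pos 2 u₀ hM.u₀_lt
  positivity

lemma neg_one_div_sqrt (hM : IsCriticalFamily M m A a b u₀) :
    -1 / √(a * m 2 u₀ / (2 * b)) = -(a * √(2 * b / (a ^ 3 * m 2 u₀))) := by
  have ha := hM.a_pos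
  have hb := hM.b_pos
  have hm := hM.pos 2 u₀ hM.u₀_lt
  have hinv : 2 * b / (a ^ 3 * m 2 u₀) = (1 / a) ^ 2 * (a * m 2 u₀ / (2 * b))⁻¹ := by field_simp
  rw [hinv, Real.sqrt_mul (sq_nonneg _), Real.sqrt_sq (by positivity), Real.sqrt_inv]
  field_simp

end IsCriticalFamily

namespace IsRetrialModel

variable {M : ℕ → ℂ → ℂ} {m : ℕ → ℝ → ℝ} {A a b u₀ uStar : ℝ}

lemma real_sub_zMapReal_ne_zero (hM : IsRetrialModel M m A a b u₀ uStar) {x : ℝ} (hx0 : 0 < x)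
    (hxA : x < A) (hx : x ≠ uStar) : m 0 x - zMapReal m a b x ≠ 0 := by
  have hsub := hM.moment_sub_zMap a hM.b_pos.ne' x
  rw [hM.zMap_ofReal hxA, hM.ofReal 0 x hxA] at hsub
  have hne : (m 0 x : ℂ) - zMapReal m a b x ≠ 0 := hsub ▸ div_ne_zero (neg_ne_zero.2 (mul_ne_zero
    (by exact_mod_cast hx0.ne') (hM.reducedDenom_ofReal_ne_zero hx0 hxA hx))) hM.ofReal_b_ne_zero
  exact_mod_cast hne

lemma hasDerivAt_f₁Lift_u₀ (hM : IsRetrialModel M m A a b u₀ uStar) (hne : u₀ ≠ uStar) :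
    HasDerivAt (f₁Lift M a b)
      ((zMapReal m a b u₀ - 1) / (a * (m 0 u₀ - zMapReal m a b u₀) ^ 2) : ℝ) u₀ := by
  have hu₀ : (u₀ : ℂ).re < A := by simpa using hM.u₀_lt
  have hmR : (m 0 u₀ : ℂ) - zMapReal m a b u₀ ≠ 0 := by
    exact_mod_cast hM.real_sub_zMapReal_ne_zero hM.u₀_pos hM.u₀_lt hne
  have hane : (a : ℂ) ≠ 0 := by exact_mod_cast hM.a_pos.ne'
  have hm₁ : (m 1 u₀ : ℂ) = 1 / a := by
    rw [eq_div_iff hane, mul_comm]; exact_mod_cast hM.mul_real_u₀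
  have hquot := ((hM.hasDerivAt 0 u₀ hu₀).const_sub 1).div
    ((hM.hasDerivAt 0 u₀ hu₀).sub (hM.hasDerivAt_zMap hu₀))
    (by rwa [Pi.sub_apply, hM.zMap_ofReal hM.u₀_lt, hM.ofReal 0 u₀ hM.u₀_lt])
  have hev : f₁Lift M a b =ᶠ[𝓝 (u₀ : ℂ)] fun u => (1 - M 0 u) / (M 0 u - zMap M a b u) := by
    filter_upwards [isOpen_ne.mem_nhds (show (u₀ : ℂ) ≠ 0 by exact_mod_cast hM.u₀_pos.ne')]
      with u hu using hM.f₁Lift_eq hM.b_pos.ne' hu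
  refine (hquot.congr_of_eventuallyEq hev).congr_deriv ?_
  rw [zero_add, Pi.sub_apply, hM.zMap_ofReal hM.u₀_lt, hM.ofReal 0 u₀ hM.u₀_lt,
    hM.ofReal 1 u₀ hM.u₀_lt, hm₁]
  push_cast
  field_simp
  ring

lemma exists_sqrt_primitive_of_lt (hM : IsRetrialModel M m A a b u₀ uStar) (hlt : u₀ < uStar)
    {F : ℂ → ℂ} (hF : ∀ z : ℂ, z.re < zMapReal m a b u₀ →
      HasDerivAt F (f₁Lift M a b (zMapInv M a b u₀ z)) z) :
    ∃ B p : ℂ → ℂ, (∀ᶠ t in 𝓝 0, HasDerivAt B (-2 * t * p t) t) ∧ p 0 = f₁Lift M a b u₀ ∧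
      HasDerivAt p (-((zMapReal m a b u₀ - 1) / (m 0 u₀ - zMapReal m a b u₀) ^ 2 *
        √(2 * b / (a ^ 3 * m 2 u₀)) : ℝ)) 0 ∧
      ExtendsToSlit F (fun z => B (zMapReal m a b u₀ - z).sqrt) (zMapReal m a b u₀) := by
  obtain ⟨ψ, hψa, hψ0, hψd, -, hψ⟩ := hM.exists_sqrt_param
  have hp : AnalyticAt ℂ (fun t => f₁Lift M a b (ψ t)) 0 :=
    (hψ0.symm ▸ hM.analyticAt_f₁Lift (by simpa using hM.u₀_lt)
      (hM.reducedDenom_ofReal_ne_zero hM.u₀_pos hM.u₀_lt hlt.ne)).comp hψa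
  obtain ⟨B, hB, hext⟩ := exists_sqrt_primitive hF
    (e := fun t => -2 * t * f₁Lift M a b (ψ t)) ((analyticAt_const.mul analyticAt_id).mul hp) (by
      filter_upwards [hψ] with z hz
      rw [hz]; ring)
  refine ⟨B, fun t => f₁Lift M a b (ψ t), hB, by simp only [hψ0], ?_, hext⟩
  have hd : HasDerivAt (f₁Lift M a b) _ (ψ 0) := hψ0.symm ▸ hM.hasDerivAt_f₁Lift_u₀ hlt.ne
  refine (hd.comp 0 hψd).congr_deriv ?_
  have ha := hM.a_pos.ne'
  have hscale : -1 / (√(a * m 2 u₀ / (2 * b)) : ℂ) = (-(a * √(2 * b / (a ^ 3 * m 2 u₀))) : ℝ) := by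
    exact_mod_cast hM.neg_one_div_sqrt
  rw [hscale, ← Complex.ofReal_mul, ← Complex.ofReal_neg, Complex.ofReal_inj]
  field_simp

lemma exists_reducedDenom_comp_eq_mul (hM : IsRetrialModel M m A a b u₀ u₀) {ψ : ℂ → ℂ}
    (hψa : AnalyticAt ℂ ψ 0) (hψ0 : ψ 0 = u₀)
    (hψd : HasDerivAt ψ (-1 / (√(a * m 2 u₀ / (2 * b)) : ℂ)) 0) :
    ∃ k : ℂ → ℂ, AnalyticAt ℂ k 0 ∧ k 0 = (b * √(2 * b / (a ^ 3 * m 2 u₀)) / u₀ : ℝ) ∧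
      ∀ t, reducedDenom M a b (ψ t) = t * k t := by
  have hd : HasDerivAt (reducedDenom M a b) _ (ψ 0) :=
    hψ0.symm ▸ hM.hasDerivAt_reducedDenom_uStar
  have hcomp : AnalyticAt ℂ (fun t => reducedDenom M a b (ψ t)) 0 :=
    (hM.analyticAt_reducedDenom a b (by simpa [hψ0] using hM.u₀_lt)).comp hψa
  obtain ⟨k, hk, hk0, hkψ⟩ := exists_eq_mul_of_hasDerivAt hcomp
    ((congrArg _ hψ0).trans hM.reducedDenom_uStar) (hd.comp 0 hψd)
  refine ⟨k, hk, hk0.trans ?_, by simpa only [sub_zero] using hkψ⟩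
  have ha := hM.a_pos.ne'
  have hm₁ : m 1 u₀ = 1 / a := by rw [eq_div_iff ha, mul_comm]; exact hM.mul_real_u₀
  have hscale : -1 / (√(a * m 2 u₀ / (2 * b)) : ℂ) = (-(a * √(2 * b / (a ^ 3 * m 2 u₀))) : ℝ) := by
    exact_mod_cast hM.neg_one_div_sqrt
  rw [hscale, hm₁, ← Complex.ofReal_neg, ← Complex.ofReal_mul, Complex.ofReal_inj]
  field_simp
  ring

/-- Where `u₀` and `uStar` coincide, the simple zero of `reducedDenom` cancels the factor `t` of
`dz = -2 t dt`. -/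
lemma exists_sqrt_primitive_of_eq (hM : IsRetrialModel M m A a b u₀ u₀) {F : ℂ → ℂ}
    (hF : ∀ z : ℂ, z.re < zMapReal m a b u₀ →
      HasDerivAt F (f₁Lift M a b (zMapInv M a b u₀ z)) z) :
    ∃ B e : ℂ → ℂ, (∀ᶠ t in 𝓝 0, HasDerivAt B (e t) t) ∧
      e 0 = (-2 * ((zMapReal m a b u₀ - 1) / √(2 * b / (a ^ 3 * m 2 u₀))) : ℝ) ∧
      ExtendsToSlit F (fun z => B (zMapReal m a b u₀ - z).sqrt) (zMapReal m a b u₀) := by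
  obtain ⟨ψ, hψa, hψ0, hψd, -, hψ⟩ := hM.exists_sqrt_param
  obtain ⟨k, hk, hk0, hkψ⟩ := hM.exists_reducedDenom_comp_eq_mul hψa hψ0 hψd
  have hb := hM.b_pos.ne'
  have hu := hM.u₀_pos.ne'
  have hc := hM.sqrt_coeff_pos.ne'
  have hkne : k 0 ≠ 0 := by
    rw [hk0]; exact_mod_cast div_ne_zero (mul_ne_zero hb hc) hu
  have he : AnalyticAt ℂ (fun t => -2 * (b * dslope (M 0) 0 (ψ t)) / k t) 0 :=
    (analyticAt_const.mul (analyticAt_const.mul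
      ((hM.analyticAt_dslope (by simpa [hψ0] using hM.u₀_lt)).comp hψa))).div hk hkne
  obtain ⟨B, hB, hext⟩ := exists_sqrt_primitive hF he (by
    filter_upwards [hψ, self_mem_nhdsWithin] with z hz hre
    have hroot : (zMapReal m a b u₀ - z).sqrt ≠ 0 := complexSqrt_ne_zero fun hzero => by
      rw [← sub_eq_zero.1 hzero] at hre
      exact absurd hre (by simp)
    rw [hz, f₁Lift, hkψ]
    rcases eq_or_ne (k (zMapReal m a b u₀ - z).sqrt) 0 with hzero | hne
    · simp [hzero]
    · field_simp)
  refine ⟨B, _, hB, ?_, hext⟩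
  have hRu := hM.mul_zMapReal_uStar_sub_one
  have hab := hM.add_pos.ne'
  have hvalue : -2 * (b * (1 / (a + b))) / (b * √(2 * b / (a ^ 3 * m 2 u₀)) / u₀) =
      -2 * ((zMapReal m a b u₀ - 1) / √(2 * b / (a ^ 3 * m 2 u₀))) := by
    field_simp
    linear_combination hRu
  rw [hk0, hψ0, hM.dslope_uStar, ← hvalue]
  push_cast
  rfl

end IsRetrialModel

/-! ### Simple poles -/

lemma exists_div_eq_add_div_sub {W : Set ℂ} (hW : IsOpen W) {N D : ℂ → ℂ} {R D' : ℂ} (hR : R ∈ W)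
    (hN : DifferentiableOn ℂ N W) (hD : DifferentiableOn ℂ D W) (hD0 : D R = 0)
    (hD' : HasDerivAt D D' R) (hne : D' ≠ 0) :
    ∃ (V : Set ℂ) (g : ℂ → ℂ), IsOpen V ∧ R ∈ V ∧ (∀ z ∈ W, D z ≠ 0 → z ∈ V) ∧
      DifferentiableOn ℂ g V ∧ ∀ z ∈ V, z ≠ R → N z / D z = g z + N R / D' / (z - R) := by
  have hK : DifferentiableOn ℂ (dslope D R) W :=
    (Complex.differentiableOn_dslope (hW.mem_nhds hR)).2 hD
  have hKR : dslope D R R = D' := (dslope_same D R).trans hD'.deriv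
  have hDK : ∀ z, D z = (z - R) * dslope D R z := fun z => by
    simpa [hD0] using (sub_smul_dslope D R z).symm
  have hV : IsOpen (W ∩ dslope D R ⁻¹' {0}ᶜ) :=
    hK.continuousOn.isOpen_inter_preimage hW isOpen_compl_singleton
  have hRV : R ∈ W ∩ dslope D R ⁻¹' {0}ᶜ := ⟨hR, by rw [mem_preimage, hKR]; exact hne⟩
  have hp : DifferentiableOn ℂ (fun z => N z / dslope D R z) (W ∩ dslope D R ⁻¹' {0}ᶜ) :=
    (hN.mono inter_subset_left).div (hK.mono inter_subset_left) fun z hz => hz.2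
  refine ⟨_, dslope (fun z => N z / dslope D R z) R, hV, hRV,
    fun z hz hDz => ⟨hz, fun hzero => hDz (by rw [hDK, hzero, mul_zero])⟩,
    (Complex.differentiableOn_dslope (hV.mem_nhds hRV)).2 hp, fun z hz hzR => ?_⟩
  have hK0 : dslope D R z ≠ 0 := hz.2
  have hz0 := sub_ne_zero.2 hzR
  rw [dslope_of_ne _ hzR, slope_def_field, hKR, hDK]
  field_simp
  ring

lemma hasDerivAt_const_mul_log_sub (c : ℂ) {R z : ℂ} (hz : R - z ∈ Complex.slitPlane) :
    HasDerivAt (fun z : ℂ => c * Complex.log (R - z)) (-(c / (R - z))) z :=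
  ((((hasDerivAt_id' z).const_sub R).clog hz).const_mul c).congr_deriv (by ring)

lemma tendsto_sub_nhdsLT (R : ℝ) : Tendsto (fun x => R - x) (𝓝[<] R) (𝓝[>] 0) := by
  refine tendsto_nhdsWithin_iff.2 ⟨?_, ?_⟩
  · have hsub : Tendsto (fun x => R - x) (𝓝 R) (𝓝 (R - R)) := Continuous.tendsto (by fun_prop) R
    rw [sub_self] at hsub
    exact hsub.mono_left nhdsWithin_le_nhds
  · filter_upwards [self_mem_nhdsWithin] with x hx using sub_pos.2 (mem_Iio.1 hx)

section Logarithm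

variable {R c : ℝ} {F g P : ℂ → ℂ}

lemma exists_log_primitive {V : Set ℂ} (hV : IsOpen V) (hR : (R : ℂ) ∈ V)
    (hg : DifferentiableOn ℂ g V)
    (hF : ∀ z : ℂ, z.re < R → HasDerivAt F (g z + c / (R - z)) z) :
    ∃ P : ℂ → ℂ, ContinuousAt P R ∧ ExtendsToSlit F (fun z => P z - c * Complex.log (R - z)) R := by
  obtain ⟨δ, hδ, hball⟩ := Metric.isOpen_iff.1 hV _ hR
  obtain ⟨P, hP⟩ := (hg.mono hball).isExactOn_ball
  have hL : ∀ z ∈ Metric.ball (R : ℂ) δ, (R : ℂ) - z ∈ Complex.slitPlane →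
      HasDerivAt (fun z => P z - c * Complex.log (R - z)) (g z + c / (R - z)) z :=
    fun z hz hslit => ((hP z hz).sub (hasDerivAt_const_mul_log_sub c hslit)).congr_deriv (by ring)
  obtain ⟨k, hk⟩ := exists_eq_add_const
    ((convex_ball (R : ℂ) δ).inter (convex_halfSpace_re_lt R)) (fun z hz => hF z hz.2)
    fun z hz => hL z hz.1 (sub_mem_slitPlane_of_re_lt hz.2)
  refine ⟨fun z => P z + k, ((hP R (Metric.mem_ball_self hδ)).add_const k).continuousAt, δ, hδ,
    fun z hz hslit => ?_, fun z hz hre => (hk z ⟨hz, hre⟩).trans (by ring)⟩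
  exact ((hL z hz hslit).differentiableAt.add_const k).congr_of_eventuallyEq
    (.of_forall fun w => by ring)

lemma ExtendsToSlit.eq_log_add_integral (hR : 1 < R) (hF1 : F 1 = 0)
    (hF : ∀ z : ℂ, z.re < R → HasDerivAt F (g z + c / (R - z)) z)
    (hg : ContinuousOn (fun x : ℝ => g x) (Icc 1 R)) (hP : ContinuousAt P R)
    (hext : ExtendsToSlit F (fun z => P z - c * Complex.log (R - z)) R) :
    P R = c * Real.log (R - 1) + ∫ x in (1 : ℝ)..R, g x := by
  have hT : ∀ x : ℝ, x < R →
      HasDerivAt (fun x : ℝ => F x + c * Complex.log (R - x)) (g x) x := fun x hx => by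
    have hre : (x : ℂ).re < R := by simpa using hx
    exact (((hF x hre).add (hasDerivAt_const_mul_log_sub c
      (sub_mem_slitPlane_of_re_lt hre))).congr_deriv (by ring)).comp_ofReal
  have hone : F (1 : ℝ) + c * Complex.log (R - (1 : ℝ)) = c * Real.log (R - 1) := by
    rw [Complex.ofReal_one, hF1, zero_add, Complex.ofReal_log (by linarith)]
    push_cast; rfl
  have hlim : Tendsto (fun x : ℝ => F x + c * Complex.log (R - x)) (𝓝[<] R) (𝓝 (P R)) := by
    have hx := tendsto_ofReal_nhdsLT R
    refine ((hP.tendsto.mono_left nhdsWithin_le_nhds).comp hx).congr' ?_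
    filter_upwards [hx.eventually hext.eventuallyEq] with x hFx
    rw [hFx, sub_add_cancel, Function.comp_apply]
  have hFTC := intervalIntegral.integral_eq_sub_of_hasDerivAt_of_tendsto hR
    (fun x hx => hT x hx.2)
    (ContinuousOn.intervalIntegrable (by rwa [uIcc_of_le hR.le]))
    (hone ▸ (hT 1 hR).continuousAt.tendsto.mono_left nhdsWithin_le_nhds) hlim
  rw [hFTC]
  ring

/-- Along the real axis `exp (κ F)` grows like a negative power of `R - x`. -/
lemma ExtendsToSlit.not_continuableAt_exp {C κ : ℝ} (hR : 0 < R) (hc : 0 < c) (hC : 0 < C)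
    (hκ : 0 < κ) (hP : ContinuousAt P R)
    (hext : ExtendsToSlit F (fun z => P z - c * Complex.log (R - z)) R) :
    ¬ ContinuableAt (fun z => C * Complex.exp (κ * F z)) (Metric.ball 0 R) R := by
  rintro ⟨k, hk, hkF⟩
  have hx := tendsto_ofReal_ball hR
  have htop : Tendsto (fun x : ℝ => C * Real.exp (κ * ((P x).re + -c * Real.log (R - x))))
      (𝓝[<] R) atTop := by
    refine Tendsto.const_mul_atTop hC (Real.tendsto_exp_atTop.comp
      (Tendsto.const_mul_atTop hκ (Tendsto.add_atTop
        ((Complex.continuous_re.tendsto _).comp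
          ((hP.tendsto.mono_left nhdsWithin_le_nhds).comp hx))
        ((Real.tendsto_log_nhdsGT_zero.comp (tendsto_sub_nhdsLT R)).const_mul_atBot_of_neg
          (neg_lt_zero.2 hc)))))
  refine not_tendsto_nhds_of_tendsto_atTop htop _
    (((hk.continuousAt.tendsto.mono_left nhdsWithin_le_nhds).comp hx).norm.congr' ?_)
  filter_upwards [hx.eventually hkF, (tendsto_ofReal_nhdsLT R).eventually hext.eventuallyEq,
    self_mem_nhdsWithin] with x hkx hFx hlt
  have hlog : Complex.log (R - x) = (Real.log (R - x) : ℝ) := by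
    rw [Complex.ofReal_log (sub_nonneg.2 (le_of_lt hlt))]; push_cast; rfl
  rw [Function.comp_apply, hkx, hFx, hlog, norm_mul, Complex.norm_exp, Complex.norm_real,
    norm_of_nonneg hC.le, Complex.re_ofReal_mul, ← Complex.ofReal_mul, Complex.sub_re,
    Complex.ofReal_re, neg_mul, sub_eq_add_neg]

end Logarithm

lemma isEquivalent_exp_log {l : Filter ℂ} {R : ℂ} (hl : l ≤ 𝓝 R) (hlR : ∀ᶠ z in l, z ≠ R)
    {G P : ℂ → ℂ} {C κ c : ℂ} (hP : ContinuousAt P R) (hC : C ≠ 0)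
    (hG : ∀ᶠ z in l, G z = C * Complex.exp (κ * (P z - c * Complex.log (R - z)))) :
    G ~[l] fun z => C * Complex.exp (κ * P R) * (R - z) ^ (-(κ * c)) := by
  have hconst : (fun z => C * Complex.exp (κ * P z)) ~[l] fun _ => C * Complex.exp (κ * P R) :=
    (isEquivalent_const_iff_tendsto (mul_ne_zero hC (Complex.exp_ne_zero _))).2
      ((hP.const_mul κ).cexp.const_mul C |>.tendsto.mono_left hl)
  refine (hconst.mul (IsEquivalent.refl (u := fun z => (R - z) ^ (-(κ * c))))).congr_left ?_
  filter_upwards [hG, hlR] with z hz hne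
  rw [Pi.mul_apply, hz, Complex.cpow_def_of_ne_zero (sub_ne_zero.2 hne.symm), mul_assoc,
    ← Complex.exp_add]
  ring_nf

namespace IsRetrialModel

variable {M : ℕ → ℂ → ℂ} {m : ℕ → ℝ → ℝ} {A a b u₀ uStar : ℝ}

lemma hasDerivAt_reducedDenom_zMapInv_uStar (hM : IsRetrialModel M m A a b u₀ uStar)
    (hlt : uStar < u₀) :
    HasDerivAt (fun z => reducedDenom M a b (zMapInv M a b u₀ z))
      (-(((a + b) * m 1 uStar - 1) / uStar * (b / (1 - a * m 1 uStar))) : ℝ)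
      (zMapReal m a b uStar : ℂ) := by
  have hinv : zMapInv M a b u₀ (zMapReal m a b uStar) = uStar := hM.zMapInv_ofReal hlt
  have hD : HasDerivAt (reducedDenom M a b) _ (zMapInv M a b u₀ (zMapReal m a b uStar)) :=
    hinv.symm ▸ hM.hasDerivAt_reducedDenom_uStar
  have hRlt : (zMapReal m a b uStar : ℂ).re < zMapReal m a b u₀ := by
    simpa using hM.zMapReal_lt_zMapReal_u₀ hlt
  refine (hD.comp _ (hM.hasDerivAt_zMapInv hRlt)).congr_deriv ?_
  rw [hinv, hM.ofReal 1 uStar hM.uStar_lt]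
  push_cast
  ring

lemma zMapReal_uStar_sub_one_mul_div (hM : IsRetrialModel M m A a b u₀ uStar)
    (hlt : uStar < u₀) :
    (zMapReal m a b uStar - 1) * (1 - a * m 1 uStar) / ((a + b) * m 1 uStar - 1) =
      b * (1 / (a + b)) / (((a + b) * m 1 uStar - 1) / uStar * (b / (1 - a * m 1 uStar))) := by
  have := (sub_pos.2 (hM.mul_real_one_lt_one hlt)).ne'
  have := (sub_pos.2 hM.one_lt_mul_real_uStar).ne'
  have := hM.uStar_pos.ne'
  have := hM.b_pos.ne'
  have hab := hM.add_pos.ne'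
  rw [eq_div_of_mul_eq hab ((mul_comm _ _).trans hM.mul_zMapReal_uStar_sub_one)]
  field_simp

lemma exists_f₁Lift_zMapInv_eq_add_div (hM : IsRetrialModel M m A a b u₀ uStar)
    (hlt : uStar < u₀) :
    ∃ (V : Set ℂ) (g : ℂ → ℂ), IsOpen V ∧ (zMapReal m a b uStar : ℂ) ∈ V ∧
      {z | z.re < zMapReal m a b uStar} ⊆ V ∧ DifferentiableOn ℂ g V ∧
      ∀ z : ℂ, z.re < zMapReal m a b uStar → f₁Lift M a b (zMapInv M a b u₀ z) = g z +
        ((zMapReal m a b uStar - 1) * (1 - a * m 1 uStar) / ((a + b) * m 1 uStar - 1) : ℝ) /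
          (zMapReal m a b uStar - z) := by
  have hRlt := hM.zMapReal_lt_zMapReal_u₀ hlt
  have hRW : (zMapReal m a b uStar : ℂ) ∈ {z : ℂ | z.re < zMapReal m a b u₀} := by simpa using hRlt
  have hinv : zMapInv M a b u₀ (zMapReal m a b uStar) = uStar := hM.zMapInv_ofReal hlt
  have hmaps : MapsTo (zMapInv M a b u₀) {z | z.re < zMapReal m a b u₀} {u | u.re < A} :=
    fun z hz => (hM.zMapInv_re_lt le_rfl hz).trans hM.u₀_lt
  have hderiv_pos : 0 < ((a + b) * m 1 uStar - 1) / uStar * (b / (1 - a * m 1 uStar)) := by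
    have := sub_pos.2 (hM.mul_real_one_lt_one hlt)
    have := sub_pos.2 hM.one_lt_mul_real_uStar
    have := hM.uStar_pos
    have := hM.b_pos
    positivity
  obtain ⟨V, g, hV, hRV, hVsub, hg, heq⟩ := exists_div_eq_add_div_sub
    (Complex.isOpen_re_lt _) hRW
    ((hM.differentiableOn_dslope.comp hM.differentiableOn_zMapInv hmaps).const_mul (b : ℂ))
    ((hM.differentiableOn_reducedDenom a b).comp hM.differentiableOn_zMapInv hmaps)
    ((congrArg _ hinv).trans hM.reducedDenom_uStar)
    (hM.hasDerivAt_reducedDenom_zMapInv_uStar hlt)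
    (by exact_mod_cast (neg_neg_of_pos hderiv_pos).ne)
  have hleft : {z : ℂ | z.re < zMapReal m a b uStar} ⊆ V := fun z hz =>
    hVsub z (lt_trans hz hRlt) (hM.reducedDenom_zMapInv_ne_zero (by rwa [min_eq_right hlt.le]))
  refine ⟨V, g, hV, hRV, hleft, hg, fun z hz => ?_⟩
  have hne : z ≠ zMapReal m a b uStar := fun h => by simp [h] at hz
  refine (heq z (hleft hz) hne).trans ?_
  rw [hM.zMapReal_uStar_sub_one_mul_div hlt, Function.comp_apply, hinv, hM.dslope_uStar,
    ← neg_sub (_ : ℂ) z, Complex.ofReal_neg, div_neg, div_neg, neg_div, neg_neg]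
  push_cast
  rfl

end IsRetrialModel

/-! ### The functions `h`, `f₁`, `f₂` and `Q` in the variable `u` -/

lemma f₂_ofReal (μ : Measure ℝ) (a b ν R : ℝ) :
    f₂ μ a b ν R = ((a + b) / ν : ℝ) * ∫ x in (1 : ℝ)..R, f₁ μ a b x := by
  have hpath : ∀ t : ℝ, (R : ℂ) + t * (1 - R) = (R + (1 - R) * t : ℝ) := fun t => by
    push_cast; ring
  have hsubst := intervalIntegral.smul_integral_comp_add_mul (a := 0) (b := 1)
    (fun x : ℝ => f₁ μ a b x) (1 - R) R
  rw [mul_zero, add_zero, mul_one, add_sub_cancel, Complex.real_smul] at hsubst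
  simp only [f₂, hpath]
  rw [neg_mul, ← mul_neg, ← Complex.ofReal_one, ← Complex.ofReal_sub, hsubst,
    ← intervalIntegral.integral_symm]

namespace IsCriticalFamily

variable {μ : Measure ℝ} {A a b u₀ : ℝ}

lemma norm_moment_zMapInv_lt_one {M : ℕ → ℂ → ℂ} {m : ℕ → ℝ → ℝ}
    (hM : IsCriticalFamily M m A a b u₀) {z : ℂ} (hz : z.re < 1) :
    ‖M 0 (zMapInv M a b u₀ z)‖ < 1 := by
  have hu0 : (zMapInv M a b u₀ z).re < 0 :=
    hM.zMapInv_re_lt hM.u₀_pos.le (by rwa [hM.zMapReal_zero])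
  have huA := hu0.trans hM.bound_pos
  rw [← hM.real_zero]
  exact (hM.norm_le 0 _ huA).trans_lt (hM.strictMonoOn_real 0 huA hM.bound_pos hu0)

lemma isRoot_iff (hM : IsCriticalFamily (complexMoment μ) (realMoment μ) A a b u₀) {z w : ℂ}
    (hz : ‖z‖ < 1) :
    IsRoot μ a b z w ↔ w = complexMoment μ 0 (zMapInv (complexMoment μ) a b u₀ z) := by
  have hb : (b : ℂ) ≠ 0 := hM.ofReal_b_ne_zero
  have hz1 : z.re < 1 := (Complex.re_le_norm z).trans_lt hz
  constructor
  · rintro ⟨hw, hroot⟩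
    rw [LST_eq_complexMoment] at hroot
    set u := -((a : ℂ) * (1 - w) + b * (1 - z)) with hu
    have hw1 : w.re < 1 := (Complex.re_le_norm w).trans_lt hw
    have hure : u.re < u₀ := by
      have hre : u.re = -(a * (1 - w.re) + b * (1 - z.re)) := by simp [hu]
      have := mul_pos hM.a_pos (sub_pos.2 hw1)
      have := mul_pos hM.b_pos (sub_pos.2 hz1)
      linarith [hM.u₀_pos]
    have huz : zMap (complexMoment μ) a b u = z := by
      rw [zMap, ← hroot, hu]
      field_simp
      ring
    rw [hM.zMapInv_eq hure huz]
    exact hroot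
  · rintro rfl
    refine ⟨hM.norm_moment_zMapInv_lt_one hz1, ?_⟩
    have hzMap := hM.zMap_zMapInv (hz1.trans hM.one_lt_zMapReal_u₀)
    rw [LST_eq_complexMoment]
    congr 1
    rw [eq_neg_iff_add_eq_zero]
    conv in b * (1 - z) => rw [← hzMap, zMap]
    field_simp
    ring

lemma iteratedDeriv_hRoot (hM : IsCriticalFamily (complexMoment μ) (realMoment μ) A a b u₀)
    (n : ℕ) :
    iteratedDeriv n (hRoot μ a b) 0 =
      iteratedDeriv n (fun z => complexMoment μ 0 (zMapInv (complexMoment μ) a b u₀ z)) 0 := by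
  refine Filter.EventuallyEq.iteratedDeriv_eq n ?_
  filter_upwards [Metric.ball_mem_nhds (0 : ℂ) one_pos] with z hz
  have hz : ‖z‖ < 1 := by simpa using hz
  exact (hM.isRoot_iff hz).1 (Classical.epsilon_spec (p := IsRoot μ a b z)
    ⟨_, (hM.isRoot_iff hz).2 rfl⟩)

lemma h_eq (hM : IsCriticalFamily (complexMoment μ) (realMoment μ) A a b u₀) {z : ℂ}
    (hz : ‖z‖ < zMapReal (realMoment μ) a b u₀) :
    h μ a b z = complexMoment μ 0 (zMapInv (complexMoment μ) a b u₀ z) := by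
  obtain ⟨c, -, hc⟩ := hM.exists_taylor_coeff
  rw [← (hM.hasSum_moment_zMapInv hc hz).tsum_eq, h]
  exact tsum_congr fun n => by rw [hM.iteratedDeriv_hRoot, hc]

lemma isRoot_iff_eq_h (hM : IsCriticalFamily (complexMoment μ) (realMoment μ) A a b u₀) {z w : ℂ}
    (hz : ‖z‖ < 1) : IsRoot μ a b z w ↔ w = h μ a b z := by
  rw [hM.isRoot_iff hz, hM.h_eq (hz.trans hM.one_lt_zMapReal_u₀)]

lemma h_zMapReal_u₀ (hM : IsCriticalFamily (complexMoment μ) (realMoment μ) A a b u₀) :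
    h μ a b (zMapReal (realMoment μ) a b u₀) = realMoment μ 0 u₀ := by
  obtain ⟨c, hc0, hc⟩ := hM.exists_taylor_coeff
  rw [← hM.tsum_taylor_coeff hc0 hc, h]
  exact tsum_congr fun n => by rw [hM.iteratedDeriv_hRoot, hc]

lemma h_zMapReal (hM : IsCriticalFamily (complexMoment μ) (realMoment μ) A a b u₀) {y : ℝ}
    (hy0 : 0 ≤ y) (hy : y ≤ u₀) :
    h μ a b (zMapReal (realMoment μ) a b y) = realMoment μ 0 y := by
  rcases hy.eq_or_lt with rfl | hlt
  · exact hM.h_zMapReal_u₀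
  · have hone : 1 ≤ zMapReal (realMoment μ) a b y := by
      rw [← hM.zMapReal_zero]
      exact hM.strictMonoOn_zMapReal.monotoneOn (mem_Iic.2 hM.u₀_pos.le) (mem_Iic.2 hy) hy0
    have hnorm : ‖(zMapReal (realMoment μ) a b y : ℂ)‖ < zMapReal (realMoment μ) a b u₀ := by
      rw [Complex.norm_real, norm_of_nonneg (zero_le_one.trans hone)]
      exact hM.zMapReal_lt_zMapReal_u₀ hlt
    rw [hM.h_eq hnorm, hM.zMapInv_ofReal hlt, hM.ofReal 0 y (hlt.trans hM.u₀_lt)]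

lemma exists_zMapReal_eq_of_le {M : ℕ → ℂ → ℂ} {m : ℕ → ℝ → ℝ}
    (hM : IsCriticalFamily M m A a b u₀) {x : ℝ} (hx1 : 1 < x) (hx : x ≤ zMapReal m a b u₀) :
    ∃ y, 0 < y ∧ y ≤ u₀ ∧ zMapReal m a b y = x := by
  obtain ⟨y, hy, rfl⟩ : ∃ y ≤ u₀, zMapReal m a b y = x := by
    rcases hx.eq_or_lt with rfl | hlt
    · exact ⟨u₀, le_rfl, rfl⟩
    · exact (hM.exists_zMapReal_eq hlt).imp fun y => And.imp_left le_of_lt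
  rw [← hM.zMapReal_zero] at hx1
  exact ⟨y, (hM.strictMonoOn_zMapReal.lt_iff_lt (mem_Iic.2 hM.u₀_pos.le) (mem_Iic.2 hy)).1 hx1,
    hy, rfl⟩

lemma isDominantSingularity_h (hM : IsCriticalFamily (complexMoment μ) (realMoment μ) A a b u₀) :
    IsDominantSingularity (h μ a b) (zMapReal (realMoment μ) a b u₀) := by
  have hR := one_pos.trans hM.one_lt_zMapReal_u₀
  refine isDominantSingularity_of_re_lt hR (hM.differentiableOn_moment_zMapInv 0) ?_
    hM.not_continuableAt_moment_zMapInv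
  filter_upwards [Metric.ball_mem_nhds (0 : ℂ) hR] with z hz
  exact (hM.h_eq (by simpa using hz)).symm

lemma f₁_eq (hM : IsCriticalFamily (complexMoment μ) (realMoment μ) A a b u₀) {z : ℂ}
    (hz : ‖z‖ < zMapReal (realMoment μ) a b u₀) (hz1 : z ≠ 1) :
    f₁ μ a b z = f₁Lift (complexMoment μ) a b (zMapInv (complexMoment μ) a b u₀ z) := by
  have hzMap := hM.zMap_zMapInv ((Complex.re_le_norm z).trans_lt hz)
  have hne : zMapInv (complexMoment μ) a b u₀ z ≠ 0 := fun h0 => hz1 (by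
    rw [← hzMap, h0, zMap, hM.zero]
    simp)
  rw [hM.f₁Lift_eq hM.b_pos.ne' hne, hzMap, f₁, hM.h_eq hz]

lemma f₁_zMapReal_u₀ (hM : IsCriticalFamily (complexMoment μ) (realMoment μ) A a b u₀) :
    f₁ μ a b (zMapReal (realMoment μ) a b u₀) = f₁Lift (complexMoment μ) a b u₀ := by
  rw [hM.f₁Lift_eq hM.b_pos.ne' (by exact_mod_cast hM.u₀_pos.ne'), hM.zMap_ofReal hM.u₀_lt, f₁,
    hM.h_zMapReal_u₀, hM.ofReal 0 u₀ hM.u₀_lt]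

lemma f₁_ofReal (hM : IsCriticalFamily (complexMoment μ) (realMoment μ) A a b u₀) {x : ℝ}
    (hx1 : 1 < x) (hx : x < zMapReal (realMoment μ) a b u₀) :
    f₁ μ a b x = f₁Lift (complexMoment μ) a b (zMapInv (complexMoment μ) a b u₀ x) := by
  refine hM.f₁_eq ?_ (by exact_mod_cast hx1.ne')
  rwa [Complex.norm_real, norm_of_nonneg (zero_le_one.trans hx1.le)]

lemma integral_f₁_ofReal (hM : IsCriticalFamily (complexMoment μ) (realMoment μ) A a b u₀) {R : ℝ}
    (hR1 : 1 ≤ R) (hR : R ≤ zMapReal (realMoment μ) a b u₀) :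
    ∫ x in (1 : ℝ)..R, f₁ μ a b x =
      ∫ x in (1 : ℝ)..R, f₁Lift (complexMoment μ) a b (zMapInv (complexMoment μ) a b u₀ x) :=
  intervalIntegral.integral_congr_Ioo_of_le hR1 fun _ hx =>
    hM.f₁_ofReal hx.1 (hx.2.trans_le hR)

end IsCriticalFamily

lemma IsRetrialModel.real_zero_eq_zMapReal_iff {M : ℕ → ℂ → ℂ} {m : ℕ → ℝ → ℝ}
    {A a b u₀ uStar : ℝ} (hM : IsRetrialModel M m A a b u₀ uStar) {y : ℝ} (hy0 : 0 < y)
    (hyA : y < A) : m 0 y = zMapReal m a b y ↔ y = uStar := by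
  have heq : m 0 y = zMapReal m a b y ↔ (a + b) * (m 0 y - 1) = y := by
    rw [zMapReal, ← sub_eq_iff_eq_add', eq_div_iff hM.b_pos.ne']
    constructor <;> intro <;> linarith
  rw [heq]
  refine ⟨hM.eq_uStar hy0 hyA, ?_⟩
  rintro rfl
  exact hM.mul_uStar

namespace IsRetrialModel

variable {μ : Measure ℝ} {A a b u₀ uStar ν : ℝ}

lemma h_ofReal_eq_self_iff (hM : IsRetrialModel (complexMoment μ) (realMoment μ) A a b u₀ uStar)
    {x : ℝ} :
    (1 < x ∧ x ≤ zMapReal (realMoment μ) a b u₀ ∧ h μ a b x = x) ↔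
      uStar ≤ u₀ ∧ x = zMapReal (realMoment μ) a b uStar := by
  constructor
  · rintro ⟨hx1, hxR, hfix⟩
    obtain ⟨y, hy0, hy, rfl⟩ := hM.exists_zMapReal_eq_of_le hx1 hxR
    rw [hM.h_zMapReal hy0.le hy, Complex.ofReal_inj,
      hM.real_zero_eq_zMapReal_iff hy0 (hy.trans_lt hM.u₀_lt)] at hfix
    exact hfix ▸ ⟨hy, rfl⟩
  · rintro ⟨hle, rfl⟩
    have hmem := mem_Iic.2 hle
    refine ⟨hM.zMapReal_zero ▸
        hM.strictMonoOn_zMapReal (mem_Iic.2 hM.u₀_pos.le) hmem hM.uStar_pos,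
      hM.strictMonoOn_zMapReal.monotoneOn hmem self_mem_Iic hle, ?_⟩
    rw [hM.h_zMapReal hM.uStar_pos.le hle, Complex.ofReal_inj,
      hM.real_zero_eq_zMapReal_iff hM.uStar_pos hM.uStar_lt]

lemma isRstar_iff (hM : IsRetrialModel (complexMoment μ) (realMoment μ) A a b u₀ uStar) {r : ℝ} :
    IsRstar μ a b (zMapReal (realMoment μ) a b u₀) r ↔
      uStar ≤ u₀ ∧ r = zMapReal (realMoment μ) a b uStar := by
  rw [IsRstar, Set.ext fun x => hM.h_ofReal_eq_self_iff (x := x)]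
  exact ⟨And.left, fun hr => ⟨hr, fun x hx => (hr.2.trans hx.2.symm).le⟩⟩

lemma isDominantSingularity_f₁
    (hM : IsRetrialModel (complexMoment μ) (realMoment μ) A a b u₀ uStar) :
    IsDominantSingularity (f₁ μ a b) (zMapReal (realMoment μ) a b (min u₀ uStar)) := by
  refine isDominantSingularity_of_re_lt (one_pos.trans hM.one_lt_zMapReal_min)
    hM.differentiableOn_f₁Lift_zMapInv ?_ hM.not_continuableAt_f₁Lift_zMapInv
  filter_upwards [Metric.ball_mem_nhds (0 : ℂ) one_pos] with z hz
  have hz : ‖z‖ < 1 := by simpa using hz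
  exact (hM.f₁_eq (hz.trans hM.one_lt_zMapReal_u₀) (by rintro rfl; simp at hz)).symm

section Primitive

variable {R : ℝ} {F : ℂ → ℂ}
  (hM : IsRetrialModel (complexMoment μ) (realMoment μ) A a b u₀ uStar)
  (hR : R = zMapReal (realMoment μ) a b (min u₀ uStar)) (hF1 : F 1 = 0)
  (hF : ∀ z : ℂ, z.re < R →
    HasDerivAt F (f₁Lift (complexMoment μ) a b (zMapInv (complexMoment μ) a b u₀ z)) z)

include hM hR hF1 hF

lemma f₂_eq {z : ℂ} (hz : ‖z‖ < R) : f₂ μ a b ν z = ((a + b) / ν : ℝ) * F z := by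
  subst hR
  rcases eq_or_ne z 1 with rfl | hz1
  · simp [f₂, hF1]
  have hsegment : ∀ t ∈ Icc (0 : ℝ) 1,
      ‖z + t * (1 - z)‖ < zMapReal (realMoment μ) a b (min u₀ uStar) := fun t ht => by
    simpa using (convex_ball (0 : ℂ) _).add_smul_sub_mem (by simpa using hz)
      (by simpa using hM.one_lt_zMapReal_min) ht
  have hre := fun t ht => (Complex.re_le_norm _).trans_lt (hsegment t ht)
  have hcongr : EqOn (fun t : ℝ => f₁ μ a b (z + t * (1 - z)))
      (fun t => f₁Lift (complexMoment μ) a b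
        (zMapInv (complexMoment μ) a b u₀ (z + t * (1 - z)))) (Ioo 0 1) := fun t ht => by
    refine hM.f₁_eq
      ((hsegment t (Ioo_subset_Icc_self ht)).trans_le hM.zMapReal_min_le) fun hone => ?_
    have hprod : (1 - (t : ℂ)) * (1 - z) = 0 := by linear_combination -hone
    rcases mul_eq_zero.1 hprod with ht1 | hz0
    · exact ht.2.ne' (by exact_mod_cast sub_eq_zero.1 ht1)
    · exact hz1 (sub_eq_zero.1 hz0).symm
  have hFTC := intervalIntegral.integral_unitInterval_deriv_eq_sub (𝕜 := ℂ) (z₀ := z) (z₁ := 1 - z)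
    (f := F) (f' := fun z => f₁Lift (complexMoment μ) a b (zMapInv (complexMoment μ) a b u₀ z))
    (hM.differentiableOn_f₁Lift_zMapInv.continuousOn.comp (by fun_prop)
      fun t ht => by simpa using hre t ht) fun t ht => hF _ (by simpa using hre t ht)
  simp only [add_sub_cancel, hF1, smul_eq_mul, Complex.real_smul] at hFTC
  rw [f₂, intervalIntegral.integral_congr_Ioo_of_le zero_le_one hcongr, hFTC]
  ring

lemma isDominantSingularity_Q
    (hn : ¬ ContinuableAt
      (fun z => (1 - load μ a b : ℝ) * Complex.exp (((a + b) / ν : ℝ) * F z))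
      (Metric.ball 0 R) R) :
    IsDominantSingularity (Q μ a b ν) R := by
  have hR0 : 0 < R := hR ▸ one_pos.trans hM.one_lt_zMapReal_min
  refine isDominantSingularity_of_re_lt hR0
    (fun z hz => (((hF z hz).const_mul _).cexp.const_mul _).differentiableAt.differentiableWithinAt)
    ?_ hn
  filter_upwards [Metric.ball_mem_nhds (0 : ℂ) hR0] with z hz
  rw [Q, hM.f₂_eq hR hF1 hF (by simpa using hz)]

lemma hasSingularExpansion_Q {L p g : ℂ → ℂ} (hdom : IsDominantSingularity (Q μ a b ν) R)
    (hL : ExtendsToSlit F L R)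
    (hexpand : ∀ (l : Filter ℂ) (Qc : ℂ → ℂ), l ≤ 𝓝[≠] (R : ℂ) →
      (∀ᶠ z in l, Qc z = (1 - load μ a b : ℝ) * Complex.exp (((a + b) / ν : ℝ) * L z)) →
        (fun z => Qc z - p z) ~[l] g) :
    HasSingularExpansion (Q μ a b ν) R p g := by
  obtain ⟨S, hS, G, hG, hGF, hGL⟩ := hL.exists_deltaDomain hdom.1
    fun z hz => (hF z hz).differentiableAt.differentiableWithinAt
  refine ⟨hdom, S, hS, fun z => (1 - load μ a b : ℝ) * Complex.exp (((a + b) / ν : ℝ) * G z),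
    fun z hz => analyticAt_const.mul (analyticAt_const.mul (hG z hz)).cexp, fun z hz => ?_,
    hexpand _ _ (nhdsWithin_mono _ fun z hz => hz.2.1) (hGL.mono fun z hz => by simp only [hz])⟩
  simp only [Q, hM.f₂_eq hR hF1 hF (by simpa using hz), hGF z (ball_subset_re_lt _ hz)]

lemma isDominantSingularity_Q_of_tendsto (hν : 0 < ν) (hload : load μ a b < 1) {ℓ : ℂ}
    (hlim : Tendsto F (𝓝[{z : ℂ | z.re < R}] (R : ℂ)) (𝓝 ℓ)) :
    IsDominantSingularity (Q μ a b ν) R :=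
  hM.isDominantSingularity_Q hR hF1 hF fun hcont => by
    subst hR
    exact hM.not_continuableAt_f₁Lift_zMapInv <| continuableAt_of_exp
      (by exact_mod_cast (sub_pos.2 hload).ne') (by exact_mod_cast (div_pos hM.add_pos hν).ne')
      (one_pos.trans hM.one_lt_zMapReal_min) (fun z hz => hF z (ball_subset_re_lt _ hz))
      (hlim.mono_left (nhdsWithin_mono _ (ball_subset_re_lt _))) hcont

lemma exists_f₂_eq_of_tendsto {ℓ : ℂ}
    (hlim : Tendsto F (𝓝[{z : ℂ | z.re < R}] (R : ℂ)) (𝓝 ℓ)) :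
    ∃ β : ℝ, ℓ = β ∧ f₂ μ a b ν R = ((a + b) / ν * β : ℝ) := by
  subst hR
  obtain ⟨β, hβ, hint⟩ := exists_integral_eq_of_real_nonneg hM.one_lt_zMapReal_min hF1 hF
    (fun x => hM.exists_f₁Lift_zMapInv_eq_nonneg) hlim
  refine ⟨β, hβ, ?_⟩
  rw [f₂_ofReal, hM.integral_f₁_ofReal hM.one_lt_zMapReal_min.le hM.zMapReal_min_le, hint,
    Complex.ofReal_mul]

lemma one_sub_load_mul_exp_eq {ℓ : ℂ}
    (hlim : Tendsto F (𝓝[{z : ℂ | z.re < R}] (R : ℂ)) (𝓝 ℓ)) :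
    (1 - load μ a b : ℝ) * Complex.exp (((a + b) / ν : ℝ) * ℓ) = Q μ a b ν R ∧
      Q μ a b ν R = ((1 - load μ a b) * Real.exp (f₂ μ a b ν R).re : ℝ) := by
  obtain ⟨β, rfl, hf₂⟩ := hM.exists_f₂_eq_of_tendsto (ν := ν) hR hF1 hF hlim
  simp only [Q, hf₂, Complex.ofReal_mul, Complex.ofReal_exp, true_and]
  norm_cast

end Primitive

end IsRetrialModel

/-! ### The expansions of `Q` -/

lemma ExtendsToSlit.tendsto_of_sqrt {F B : ℂ → ℂ} {R : ℝ}
    (hext : ExtendsToSlit F (fun z => B (R - z).sqrt) R) (hB : ContinuousAt B 0) :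
    Tendsto F (𝓝[{z : ℂ | z.re < R}] (R : ℂ)) (𝓝 (B 0)) :=
  ((hB.tendsto.comp (tendsto_complexSqrt_sub R)).mono_left nhdsWithin_le_nhds).congr'
    hext.eventuallyEq.symm

lemma complexSqrt_pow_three (z : ℂ) : z.sqrt ^ 3 = z ^ (3 / 2 : ℂ) := by
  rw [Complex.sqrt, ← Complex.cpow_nat_mul]
  norm_num

variable {μ : Measure ℝ} {A a b u₀ uStar ν : ℝ}

lemma Q_ne_zero (hload : load μ a b < 1) (z : ℂ) : Q μ a b ν z ≠ 0 :=
  mul_ne_zero (by exact_mod_cast (sub_pos.2 hload).ne') (Complex.exp_ne_zero _)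

lemma ofReal_cQ1_eq {R : ℝ} (hR : 1 < R) {p : ℂ}
    (hp : p = cF1 μ a b R * Real.log (R - 1) +
      (∫ x in (1 : ℝ)..R, ((f₁ μ a b x).re - cF1 μ a b R / (R - x)) : ℝ)) :
    (cQ1 μ a b ν R : ℂ) = (1 - load μ a b : ℝ) * Complex.exp (((a + b) / ν : ℝ) * p) := by
  rw [cQ1, intervalIntegral.integral_symm, Real.rpow_def_of_pos (sub_pos.2 hR), mul_assoc,
    ← Real.exp_add, hp]
  push_cast
  congr 2
  ring

namespace IsCriticalFamily

lemma cH_eq (hM : IsCriticalFamily (complexMoment μ) (realMoment μ) A a b u₀) :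
    cH μ a b (zMapReal (realMoment μ) a b u₀) = √(2 * b / (a ^ 3 * realMoment μ 2 u₀)) := by
  have hb := hM.b_pos.ne'
  have harg : a * (1 - realMoment μ 0 u₀) + b * (1 - zMapReal (realMoment μ) a b u₀) = -u₀ := by
    rw [zMapReal]
    field_simp
    ring
  rw [cH, hM.h_zMapReal_u₀, Complex.ofReal_re, harg,
    iteratedDeriv_two_realLST_neg hM.toIsMomentFamily hM.u₀_lt]

lemma cF2_eq (hM : IsCriticalFamily (complexMoment μ) (realMoment μ) A a b u₀) :
    cF2 μ a b (zMapReal (realMoment μ) a b u₀) = (zMapReal (realMoment μ) a b u₀ - 1) /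
      (realMoment μ 0 u₀ - zMapReal (realMoment μ) a b u₀) ^ 2 *
        √(2 * b / (a ^ 3 * realMoment μ 2 u₀)) := by
  rw [cF2, hM.h_zMapReal_u₀, Complex.ofReal_re, hM.cH_eq]

lemma cF3_eq (hM : IsCriticalFamily (complexMoment μ) (realMoment μ) A a b u₀) :
    cF3 μ a b (zMapReal (realMoment μ) a b u₀) =
      (zMapReal (realMoment μ) a b u₀ - 1) / √(2 * b / (a ^ 3 * realMoment μ 2 u₀)) := by
  rw [cF3, hM.cH_eq]

lemma ofReal_re_f₁_zMapReal_u₀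
    (hM : IsCriticalFamily (complexMoment μ) (realMoment μ) A a b u₀) :
    ((f₁ μ a b (zMapReal (realMoment μ) a b u₀)).re : ℂ) = f₁Lift (complexMoment μ) a b u₀ := by
  rw [← hM.f₁_zMapReal_u₀, f₁, hM.h_zMapReal_u₀]
  norm_cast

end IsCriticalFamily

namespace IsRetrialModel

lemma cF1_eq (hM : IsRetrialModel (complexMoment μ) (realMoment μ) A a b u₀ uStar) :
    cF1 μ a b (zMapReal (realMoment μ) a b uStar) = (zMapReal (realMoment μ) a b uStar - 1) *
      (1 - a * realMoment μ 1 uStar) / ((a + b) * realMoment μ 1 uStar - 1) := by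
  have harg : (a + b) * (1 - zMapReal (realMoment μ) a b uStar) = -uStar := by
    linarith [hM.mul_zMapReal_uStar_sub_one]
  rw [cF1, harg, deriv_realLST_neg hM.toIsMomentFamily hM.uStar_lt, ← neg_div_neg_eq]
  congr 1 <;> ring

lemma hasSingularExpansion_Q_of_lt
    (hM : IsRetrialModel (complexMoment μ) (realMoment μ) A a b u₀ uStar) (hν : 0 < ν)
    (hload : load μ a b < 1) (hlt : u₀ < uStar) {R : ℝ}
    (hR : R = zMapReal (realMoment μ) a b u₀) :
    HasSingularExpansion (Q μ a b ν) R (fun z => Q μ a b ν R - cQlin μ a b ν R * (R - z))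
      fun z => cQ2 μ a b ν R * (R - z) ^ (3 / 2 : ℂ) := by
  have hRmin : R = zMapReal (realMoment μ) a b (min u₀ uStar) := by rw [hR, min_eq_left hlt.le]
  obtain ⟨F, hF1, hF⟩ := hM.exists_primitive_f₁Lift_zMapInv
  rw [← hRmin] at hF
  obtain ⟨B, p, hB, hp0, hp, hext⟩ := hM.exists_sqrt_primitive_of_lt hlt (by rwa [← hR])
  rw [← hM.cF2_eq, ← hR] at hp
  rw [← hR] at hext
  rw [← hM.ofReal_re_f₁_zMapReal_u₀, ← hR] at hp0
  have hlim := hext.tendsto_of_sqrt hB.self_of_nhds.continuousAt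
  have hdom := hM.isDominantSingularity_Q_of_tendsto hRmin hF1 hF hν hload hlim
  obtain ⟨hQ, hQre⟩ := hM.one_sub_load_mul_exp_eq (ν := ν) hRmin hF1 hF hlim
  refine hM.hasSingularExpansion_Q hRmin hF1 hF hdom hext fun l Qc hl hQc => ?_
  have hlin : Q μ a b ν R * ((a + b) / ν : ℝ) * p 0 = cQlin μ a b ν R := by
    rw [hp0, hQre, cQlin]
    push_cast
    ring
  have hlead : -(2 / 3) * (Q μ a b ν R * ((a + b) / ν : ℝ) * -(cF2 μ a b R : ℂ)) =
      cQ2 μ a b ν R := by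
    rw [hQre, cQ2]
    push_cast
    ring
  have hcF2 : cF2 μ a b R ≠ 0 := by
    rw [hR, hM.cF2_eq]
    exact mul_ne_zero (div_ne_zero (sub_pos.2 hM.one_lt_zMapReal_u₀).ne'
      (pow_ne_zero 2 <|
        hM.real_sub_zMapReal_ne_zero hM.u₀_pos hM.u₀_lt hlt.ne)) hM.sqrt_coeff_pos.ne'
  have hne : Q μ a b ν R * ((a + b) / ν : ℝ) * -(cF2 μ a b R : ℂ) ≠ 0 :=
    mul_ne_zero (mul_ne_zero (Q_ne_zero hload _)
      (by exact_mod_cast (div_pos hM.add_pos hν).ne')) (neg_ne_zero.2 (by exact_mod_cast hcF2))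
  have hequiv := isEquivalent_sqrt_cubed (hl.trans nhdsWithin_le_nhds) hB hp (hQ ▸ hne) hQc
  simpa only [hQ, hlin, hlead, complexSqrt_pow_three] using hequiv

lemma hasSingularExpansion_Q_of_eq
    (hM : IsRetrialModel (complexMoment μ) (realMoment μ) A a b u₀ u₀) (hν : 0 < ν)
    (hload : load μ a b < 1) {R : ℝ} (hR : R = zMapReal (realMoment μ) a b u₀) :
    HasSingularExpansion (Q μ a b ν) R (fun _ => Q μ a b ν R)
      fun z => -(cQ3 μ a b ν R * (R - z) ^ (1 / 2 : ℂ)) := by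
  obtain ⟨F, hF1, hF⟩ := hM.exists_primitive_f₁Lift_zMapInv
  have hRmin : R = zMapReal (realMoment μ) a b (min u₀ u₀) := by rw [hR, min_self]
  rw [← hRmin] at hF
  obtain ⟨B, e, hB, he0, hext⟩ := hM.exists_sqrt_primitive_of_eq (by rwa [← hR])
  rw [← hM.cF3_eq, ← hR] at he0
  rw [← hR] at hext
  have hlim := hext.tendsto_of_sqrt hB.self_of_nhds.continuousAt
  have hdom := hM.isDominantSingularity_Q_of_tendsto hRmin hF1 hF hν hload hlim
  obtain ⟨hQ, hQre⟩ := hM.one_sub_load_mul_exp_eq (ν := ν) hRmin hF1 hF hlim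
  refine hM.hasSingularExpansion_Q hRmin hF1 hF hdom hext fun l Qc hl hQc => ?_
  have hlead : Q μ a b ν R * ((a + b) / ν : ℝ) * e 0 = -cQ3 μ a b ν R := by
    rw [he0, hQre, cQ3]
    push_cast
    ring
  have hcF3 : 0 < cF3 μ a b R := by
    rw [hR, hM.cF3_eq]
    exact div_pos (sub_pos.2 hM.one_lt_zMapReal_u₀) hM.sqrt_coeff_pos
  have hne : cQ3 μ a b ν R ≠ 0 := by
    have := sub_pos.2 hload
    have := hM.add_pos
    rw [cQ3]
    positivity
  have hequiv := isEquivalent_sqrt (hl.trans nhdsWithin_le_nhds) hB.self_of_nhds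
    (by rw [hQ, hlead]; exact_mod_cast neg_ne_zero.2 hne) hQc
  simpa only [hQ, hlead, Complex.sqrt, one_div, neg_mul] using hequiv

lemma cF1_pos (hM : IsRetrialModel (complexMoment μ) (realMoment μ) A a b u₀ uStar)
    (hlt : uStar < u₀) : 0 < cF1 μ a b (zMapReal (realMoment μ) a b uStar) := by
  rw [hM.cF1_eq]
  exact div_pos (mul_pos (sub_pos.2 (min_eq_right hlt.le ▸ hM.one_lt_zMapReal_min))
    (sub_pos.2 (hM.mul_real_one_lt_one hlt))) (sub_pos.2 hM.one_lt_mul_real_uStar)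

lemma integral_re_f₁_sub_eq
    (hM : IsRetrialModel (complexMoment μ) (realMoment μ) A a b u₀ uStar) {R c : ℝ}
    (hR : R = zMapReal (realMoment μ) a b (min u₀ uStar)) {g : ℂ → ℂ}
    (hg : ∀ z : ℂ, z.re < R → f₁Lift (complexMoment μ) a b (zMapInv (complexMoment μ) a b u₀ z) =
      g z + c / (R - z)) :
    ((∫ x in (1 : ℝ)..R, ((f₁ μ a b x).re - c / (R - x)) : ℝ) : ℂ) =
      ∫ x in (1 : ℝ)..R, g x := by
  subst hR
  rw [← intervalIntegral.integral_ofReal]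
  refine intervalIntegral.integral_congr_Ioo_of_le hM.one_lt_zMapReal_min.le fun x hx => ?_
  obtain ⟨r, -, hr⟩ := hM.exists_f₁Lift_zMapInv_eq_nonneg hx.1 hx.2
  have hgx := hg x (by simpa using hx.2)
  simp only [hM.f₁_ofReal hx.1 (hx.2.trans_le hM.zMapReal_min_le), hr, Complex.ofReal_re]
  rw [← sub_eq_iff_eq_add.2 hgx, hr]
  push_cast
  rfl

lemma hasSingularExpansion_Q_of_gt
    (hM : IsRetrialModel (complexMoment μ) (realMoment μ) A a b u₀ uStar) (hν : 0 < ν)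
    (hload : load μ a b < 1) (hlt : uStar < u₀) {R : ℝ}
    (hR : R = zMapReal (realMoment μ) a b uStar) :
    HasSingularExpansion (Q μ a b ν) R 0
      fun z => cQ1 μ a b ν R * (R - z) ^ (-(((a + b) / ν * cF1 μ a b R : ℝ) : ℂ)) := by
  have hRmin : R = zMapReal (realMoment μ) a b (min u₀ uStar) := by rw [hR, min_eq_right hlt.le]
  have hR1 : 1 < R := hRmin ▸ hM.one_lt_zMapReal_min
  have hκ := div_pos hM.add_pos hν
  obtain ⟨F, hF1, hF⟩ := hM.exists_primitive_f₁Lift_zMapInv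
  obtain ⟨V, g, hV, hRV, hVsub, hg, hpole⟩ := hM.exists_f₁Lift_zMapInv_eq_add_div hlt
  have hc := hM.cF1_pos hlt
  rw [← hM.cF1_eq] at hpole
  rw [← hRmin] at hF
  rw [← hR] at hRV hVsub hpole hc
  have hF' : ∀ z : ℂ, z.re < R → HasDerivAt F (g z + (cF1 μ a b R : ℝ) / (R - z)) z :=
    fun z hz => hpole z hz ▸ hF z hz
  obtain ⟨P, hP, hext⟩ := exists_log_primitive hV hRV hg hF'
  have hgcont : ContinuousOn (fun x : ℝ => g x) (Icc 1 R) :=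
    hg.continuousOn.comp (by fun_prop) fun x hx => hx.2.eq_or_lt.elim (fun h => h ▸ hRV)
      fun h => hVsub (by simpa using h)
  have hPR := hext.eq_log_add_integral hR1 hF1 hF' hgcont hP
  rw [← hM.integral_re_f₁_sub_eq hRmin hpole] at hPR
  have hdom := hM.isDominantSingularity_Q hRmin hF1 hF
    (hext.not_continuableAt_exp (one_pos.trans hR1) hc (sub_pos.2 hload) hκ hP)
  refine hM.hasSingularExpansion_Q hRmin hF1 hF hdom hext fun l Qc hl hQc => ?_
  have hequiv := isEquivalent_exp_log (hl.trans nhdsWithin_le_nhds)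
    (hl self_mem_nhdsWithin) hP (by exact_mod_cast (sub_pos.2 hload).ne') hQc
  rw [← ofReal_cQ1_eq hR1 hPR, ← Complex.ofReal_mul] at hequiv
  simpa only [Pi.zero_apply, sub_zero] using hequiv

end IsRetrialModel

lemma exists_isRetrialModel {μ : Measure ℝ} [IsProbabilityMeasure μ] (hμ : μ (Iio 0) = 0)
    (hType : IsType1 μ) {a b : ℝ} (ha : 0 < a) (hb : 0 < b) (hload : load μ a b < 1) :
    ∃ A u₀ uStar : ℝ, IsRetrialModel (complexMoment μ) (realMoment μ) A a b u₀ uStar := by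
  obtain ⟨v, hv, hvR, hsec⟩ := hType.exists_lt_mul_realMoment_zero_sub_one hμ ha
  obtain ⟨A, hvA, hAR⟩ := EReal.lt_iff_exists_real_btwn.1 hvR
  have hvA : v < A := by exact_mod_cast hvA
  have hM := isMomentFamily_moments hμ (hType.measure_Ioi_pos hμ) (hv.trans hvA) hAR
  have hsub : (a + b) * realMoment μ 1 0 < 1 := by simpa [realMoment, load] using hload
  have hab := lt_add_of_pos_right a hb
  have hmean := hM.pos 1 0 hM.bound_pos
  have hlarge := pos_of_mul_pos_right (hv.trans hsec) ha.le
  obtain ⟨u₀, hu₀, hu₀A, hcrit⟩ := hM.exists_mul_real_one_eq_one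
    ((mul_lt_mul_of_pos_right hab hmean).trans hsub) hv hvA hsec
  obtain ⟨uStar, huStar, huStarA, hstar⟩ := hM.exists_mul_real_sub_one_eq hsub hv hvA
    (hsec.trans (mul_lt_mul_of_pos_right hab hlarge))
  exact ⟨A, u₀, uStar, { hM with
    a_pos := ha, b_pos := hb, u₀_pos := hu₀, u₀_lt := hu₀A, mul_real_u₀ := hcrit
    uStar_pos := huStar, uStar_lt := huStarA, mul_uStar := hstar, subcritical := hsub }⟩

end PriorityRetrial

theorem mainTheorem2
    (μ : Measure ℝ) [IsProbabilityMeasure μ] (hμ : μ (Set.Iio 0) = 0) (hType : IsType1 μ)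
    (lam₁ lam₂ ν : ℝ) (hlam₁ : 0 < lam₁) (hlam₂ : 0 < lam₂) (hν : 0 < ν)
    (hload : load μ lam₁ lam₂ < 1) :
    -- `h` is well defined: it is the unique root in the open unit disc
    (∀ z : ℂ, ‖z‖ < 1 → ∀ w : ℂ, IsRoot μ lam₁ lam₂ z w ↔ w = PriorityRetrial.h μ lam₁ lam₂ z) ∧
    ∃ Rh Rf RQ : ℝ,
      IsDominantSingularity (PriorityRetrial.h μ lam₁ lam₂) Rh ∧
      IsDominantSingularity (f₁ μ lam₁ lam₂) Rf ∧
      IsDominantSingularity (Q μ lam₁ lam₂ ν) RQ ∧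
      RQ = Rf ∧
      -- `Qc` is the analytic continuation of `Q` to a Delta-domain at `RQ`
      ∃ S φ : ℝ, RQ < S ∧ 0 < φ ∧ φ < π / 2 ∧
      ∃ Qc : ℂ → ℂ, AnalyticOnNhd ℂ Qc (DeltaDomain RQ S φ) ∧
        Set.EqOn Qc (Q μ lam₁ lam₂ ν) (Metric.ball 0 RQ) ∧
        -- first case: `R*` exists and is smaller than `Rh`
        (∀ Rstar : ℝ, IsRstar μ lam₁ lam₂ Rh Rstar → Rstar < Rh →
          RQ = Rstar ∧
          Qc ~[𝓝[DeltaDomain RQ S φ] (RQ : ℂ)] fun z : ℂ =>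
            (cQ1 μ lam₁ lam₂ ν RQ : ℂ) *
              ((RQ : ℂ) - z) ^ (-(((lam₁ + lam₂) / ν * cF1 μ lam₁ lam₂ RQ : ℝ) : ℂ))) ∧
        -- second case: `R*` does not exist
        ((¬ ∃ Rstar : ℝ, IsRstar μ lam₁ lam₂ Rh Rstar) →
          RQ = Rh ∧
          (fun z : ℂ => Qc z -
              (Q μ lam₁ lam₂ ν (RQ : ℂ) - (cQlin μ lam₁ lam₂ ν RQ : ℂ) * ((RQ : ℂ) - z)))
            ~[𝓝[DeltaDomain RQ S φ] (RQ : ℂ)] fun z : ℂ =>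
              (cQ2 μ lam₁ lam₂ ν RQ : ℂ) * ((RQ : ℂ) - z) ^ (3 / 2 : ℂ)) ∧
        -- third case: `R*` exists and equals `Rh`
        (∀ Rstar : ℝ, IsRstar μ lam₁ lam₂ Rh Rstar → Rstar = Rh →
          RQ = Rstar ∧
          (fun z : ℂ => Qc z - Q μ lam₁ lam₂ ν (RQ : ℂ))
            ~[𝓝[DeltaDomain RQ S φ] (RQ : ℂ)] fun z : ℂ =>
              -((cQ3 μ lam₁ lam₂ ν RQ : ℂ) * ((RQ : ℂ) - z) ^ (1 / 2 : ℂ))) := by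
  obtain ⟨A, u₀, uStar, hM⟩ := exists_isRetrialModel hμ hType hlam₁ hlam₂ hload
  have hφ : 0 < π / 4 ∧ π / 4 < π / 2 := by constructor <;> linarith [Real.pi_pos]
  refine ⟨fun z hz w => hM.isRoot_iff_eq_h hz, _, _,
    zMapReal (realMoment μ) lam₁ lam₂ (min u₀ uStar), hM.isDominantSingularity_h,
    hM.isDominantSingularity_f₁, ?_⟩
  simp only [hM.isRstar_iff]
  rcases lt_trichotomy u₀ uStar with hlt | rfl | hlt
  · rw [min_eq_left hlt.le]
    obtain ⟨hdom, S, hS, Qc, hQc, hQ, hasymp⟩ := hM.hasSingularExpansion_Q_of_lt hν hload hlt rfl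
    exact ⟨hdom, trivial, S, π / 4, hS, hφ.1, hφ.2, Qc, hQc, hQ,
      fun _ hr => absurd hr.1 hlt.not_ge, fun _ => ⟨rfl, hasymp⟩,
      fun _ hr => absurd hr.1 hlt.not_ge⟩
  · rw [min_self]
    obtain ⟨hdom, S, hS, Qc, hQc, hQ, hasymp⟩ := hM.hasSingularExpansion_Q_of_eq hν hload rfl
    exact ⟨hdom, trivial, S, π / 4, hS, hφ.1, hφ.2, Qc, hQc, hQ,
      fun _ hr hne => absurd hr.2 hne.ne, fun hno => absurd ⟨_, le_rfl, rfl⟩ hno,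
      fun _ hr _ => ⟨hr.2.symm, hasymp⟩⟩
  · rw [min_eq_right hlt.le]
    obtain ⟨hdom, S, hS, Qc, hQc, hQ, hasymp⟩ := hM.hasSingularExpansion_Q_of_gt hν hload hlt rfl
    have hne := (hM.zMapReal_lt_zMapReal_u₀ hlt).ne
    exact ⟨hdom, trivial, S, π / 4, hS, hφ.1, hφ.2, Qc, hQc, hQ,
      fun _ hr _ => ⟨hr.2.symm, by simpa using hasymp⟩, fun hno => absurd ⟨_, hlt.le, rfl⟩ hno,
      fun _ hr heq => absurd (hr.2.symm.trans heq) hne⟩
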